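/- **Setting.** Let $\kappa_{i+1/2,j}>0$ and $\kappa_{i,j+1/2}>0$ be diffusivities that are $p_x$-periodic in $i$ and $p_y$-periodic in $j$. On a lattice with spacings $d_x,d_y>0$ consider the heterogeneous diffusion $$\partial_t u_{i,j}=\tfrac1{d_x^2}\big[\kappa_{i+\frac12,j}(u_{i+1,j}-u_{i,j})+\kappa_{i-\frac12,j}(u_{i-1,j}-u_{i,j})\big]+\tfrac1{d_y^2}\big[\kappa_{i,j+\frac12}(u_{i,j+1}-u_{i,j})+\kappa_{i,j-\frac12}(u_{i,j-1}-u_{i,j})\big],$$ and the ensemble of all its $p_xp_y$ phase shifts, written in the spatially homogeneous form $$\begin{aligned}\partial_t v_{i,j,k,\ell}={}&\tfrac1{d_x^2}\big[\kappa_{k+\frac12,\ell}(v_{i+1,j,k+1,\ell}-v_{i,j,k,\ell})+\kappa_{k-\frac12,\ell}(v_{i-1,j,k-1,\ell}-v_{i,j,k,\ell})\big]\\&+\tfrac1{d_y^2}\big[\kappa_{k,\ell+\frac12}(v_{i,j+1,k,\ell+1}-v_{i,j,k,\ell})+\kappa_{k,\ell-\frac12}(v_{i,j-1,k,\ell-1}-v_{i,j,k,\ell})\big],\end{aligned}$$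 with $k$ modulo $p_x$ and $\ell$ modulo $p_y$. **Homogenisation.** For a wavenumber $q=(q_x,q_y)$ put $v_{i,j,k,\ell}=e^{\mathrm i(q_xd_xi+q_yd_yj)}w_{k,\ell}(t)$ in the ensemble, so that $\partial_tw=A(q)w$ with a Hermitian matrix $A(q)$; let $\Lambda(q)$ be the largest eigenvalue of $A(q)$. For all $d_x,d_y>0$ the homogenisation is well defined: near $q=0$, $\Lambda$ is real analytic, there is an analytic slow manifold $w=\hat V\,W(q)$ parametrised by the ensemble mean $\hat V$ (that is, $A(q)W(q)=\Lambda(q)W(q)$, $W(q)$ has mean $1$, and $W(0)$ is the constant vector $1$), all other modes have rates $\le-\beta$ for some $\beta>0$, and $\Lambda(q)=-(K_{xx}q_x^2+2K_{xy}q_xq_y+K_{yy}q_y^2)+O(|q|^4)$ with a positive definite form. The homogenised evolution is $\partial_t\hat V=\Lambda(q)\hat V$, that is, $\partial_tV=K_{xx}V_{xx}+2K_{xy}V_{xy}+K_{yy}V_{yy}+(\text{fourth and higher order})$. **Patch scheme.** On an $L_x\times L_y$-periodic domain there are $N_x\times N_y$ patches with spacings $H_x=L_x/N_x$, $H_y=L_y/N_y$.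 Each has $n_x\times n_y$ interior points $i=1{:}n_x$, $j=1{:}n_y$, with $n_xd_x=r_xH_x$, $n_yd_y=r_yH_y$, $0<r_x,r_y\le1$. The lattice equations hold at the interior points of each patch $(I,J)$, with the edge values $$v^{I,J}_{n_x+1,j}=E_x^{r_x}v^{I,J}_{1,j},\quad v^{I,J}_{0,j}=E_x^{-r_x}v^{I,J}_{n_x,j},\quad v^{I,J}_{i,n_y+1}=E_y^{r_y}v^{I,J}_{i,1},\quad v^{I,J}_{i,0}=E_y^{-r_y}v^{I,J}_{i,n_y},$$ for each ensemble index $(k,\ell)$ in the case of the ensemble. In each direction $E^{\pm r}$, the fractional shift of the patch index, is realised either by spectral (Fourier) interpolation over all the patches in that direction, or by the Lagrangian interpolation $$E^{r}\approx 1+\sum_{k=1}^{P}\Big(\prod_{l=0}^{k-1}(r^2-l^2)\Big)\frac{(2k/r)\,\mu\delta^{2k-1}+\delta^{2k}}{(2k)!}$$ from $P$ neighbours on either side ($\mu,\delta$ being the macroscale mean and central difference operators). Put $e(H)=0$ for spectral and $e(H)=H^{2P}$ for Lagrangian coupling, and $\varepsilon=e_x(H_x)+e_y(H_y)$; the couplings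 in the two directions may differ. **Consistency.** The scheme is *consistent with the homogenisation* if there is $\beta>0$ such that for all $L_x,L_y>0$ and all integers $a,b$ there are $C$ and $N_0$ such that the following holds for all $N_x,N_y\ge N_0$ and all $r_x,r_y\in(0,1]$. Let $q=(2\pi a/L_x,2\pi b/L_y)$ and $d=\max(d_x,d_y)$, and consider the solutions $v$ of the patch scheme that vary from patch to patch with wavenumber $q$, that is, by the factors $e^{\mathrm iq_xH_x}$ and $e^{\mathrm iq_yH_y}$ between neighbouring patches. 1. Every such $v$ is a sum $v^{\rm slow}+v^{\rm fast}$ of two such solutions with, in the $\ell^2$ norm over any patch, $\|\partial_tv^{\rm slow}-\Lambda(q)v^{\rm slow}\|\le C\varepsilon\,\|v^{\rm slow}\|$ at all times and $\|v^{\rm fast}(t)\|\le e^{-\beta t/d^2}\|v(0)\|$ for $t\ge0$. 2. There is such a solution $v^{\rm slow}$, with the same residual bound, whose average over the patch $(0,0)$ (and over the ensemble, if there is one) at $t=0$ is $1$, and all of whose values in this patch at $t=0$ differ from $1$ by at most $Cd$. So the macroscale dynamics of the scheme are those of the homogenisation, exactly for spectral coupling, and to arbitrarily high order in $H$ for Lagrangian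 coupling as $P$ may be any number. **Corollary.** The homogenisation is well defined as described, and: (a) for all patch sizes $n_x,n_y\ge1$, the patch scheme applied to the ensemble is consistent with the homogenisation; (b) if $p_x\mid n_x$ and $p_y\mid n_y$, the patch scheme applied to a single realisation of the heterogeneous diffusion (any one phase shift $(\varphi,\psi)$ of the diffusivities, the same in all patches; no ensemble) is consistent with the homogenisation. -/

import Mathlib

open Complex Filter Topology

/-! ### Periodic diffusivities and the homogenisation

Diffusivities that are `(px, py)`-periodic are functions on `ZMod px × ZMod py`:
`κx k l` is the diffusivity between the lattice points `(k, l)` and `(k + 1, l)`, and `κy k l` is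
the one between `(k, l)` and `(k, l + 1)`.  Fields are complex valued; as all coefficients are real,
real fields are covered (real and imaginary parts evolve independently). -/

/-- The ensemble system on the whole lattice is
`∂ₜ v (i, j, k, l) =
  (κx k l (v (i+1, j, k+1, l) - v (i, j, k, l)) +
    κx (k-1) l (v (i-1, j, k-1, l) - v (i, j, k, l))) / dx² + (the same in y)`.
On the Fourier modes `v (i, j, k, l) = exp (𝐢 (qx dx i + qy dy j)) w (k, l)` of physical wavenumber
`(qx, qy)` it becomes `∂ₜ w = ensembleSymbol κx κy dx dy qx qy w`.  Equally,
`u (i, j) = exp (𝐢 (qx dx i + qy dy j)) w (i, j)` are the Bloch waves of the heterogeneous diffusion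
itself. -/
noncomputable def ensembleSymbol {px py : ℕ} (κx κy : ZMod px → ZMod py → ℝ) (dx dy qx qy : ℝ)
    (w : ZMod px → ZMod py → ℂ) : ZMod px → ZMod py → ℂ := fun k l =>
  ((κx k l : ℂ) * (exp (I * qx * dx) * w (k + 1) l - w k l)
    + (κx (k - 1) l : ℂ) * (exp (-(I * qx * dx)) * w (k - 1) l - w k l)) / (dx : ℂ) ^ 2
  + ((κy k l : ℂ) * (exp (I * qy * dy) * w k (l + 1) - w k l)
    + (κy k (l - 1) : ℂ) * (exp (-(I * qy * dy)) * w k (l - 1) - w k l)) / (dy : ℂ) ^ 2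

/-- `μ` is a growth rate of the Fourier modes of wavenumber `(qx, qy)`, with mode shape `w`. -/
def IsLatticeMode {px py : ℕ} (κx κy : ZMod px → ZMod py → ℝ) (dx dy : ℝ) (q : ℝ × ℝ)
    (μ : ℝ) (w : ZMod px → ZMod py → ℂ) : Prop :=
  w ≠ 0 ∧ ensembleSymbol κx κy dx dy q.1 q.2 w = (μ : ℂ) • w

/-- The homogenised evolution in Fourier space: the rate of the slowest mode of wavenumber `q`,
so that the homogenised macroscale field obeys `∂ₜ V̂ = homRate κx κy dx dy q * V̂`. -/
noncomputable def homRate {px py : ℕ} (κx κy : ZMod px → ZMod py → ℝ) (dx dy : ℝ)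
    (q : ℝ × ℝ) : ℝ :=
  sSup {μ : ℝ | ∃ w, IsLatticeMode κx κy dx dy q μ w}

/-- `∂ₜ V̂ = Λ(q) V̂` is the homogenisation of the heterogeneous diffusion: for small wavenumber `q`
the ensemble system in Fourier space has an analytic slow manifold `w = V̂ • W q`, parametrised by
the ensemble mean `V̂`, with evolution `∂ₜ V̂ = Λ(q) V̂` on it, and every other mode decays at a rate
bounded away from zero.  The power series of `Λ` starts with the second order terms, with a positive
definite effective diffusivity, so that the homogenised PDE is
`∂ₜ V = Kxx V_xx + 2 Kxy V_xy + Kyy V_yy + (terms of fourth and higher order)`. -/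
def IsHomogenisation {px py : ℕ} [NeZero px] [NeZero py] (κx κy : ZMod px → ZMod py → ℝ)
    (dx dy : ℝ) (Λ : ℝ × ℝ → ℝ) : Prop :=
  AnalyticAt ℝ Λ 0 ∧
  (∃ W : ℝ × ℝ → ZMod px → ZMod py → ℂ,
    AnalyticAt ℝ W 0 ∧ W 0 = 1 ∧
    (∀ᶠ q in 𝓝 (0 : ℝ × ℝ), (∑ k, ∑ l, W q k l) / ((px : ℂ) * (py : ℂ)) = 1 ∧
      ensembleSymbol κx κy dx dy q.1 q.2 (W q) = (Λ q : ℂ) • W q) ∧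
    ∃ β : ℝ, 0 < β ∧ ∀ᶠ q in 𝓝 (0 : ℝ × ℝ), ∀ μ w, IsLatticeMode κx κy dx dy q μ w →
      (∃ c : ℂ, w = c • W q) ∨ μ ≤ -β) ∧
  ∃ Kxx Kxy Kyy : ℝ,
    (∀ q : ℝ × ℝ, q ≠ 0 → 0 < Kxx * q.1 ^ 2 + 2 * Kxy * q.1 * q.2 + Kyy * q.2 ^ 2) ∧
    (fun q : ℝ × ℝ => Λ q + (Kxx * q.1 ^ 2 + 2 * Kxy * q.1 * q.2 + Kyy * q.2 ^ 2))
      =O[𝓝 0] fun q => ‖q‖ ^ 4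

/-! ### Interpolation between patches

A macroscale field at `N` equally spaced patches on a periodic domain is a function on `ZMod N`. -/

/-- The squared centred difference `δ²`. -/
def macroDelta2 {N : ℕ} (f : ZMod N → ℂ) : ZMod N → ℂ :=
  fun A => f (A + 1) - 2 * f A + f (A - 1)

/-- The mean centred difference `μδ`. -/
noncomputable def macroMuDelta {N : ℕ} (f : ZMod N → ℂ) : ZMod N → ℂ :=
  fun A => (f (A + 1) - f (A - 1)) / 2

/-- Lagrangian interpolation from `P` neighbours on either side:
`E^r ≈ 1 + ∑ₖ (∏_{l<k} (r² - l²)) ((2k/r) μδ^{2k-1} + δ^{2k}) / (2k)!`, `k = 1, …, P`. -/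
noncomputable def lagrangeShift (P : ℕ) {N : ℕ} (r : ℝ) (f : ZMod N → ℂ) : ZMod N → ℂ := fun A =>
  f A + ∑ k ∈ Finset.Icc 1 P,
    ((∏ l ∈ Finset.range k, (r ^ 2 - (l : ℝ) ^ 2) : ℝ) : ℂ) *
      ((((2 * k : ℝ) / r : ℝ) : ℂ) * macroMuDelta (macroDelta2^[k - 1] f) A
        + (macroDelta2^[k] f) A) / ((2 * k).factorial : ℂ)

/-- The discrete Fourier coefficient of wavenumber index `m`. -/
noncomputable def fourierCoeffPatch {N : ℕ} [NeZero N] (f : ZMod N → ℂ) (m : ℤ) : ℂ :=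
  (∑ B, f B * exp (-(2 * Real.pi * I * m * (B.val : ℂ) / N))) / N

/-- Spectral interpolation, `E^r f = ∑ₘ f̂ₘ exp (2 π 𝐢 m (A + r) / N)`, over a set of wavenumbers that
is closed under negation: `|m| ≤ N / 2`, where for even `N` the coefficient of the highest frequency
is shared equally by `m = N / 2` and `m = -N / 2`. -/
noncomputable def spectralShift {N : ℕ} [NeZero N] (r : ℝ) (f : ZMod N → ℂ) : ZMod N → ℂ := fun A =>
  ∑ m ∈ (Finset.Icc (-(N : ℤ)) N).filter (fun m => 2 * |m| ≤ (N : ℤ)),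
    (if 2 * |m| = (N : ℤ) then (1 / 2 : ℂ) else 1) * fourierCoeffPatch f m *
      exp (2 * Real.pi * I * m * ((A.val : ℂ) + r) / N)

/-- The two ways of coupling patches. -/
inductive Coupling where
  | spectral : Coupling
  | lagrange (P : ℕ) : Coupling

/-- The realisation of the fractional macroscale shift `E^r`. -/
noncomputable def Coupling.shift (c : Coupling) {N : ℕ} [NeZero N] (r : ℝ) (f : ZMod N → ℂ) :
    ZMod N → ℂ :=
  match c with
  | .spectral => spectralShift r f
  | .lagrange P => lagrangeShift P r f

/-- The size of the consistency error at patch spacing `H`: none for spectral coupling, `H^{2P}` for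
Lagrangian coupling with `P` neighbours. -/
def Coupling.error (c : Coupling) (H : ℝ) : ℝ :=
  match c with
  | .spectral => 0
  | .lagrange P => H ^ (2 * P)

/-! ### Patch schemes -/

/-- The values at `i = 0, 1, …, n + 1` of a row of a patch with interior values
`w = (w₁, …, wₙ)` (indexed from zero by `Fin n`) and edge values `left` and `right`. -/
def withEdges {n : ℕ} (left right : ℂ) (w : Fin n → ℂ) (i : ℕ) : ℂ :=
  if i = 0 then left else if h : i - 1 < n then w ⟨i - 1, h⟩ else right

/-- The first interior point of a patch. -/
def firstPt (n : ℕ) [NeZero n] : Fin n := ⟨0, Nat.pos_of_neZero n⟩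

/-- The last interior point of a patch. -/
def lastPt (n : ℕ) [NeZero n] : Fin n := ⟨n - 1, Nat.sub_lt (Nat.pos_of_neZero n) one_pos⟩

/-- The row of a patch `A`, given the interior values of the rows at the same position in all the
patches: the right edge is interpolated from the first interior values by `E^r`,
the left edge from the last interior values by `E^{-r}`. -/
noncomputable def coupledRow (c : Coupling) {N n : ℕ} [NeZero N] [NeZero n] (r : ℝ)
    (w : ZMod N → Fin n → ℂ) (A : ZMod N) : ℕ → ℂ :=
  withEdges (c.shift (-r) (fun K => w K (lastPt n)) A) (c.shift r (fun K => w K (firstPt n)) A) (w A)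

/-- Fields on `Nx × Ny` patches; `σ` indexes the variables inside a patch. -/
abbrev PatchField (Nx Ny : ℕ) (σ : Type) : Type := ZMod Nx → ZMod Ny → σ → ℂ

/-- A patch scheme gives, for any numbers of patches `Nx`, `Ny`, size ratios `rx`, `ry` and
microscale spacings `dx`, `dy`, the right-hand side of a system of ODEs. -/
abbrev PatchScheme (σ : Type) : Type :=
  ∀ (Nx Ny : ℕ) [NeZero Nx] [NeZero Ny], (rx ry dx dy : ℝ) →
    PatchField Nx Ny σ → PatchField Nx Ny σ

/-- The patch scheme for the ensemble of all phase shifts.  The variables inside a patch are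
`v (i, j, k, l)` with `(i, j)` the position and `(k, l)` the ensemble index.  Patch edge values
are interpolated from next-to-edge values with the same ensemble index. -/
noncomputable def ensembleScheme {px py : ℕ} (κx κy : ZMod px → ZMod py → ℝ) (nx ny : ℕ)
    [NeZero nx] [NeZero ny] (cx cy : Coupling) :
    PatchScheme (Fin nx × Fin ny × ZMod px × ZMod py) :=
  fun _ _ _ _ rx ry dx dy v A B s =>
    let i := s.1
    let j := s.2.1
    let k := s.2.2.1
    let l := s.2.2.2
    let xrow := fun k' => coupledRow cx rx (fun K i' => v K B (i', j, k', l)) A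
    let yrow := fun l' => coupledRow cy ry (fun K j' => v A K (i, j', k, l')) B
    ((κx k l : ℂ) * (xrow (k + 1) (i.val + 2) - v A B s)
      + (κx (k - 1) l : ℂ) * (xrow (k - 1) i.val - v A B s)) / (dx : ℂ) ^ 2
    + ((κy k l : ℂ) * (yrow (l + 1) (j.val + 2) - v A B s)
      + (κy k (l - 1) : ℂ) * (yrow (l - 1) j.val - v A B s)) / (dy : ℂ) ^ 2

/-- The patch scheme for a single realisation, with phase shift `(φ, ψ)`: the diffusivities to the
right of and above the interior point `(i, j)` (counted from `1`) are `κx (i + φ) (j + ψ)` and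
`κy (i + φ) (j + ψ)`. -/
noncomputable def singleScheme {px py : ℕ} (κx κy : ZMod px → ZMod py → ℝ) (φ : ZMod px)
    (ψ : ZMod py) (nx ny : ℕ) [NeZero nx] [NeZero ny] (cx cy : Coupling) :
    PatchScheme (Fin nx × Fin ny) :=
  fun _ _ _ _ rx ry dx dy u A B s =>
    let i := s.1
    let j := s.2
    let k : ZMod px := ((i.val + 1 : ℕ) : ZMod px) + φ
    let l : ZMod py := ((j.val + 1 : ℕ) : ZMod py) + ψ
    let xrow := coupledRow cx rx (fun K i' => u K B (i', j)) A
    let yrow := coupledRow cy ry (fun K j' => u A K (i, j')) B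
    ((κx k l : ℂ) * (xrow (i.val + 2) - u A B s)
      + (κx (k - 1) l : ℂ) * (xrow i.val - u A B s)) / (dx : ℂ) ^ 2
    + ((κy k l : ℂ) * (yrow (j.val + 2) - u A B s)
      + (κy k (l - 1) : ℂ) * (yrow j.val - u A B s)) / (dy : ℂ) ^ 2

/-! ### Consistency -/

section Consistency

variable {Nx Ny : ℕ} {σ : Type}

/-- `v` solves the system of ODEs `∂ₜ v = F v`, and its variation from patch to patch is that of a
plane wave: with `qx = 2 π a / Lx` and spacing `Hx = Lx / Nx` the factor between neighbours in `x` is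
`exp (𝐢 qx Hx) = exp (2 π 𝐢 a / Nx)`, and likewise in `y`. -/
def IsWaveSolution (F : PatchField Nx Ny σ → PatchField Nx Ny σ) (a b : ℤ)
    (v : ℝ → PatchField Nx Ny σ) : Prop :=
  (∀ t A B s, HasDerivAt (fun τ => v τ A B s) (F (v t) A B s) t) ∧
  (∀ t A B s, v t (A + 1) B s = exp (2 * Real.pi * I * a / Nx) * v t A B s) ∧
  (∀ t A B s, v t A (B + 1) s = exp (2 * Real.pi * I * b / Ny) * v t A B s)

/-- The solution `v` obeys the homogenised evolution `∂ₜ v = Λ v` up to the relative residual `ε`,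
in the mean square over each patch. -/
def ObeysRate [Fintype σ] (F : PatchField Nx Ny σ → PatchField Nx Ny σ) (Λ ε : ℝ)
    (v : ℝ → PatchField Nx Ny σ) : Prop :=
  ∀ t A B, ∑ s, ‖F (v t) A B s - (Λ : ℂ) * v t A B s‖ ^ 2 ≤ ε ^ 2 * ∑ s, ‖v t A B s‖ ^ 2

/-- The macroscale dynamics of `∂ₜ v = F v` at macroscale wavenumber index `(a, b)` is `∂ₜ V = Λ V`,
up to the relative residual `ε`:
every solution is the sum of a solution that obeys `∂ₜ v = Λ v` up to `ε` and of a sub-patch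
transient that decays at rate `γ`; and there is a solution of the former sort whose macroscale
field (the average over the patch, and over the ensemble if there is one) is initially the plane
wave normalised to be `1` at patch `(0, 0)`, with microscale fluctuations at most `η`. -/
def HasMacroscaleRate [Fintype σ] (F : PatchField Nx Ny σ → PatchField Nx Ny σ) (a b : ℤ)
    (Λ ε γ η : ℝ) : Prop :=
  (∀ v, IsWaveSolution F a b v → ∃ slow fast, IsWaveSolution F a b slow ∧
    IsWaveSolution F a b fast ∧ v = slow + fast ∧ ObeysRate F Λ ε slow ∧
    ∀ t, 0 ≤ t → ∀ A B, ∑ s, ‖fast t A B s‖ ^ 2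
      ≤ Real.exp (-2 * γ * t) * ∑ s, ‖v 0 A B s‖ ^ 2) ∧
  ∃ slow, IsWaveSolution F a b slow ∧ ObeysRate F Λ ε slow ∧
    (∑ s, slow 0 0 0 s) / (Fintype.card σ : ℂ) = 1 ∧ ∀ s, ‖slow 0 0 0 s - 1‖ ≤ η

end Consistency

/-- The patch scheme (patches of `nx × ny` points, coupled by `cx` in `x` and `cy` in `y`)
is consistent with the homogenisation, with error `O(cx.error Hx + cy.error Hy)` in the patch
spacings `Hx = Lx / Nx`, `Hy = Ly / Ny`.  The patch widths are `nx dx = rx Hx` and `ny dy = ry Hy`,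
and the estimates are uniform in the size ratios `rx`, `ry`. -/
def IsConsistent {px py : ℕ} (κx κy : ZMod px → ZMod py → ℝ) (nx ny : ℕ) (cx cy : Coupling)
    {σ : Type} [Fintype σ] (scheme : PatchScheme σ) : Prop :=
  ∃ β : ℝ, 0 < β ∧ ∀ Lx Ly : ℝ, 0 < Lx → 0 < Ly → ∀ a b : ℤ, ∃ C : ℝ, ∃ N₀ : ℕ,
    ∀ (Nx Ny : ℕ) [NeZero Nx] [NeZero Ny], N₀ ≤ Nx → N₀ ≤ Ny →
    ∀ rx ry : ℝ, 0 < rx → rx ≤ 1 → 0 < ry → ry ≤ 1 →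
    ∀ Hx Hy dx dy : ℝ, Hx = Lx / Nx → Hy = Ly / Ny → dx = rx * Hx / nx → dy = ry * Hy / ny →
      HasMacroscaleRate (scheme Nx Ny rx ry dx dy) a b
        (homRate κx κy dx dy (2 * Real.pi * a / Lx, 2 * Real.pi * b / Ly))
        (C * (cx.error Hx + cy.error Hy)) (β / max dx dy ^ 2) (C * max dx dy)

/-!
On plane waves, the Fourier symbol of the ensemble system and the patch schemes are all the same
kind of operator: diffusion on a finite lattice, in which the field at a neighbour is seen with a
phase factor (`twistedOp`). For the lattice itself all factors are `exp (𝐢 q d)`. For a patch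
scheme the rows of a patch are closed up to cycles, and the only factor other than `1` is the
coupling factor `M`, by which `E^r` multiplies the wave, on the bond that closes the cycle
(`edgeFactor`). These operators are Hermitian, also for `‖M‖ ≠ 1`, as `E^{-r}` multiplies by the
conjugate of `M`.

*Consistency.* If `M = ρ exp (𝐢 q' n d)`, the scheme is a perturbation, of size `|ρ - 1| / d²`, of
the one with `ρ = 1`; and for `ρ = 1` a gauge transformation spreads the factor evenly over the
cycle (`edgeFactor_gauge`), which leaves the lattice operator of wavenumber `q'`, on a lattice
that covers one period of the diffusivities. The slowest mode of one period lifts to this lattice,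
and by the Poincaré inequality every other rate is at most `-β / d²` (`slow_modes_dependent`,
`rate_eq_homRate_or_le`). So the rates of the scheme are close to `homRate q'` or beyond the gap
(`rate_near_homRate_or_le`); projecting onto the former gives the slow part of any solution, and
the slow solution near a constant is the projection of the constant field, whose energy is bounded
while the gap is of order `1 / d²` (`hasMacroscaleRate_of_hermitian`).

It remains to estimate `M` (`exists_coupling_factor`). Spectral coupling is exact. For Lagrangian
coupling, `M` is `G - (𝐢 / r) G'` as a function of the phase difference `θ = q H`, where
`G'' + r² G` telescopes to a single term of order `r² θ^{2P}`. Hence `M exp (-𝐢 r θ) - 1` is of order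
`r θ^{2P+1}`, so that `q' - q = O(H^{2P})`; and `(‖M‖²)' = 2 G' (G'' + r² G) / r²`, so that `ρ - 1`
is of order `r² θ^{2P+2}`, which is `O((n d)² H^{2P})`. The latter gain of a factor `r H` is what
allows division by `d²`, uniformly in `r`.

*Homogenisation.* The mode shape and the rate solve an analytic system of equations, whose
linearisation at `q = 0` is nondegenerate as only constant fields have rate zero; the implicit
function theorem gives the analytic slow manifold (`exists_slow_branch`), and the spectral gap
identifies its rate with `homRate`. As `homRate` is even, its expansion has no odd terms. The
quadratic form is definite because a mode cannot be constant up to the phase factors along a whole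
period (`homRate_le_holonomy`).
-/

/-! ### Hermitian operators on finite families of complex numbers -/

section Hermitian

variable {σ : Type} [Fintype σ]

/-- The squared `ℓ²` norm of a finite family. -/
noncomputable def l2sq (f : σ → ℂ) : ℝ := ∑ s, ‖f s‖ ^ 2

/-- `T` is Hermitian for the inner product `star f ⬝ᵥ g = ∑ s, conj (f s) * g s`. -/
def IsHermitianOp (T : (σ → ℂ) →ₗ[ℂ] (σ → ℂ)) : Prop :=
  ∀ f g, star f ⬝ᵥ T g = star (T f) ⬝ᵥ g

lemma l2sq_nonneg (f : σ → ℂ) : 0 ≤ l2sq f := Finset.sum_nonneg fun _ _ => by positivity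

lemma star_dotProduct_self (f : σ → ℂ) : star f ⬝ᵥ f = (l2sq f : ℂ) := by
  simp only [dotProduct, l2sq, Pi.star_apply, RCLike.star_def, ofReal_sum, ofReal_pow]
  exact Finset.sum_congr rfl fun s _ => Complex.conj_mul' (f s)

lemma l2sq_eq_zero {f : σ → ℂ} : l2sq f = 0 ↔ f = 0 := by
  rw [l2sq, Finset.sum_eq_zero_iff_of_nonneg fun _ _ => by positivity]
  simp [funext_iff]

lemma l2sq_pos {f : σ → ℂ} (hf : f ≠ 0) : 0 < l2sq f :=
  lt_of_le_of_ne (l2sq_nonneg f) fun h => hf (l2sq_eq_zero.1 h.symm)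

lemma l2sq_smul (c : ℂ) (f : σ → ℂ) : l2sq (c • f) = ‖c‖ ^ 2 * l2sq f := by
  simp [l2sq, Finset.mul_sum, mul_pow]

lemma norm_sq_le_l2sq (f : σ → ℂ) (s : σ) : ‖f s‖ ^ 2 ≤ l2sq f :=
  Finset.single_le_sum (f := fun s => ‖f s‖ ^ 2) (fun _ _ => by positivity) (Finset.mem_univ s)

/-- A Hermitian operator is multiplication by real numbers in suitable unitary coordinates. -/
lemma exists_diagonalization {T : (σ → ℂ) →ₗ[ℂ] (σ → ℂ)} (hT : IsHermitianOp T) :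
    ∃ (Φ : (σ → ℂ) ≃ₗ[ℂ] (σ → ℂ)) (μ : σ → ℝ),
      (∀ f g, star (Φ f) ⬝ᵥ Φ g = star f ⬝ᵥ g) ∧ ∀ f s, Φ (T f) s = μ s * Φ f s := by
  classical
  let e := WithLp.linearEquiv 2 ℂ (σ → ℂ)
  let S : EuclideanSpace ℂ σ →ₗ[ℂ] EuclideanSpace ℂ σ := e.symm ∘ₗ T ∘ₗ e
  have hS : S.IsSymmetric := fun x y => by
    rw [EuclideanSpace.inner_eq_star_dotProduct, EuclideanSpace.inner_eq_star_dotProduct,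
      dotProduct_comm, dotProduct_comm (S y).ofLp]
    exact (hT x.ofLp y.ofLp).symm
  let b := (hS.eigenvectorBasis rfl)
  have hn : Module.finrank ℂ (EuclideanSpace ℂ σ) = Fintype.card σ := by simp
  let ι : Fin (Module.finrank ℂ (EuclideanSpace ℂ σ)) ≃ σ :=
    (finCongr hn).trans (Fintype.equivFin σ).symm
  let b' := b.reindex ι
  refine ⟨(e.symm.trans b'.repr.toLinearEquiv).trans e,
    fun s => hS.eigenvalues rfl (ι.symm s), fun f g => ?_, fun f s => ?_⟩
  · have h := b'.repr.inner_map_map (e.symm f) (e.symm g)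
    rw [EuclideanSpace.inner_eq_star_dotProduct, EuclideanSpace.inner_eq_star_dotProduct,
      dotProduct_comm, dotProduct_comm (e.symm g).ofLp] at h
    exact h
  · have h := hS.eigenvectorBasis_apply_self_apply rfl (e.symm f) (ι.symm s)
    change b'.repr (e.symm (T f)) s = _ * b'.repr (e.symm f) s
    simp only [b', OrthonormalBasis.repr_reindex]
    exact h

lemma l2sq_map_of_unitary {Φ : (σ → ℂ) ≃ₗ[ℂ] (σ → ℂ)}
    (hΦ : ∀ f g, star (Φ f) ⬝ᵥ Φ g = star f ⬝ᵥ g) (f : σ → ℂ) : l2sq (Φ f) = l2sq f := by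
  have h := hΦ f f
  rw [star_dotProduct_self, star_dotProduct_self] at h
  exact_mod_cast h

lemma energy_of_diagonalization {T : (σ → ℂ) →ₗ[ℂ] (σ → ℂ)} {Φ : (σ → ℂ) ≃ₗ[ℂ] (σ → ℂ)}
    {μ : σ → ℝ} (hΦ : ∀ f g, star (Φ f) ⬝ᵥ Φ g = star f ⬝ᵥ g)
    (hμ : ∀ f s, Φ (T f) s = μ s * Φ f s) (f : σ → ℂ) :
    star f ⬝ᵥ T f = ((∑ s, μ s * ‖Φ f s‖ ^ 2 : ℝ) : ℂ) := by
  rw [← hΦ]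
  simp only [dotProduct, Pi.star_apply, RCLike.star_def, ofReal_sum, ofReal_pow, ofReal_mul, hμ]
  refine Finset.sum_congr rfl fun s _ => ?_
  rw [← Complex.conj_mul']; ring

/-- The coordinate vectors of a diagonalization are eigenvectors. -/
lemma exists_eigenvector_of_diagonalization {T : (σ → ℂ) →ₗ[ℂ] (σ → ℂ)}
    {Φ : (σ → ℂ) ≃ₗ[ℂ] (σ → ℂ)} {μ : σ → ℝ} (hμ : ∀ f s, Φ (T f) s = μ s * Φ f s) (i : σ) :
    ∃ w, w ≠ 0 ∧ T w = (μ i : ℂ) • w ∧ ∀ f, star w ⬝ᵥ f = 0 →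
      (∀ f g, star (Φ f) ⬝ᵥ Φ g = star f ⬝ᵥ g) → Φ f i = 0 := by
  classical
  refine ⟨Φ.symm (Pi.single i 1), by simp, Φ.injective ?_, fun f hf hΦ => ?_⟩
  · ext s
    rw [hμ, map_smul, LinearEquiv.apply_symm_apply, Pi.smul_apply, smul_eq_mul]
    by_cases h : s = i
    · subst h; rfl
    · simp [h]
  · rw [← hΦ, LinearEquiv.apply_symm_apply] at hf
    simpa [← Pi.single_star] using hf

lemma exists_eq_of_eigenvector {α : Type} {T : (α → ℂ) →ₗ[ℂ] (α → ℂ)}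
    {Φ : (α → ℂ) ≃ₗ[ℂ] (α → ℂ)} {μ : α → ℝ} (hμ : ∀ f s, Φ (T f) s = μ s * Φ f s)
    {w : α → ℂ} (hw : w ≠ 0) {ν : ℝ} (h : T w = (ν : ℂ) • w) : ∃ i, μ i = ν := by
  have : Φ w ≠ 0 := by simpa using hw
  obtain ⟨i, hi⟩ := Function.ne_iff.1 this
  refine ⟨i, ?_⟩
  have := hμ w i
  rw [h, map_smul, Pi.smul_apply, smul_eq_mul] at this
  exact_mod_cast (mul_right_cancel₀ hi this).symm

lemma eigenvectors_orthogonal {T : (σ → ℂ) →ₗ[ℂ] (σ → ℂ)} (hT : IsHermitianOp T)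
    {v w : σ → ℂ} {μ ν : ℝ} (hv : T v = (μ : ℂ) • v) (hw : T w = (ν : ℂ) • w) (h : μ ≠ ν) :
    star v ⬝ᵥ w = 0 := by
  have := hT v w
  rw [hv, hw, dotProduct_smul, star_smul, smul_dotProduct] at this
  simp only [smul_eq_mul, RCLike.star_def, conj_ofReal] at this
  have h2 : ((ν : ℂ) - μ) * (star v ⬝ᵥ w) = 0 := by linear_combination this
  rcases mul_eq_zero.1 h2 with h3 | h3
  · exact absurd (by exact_mod_cast (sub_eq_zero.1 h3).symm) h
  · exact h3

/-- An approximate eigenvalue of a Hermitian operator is close to an eigenvalue. -/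
lemma exists_eigenvalue_near {T : (σ → ℂ) →ₗ[ℂ] (σ → ℂ)} (hT : IsHermitianOp T)
    {w : σ → ℂ} (hw : w ≠ 0) {μ ε : ℝ} (hε : 0 ≤ ε)
    (h : l2sq (T w - (μ : ℂ) • w) ≤ ε ^ 2 * l2sq w) :
    ∃ (ν : ℝ) (v : σ → ℂ), v ≠ 0 ∧ T v = (ν : ℂ) • v ∧ |μ - ν| ≤ ε := by
  obtain ⟨Φ, m, hΦ, hm⟩ := exists_diagonalization hT
  by_contra hcon
  push Not at hcon
  have hgap : ∀ i, ε < |μ - m i| := fun i => by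
    obtain ⟨v, hv, hTv, -⟩ := exists_eigenvector_of_diagonalization hm i
    exact hcon _ v hv hTv
  rw [← l2sq_map_of_unitary hΦ, ← l2sq_map_of_unitary hΦ w] at h
  have hne : Φ w ≠ 0 := by simpa using hw
  obtain ⟨i, hi⟩ := Function.ne_iff.1 hne
  refine absurd h (not_le.2 ?_)
  rw [l2sq, l2sq, Finset.mul_sum]
  have key : ∀ s, ‖Φ (T w - (μ : ℂ) • w) s‖ ^ 2 = |μ - m s| ^ 2 * ‖Φ w s‖ ^ 2 := fun s => by
    rw [map_sub, map_smul, Pi.sub_apply, hm, Pi.smul_apply, smul_eq_mul, ← sub_mul, norm_mul,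
      mul_pow, ← ofReal_sub, norm_real, Real.norm_eq_abs, abs_sub_comm]
  have hsq : ∀ s, ε ^ 2 < |μ - m s| ^ 2 := fun s => by
    have := hgap s; gcongr
  refine Finset.sum_lt_sum (fun s _ => ?_) ⟨i, Finset.mem_univ _, ?_⟩
  · rw [key]; exact mul_le_mul_of_nonneg_right (hsq s).le (by positivity)
  · rw [key]
    have : 0 < ‖Φ w i‖ := norm_pos_iff.2 hi
    exact mul_lt_mul_of_pos_right (hsq i) (by positivity)

end Hermitian

/-! ### Slow and fast solutions of Hermitian systems -/

section SlowFast

variable {σ : Type} [Fintype σ]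

/-- The spectral projection `P` onto the eigenvalues within `ε` of `Λ`, when all others are at
most `-γ`.  The last estimate controls the fast part of `f` by the energy `-⟨f, T f⟩`. -/
lemma exists_slow_projection {T : (σ → ℂ) →ₗ[ℂ] (σ → ℂ)} (hT : IsHermitianOp T) {Λ ε γ : ℝ}
    (hε : 0 ≤ ε) (hΛ : Λ ≤ 0)
    (h : ∀ (ν : ℝ) v, v ≠ 0 → T v = (ν : ℂ) • v → |ν - Λ| ≤ ε ∨ ν ≤ -γ) :
    ∃ P : (σ → ℂ) →ₗ[ℂ] (σ → ℂ), (∀ f, P (T f) = T (P f)) ∧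
      (∀ f, l2sq (T (P f) - (Λ : ℂ) • P f) ≤ ε ^ 2 * l2sq (P f)) ∧
      (∀ f, l2sq (f - P f) ≤ l2sq f) ∧
      (∀ f, (star (f - P f) ⬝ᵥ T (f - P f)).re ≤ -γ * l2sq (f - P f)) ∧
      ∀ f, (star f ⬝ᵥ T f).re ≤ ε * l2sq f - γ * l2sq (f - P f) := by
  obtain ⟨Φ, μ, hΦ, hμ⟩ := exists_diagonalization hT
  have hd : ∀ i, |μ i - Λ| ≤ ε ∨ μ i ≤ -γ := fun i => by
    obtain ⟨v, hv, hTv, -⟩ := exists_eigenvector_of_diagonalization hμ i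
    exact h _ v hv hTv
  classical
  let D : (σ → ℂ) →ₗ[ℂ] (σ → ℂ) :=
    LinearMap.pi fun i => (if |μ i - Λ| ≤ ε then (1 : ℂ) else 0) • LinearMap.proj i
  let P : (σ → ℂ) →ₗ[ℂ] (σ → ℂ) := Φ.symm.toLinearMap ∘ₗ D ∘ₗ Φ.toLinearMap
  have hP : ∀ f i, Φ (P f) i = (if |μ i - Λ| ≤ ε then (1 : ℂ) else 0) * Φ f i := fun f i => by
    by_cases hi : |μ i - Λ| ≤ ε <;> simp [P, D, hi]
  refine ⟨P, fun f => Φ.injective ?_, fun f => ?_, fun f => ?_, fun f => ?_, fun f => ?_⟩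
  · ext i
    rw [hP, hμ, hμ, hP]; ring
  · rw [← l2sq_map_of_unitary hΦ, ← l2sq_map_of_unitary hΦ (P f), l2sq, l2sq, Finset.mul_sum]
    refine Finset.sum_le_sum fun i _ => ?_
    rw [map_sub, map_smul, Pi.sub_apply, hμ, Pi.smul_apply, smul_eq_mul, ← sub_mul, norm_mul,
      mul_pow, ← ofReal_sub, norm_real, Real.norm_eq_abs, hP]
    split_ifs with hi
    · gcongr
    · simp
  · rw [← l2sq_map_of_unitary hΦ, ← l2sq_map_of_unitary hΦ f]
    refine Finset.sum_le_sum fun i _ => ?_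
    rw [map_sub, Pi.sub_apply, hP]
    split_ifs with hi
    · simp
    · simp
  · rw [energy_of_diagonalization hΦ hμ, ofReal_re, ← l2sq_map_of_unitary hΦ, l2sq, Finset.mul_sum]
    refine Finset.sum_le_sum fun i _ => ?_
    rw [map_sub, Pi.sub_apply, hP]
    split_ifs with hi
    · simp
    · exact mul_le_mul_of_nonneg_right ((hd i).resolve_left hi) (by positivity)
  · rw [energy_of_diagonalization hΦ hμ, ofReal_re, ← l2sq_map_of_unitary hΦ,
      ← l2sq_map_of_unitary hΦ (f - P f), l2sq, l2sq, Finset.mul_sum, Finset.mul_sum,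
      ← Finset.sum_sub_distrib]
    refine Finset.sum_le_sum fun i _ => ?_
    rw [map_sub, Pi.sub_apply, hP]
    split_ifs with hi
    · have := (abs_le.1 hi).2
      simp only [one_mul, sub_self, norm_zero, ne_eq, OfNat.ofNat_ne_zero, not_false_eq_true,
        zero_pow, mul_zero, sub_zero]
      exact mul_le_mul_of_nonneg_right (by linarith) (by positivity)
    · have := (hd i).resolve_left hi
      simp only [zero_mul, sub_zero]
      nlinarith [sq_nonneg ‖Φ f i‖]

lemma exists_linear_flow {T : (σ → ℂ) →ₗ[ℂ] (σ → ℂ)} (hT : IsHermitianOp T) (f : σ → ℂ) :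
    ∃ y : ℝ → σ → ℂ, y 0 = f ∧ ∀ t, HasDerivAt y (T (y t)) t := by
  obtain ⟨Φ, μ, hΦ, hμ⟩ := exists_diagonalization hT
  let L : (σ → ℂ) →L[ℝ] (σ → ℂ) :=
    (LinearMap.toContinuousLinearMap Φ.symm.toLinearMap).restrictScalars ℝ
  have hL : ∀ z, L z = Φ.symm z := fun z => rfl
  refine ⟨fun t => L fun i => exp ((μ i * t : ℝ) : ℂ) * Φ f i, ?_, fun t => ?_⟩
  · simp [hL]
  · have h1 : HasDerivAt (fun t : ℝ => fun i => exp ((μ i * t : ℝ) : ℂ) * Φ f i)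
        (fun i => μ i * (exp ((μ i * t : ℝ) : ℂ) * Φ f i)) t := by
      rw [hasDerivAt_pi]
      intro i
      have h2 : HasDerivAt (fun t : ℝ => ((μ i * t : ℝ) : ℂ)) (μ i : ℂ) t := by
        simpa using (((hasDerivAt_id t).const_mul (μ i)).ofReal_comp)
      refine (h2.cexp.mul_const (Φ f i)).congr_deriv ?_
      ring
    refine (L.hasFDerivAt.comp_hasDerivAt t h1).congr_deriv (Φ.injective ?_)
    ext i
    simp [hL, hμ]

lemma hasDerivAt_l2sq {y : ℝ → σ → ℂ} {y' : σ → ℂ} {t : ℝ} (h : HasDerivAt y y' t) :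
    HasDerivAt (fun τ => l2sq (y τ)) (2 * (star (y t) ⬝ᵥ y').re) t := by
  have h1 : ∀ s ∈ (Finset.univ : Finset σ), HasDerivAt (fun τ => ‖y τ s‖ ^ 2)
      (2 * Inner.inner ℝ (y t s) (y' s)) t := fun s _ => (hasDerivAt_pi.1 h s).norm_sq
  refine (HasDerivAt.fun_sum h1).congr_deriv ?_
  rw [← Finset.mul_sum, dotProduct, re_sum]
  simp [Complex.inner, mul_comm]

/-- Exponential decay from an energy estimate. -/
lemma l2sq_decay {y : ℝ → σ → ℂ} {T : (σ → ℂ) → σ → ℂ} {γ : ℝ}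
    (hy : ∀ t, HasDerivAt y (T (y t)) t)
    (h : ∀ t, (star (y t) ⬝ᵥ T (y t)).re ≤ -γ * l2sq (y t)) {t : ℝ} (ht : 0 ≤ t) :
    l2sq (y t) ≤ Real.exp (-2 * γ * t) * l2sq (y 0) := by
  have hd : ∀ t, HasDerivAt (fun τ => Real.exp (2 * γ * τ) * l2sq (y τ))
      (Real.exp (2 * γ * t) * (2 * γ) * l2sq (y t)
        + Real.exp (2 * γ * t) * (2 * (star (y t) ⬝ᵥ T (y t)).re)) t := fun t => by
    have h1 : HasDerivAt (fun τ : ℝ => 2 * γ * τ) (2 * γ) t := by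
      simpa using (hasDerivAt_id t).const_mul (2 * γ)
    exact h1.exp.mul (hasDerivAt_l2sq (hy t))
  have hanti : Antitone fun τ => Real.exp (2 * γ * τ) * l2sq (y τ) := by
    refine antitone_of_deriv_nonpos (fun t => (hd t).differentiableAt) fun t => ?_
    rw [(hd t).deriv]
    nlinarith [Real.exp_pos (2 * γ * t), h t]
  have h0 := hanti ht
  simp only [mul_zero, Real.exp_zero, one_mul] at h0
  have : -2 * γ * t = -(2 * γ * t) := by ring
  rw [this, Real.exp_neg, inv_mul_eq_div, le_div_iff₀ (Real.exp_pos _), mul_comm]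
  exact h0

end SlowFast

section Waves

variable {Nx Ny : ℕ} {σ : Type}

/-- The field `V` varies from patch to patch as a plane wave of wavenumber index `(a, b)`. -/
def IsWave (a b : ℤ) (V : PatchField Nx Ny σ) : Prop :=
  (∀ A B s, V (A + 1) B s = exp (2 * Real.pi * I * a / Nx) * V A B s) ∧
  ∀ A B s, V A (B + 1) s = exp (2 * Real.pi * I * b / Ny) * V A B s

lemma IsWave.map {a b : ℤ} {V : PatchField Nx Ny σ} (h : IsWave a b V)
    (P : (σ → ℂ) →ₗ[ℂ] (σ → ℂ)) : IsWave a b fun A B => P (V A B) := by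
  refine ⟨fun A B s => ?_, fun A B s => ?_⟩
  · have : V (A + 1) B = exp (2 * Real.pi * I * a / Nx) • V A B := funext fun s => h.1 A B s
    simp only [this, map_smul, Pi.smul_apply, smul_eq_mul]
  · have : V A (B + 1) = exp (2 * Real.pi * I * b / Ny) • V A B := funext fun s => h.2 A B s
    simp only [this, map_smul, Pi.smul_apply, smul_eq_mul]

/-- The plane wave with profile `w` in patch `(0, 0)`. -/
lemma exists_isWave [NeZero Nx] [NeZero Ny] (a b : ℤ) :
    ∃ e : ZMod Nx → ZMod Ny → ℂ, e 0 0 = 1 ∧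
      ∀ w : σ → ℂ, IsWave a b (fun A B s => e A B * w s : PatchField Nx Ny σ) := by
  refine ⟨fun A B => ZMod.stdAddChar ((a : ZMod Nx) * A) * ZMod.stdAddChar ((b : ZMod Ny) * B),
    by simp, fun w => ⟨fun A B s => ?_, fun A B s => ?_⟩⟩
  · simp only [mul_add, mul_one, AddChar.map_add_eq_mul, ZMod.stdAddChar_coe]; ring
  · simp only [mul_add, mul_one, AddChar.map_add_eq_mul, ZMod.stdAddChar_coe]; ring

/-- If the patch scheme acts on waves as a Hermitian operator `T` in each patch, the spectrum of `T`
splits as in `exists_slow_projection`, and the energy of the constant field is small, then the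
scheme has the macroscale rate `Λ`.  The slow solution with small fluctuations starts from the
slow part of the constant field. -/
theorem hasMacroscaleRate_of_hermitian [NeZero Nx] [NeZero Ny] [Fintype σ] [Nonempty σ]
    {F : PatchField Nx Ny σ → PatchField Nx Ny σ} {a b : ℤ} {T : (σ → ℂ) →ₗ[ℂ] (σ → ℂ)}
    (hT : IsHermitianOp T) (hF : ∀ V, IsWave a b V → ∀ A B, F V A B = T (V A B))
    {Λ ε γ η δ : ℝ} (hε : 0 ≤ ε) (hΛ : Λ ≤ 0) (hγ : 0 < γ)
    (h : ∀ (ν : ℝ) v, v ≠ 0 → T v = (ν : ℂ) • v → |ν - Λ| ≤ ε ∨ ν ≤ -γ)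
    (hδ : 0 ≤ δ) (hδ' : δ ≤ 1 / 2) (hη : 4 * δ ≤ η)
    (h1 : ε * Fintype.card σ - (star (1 : σ → ℂ) ⬝ᵥ T 1).re ≤ γ * δ ^ 2) :
    HasMacroscaleRate F a b Λ ε γ η := by
  obtain ⟨P, hPT, hPε, hPle, hPfast, hPen⟩ := exists_slow_projection hT hε hΛ h
  let R : (σ → ℂ) →ₗ[ℂ] (σ → ℂ) := LinearMap.id - P
  have hR : ∀ f, R f = f - P f := fun f => rfl
  have hRT : ∀ f, R (T f) = T (R f) := fun f => by rw [hR, hR, map_sub, hPT]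
  have hpatch : ∀ {v}, IsWaveSolution F a b v →
      ∀ t A B, HasDerivAt (fun τ => v τ A B) (T (v t A B)) t := fun {v} hv t A B => by
    rw [hasDerivAt_pi]
    intro s
    rw [← hF (v t) ⟨hv.2.1 t, hv.2.2 t⟩]
    exact hv.1 t A B s
  have hmap : ∀ {v}, IsWaveSolution F a b v → ∀ S : (σ → ℂ) →ₗ[ℂ] (σ → ℂ),
      (∀ f, S (T f) = T (S f)) → IsWaveSolution F a b fun t A B => S (v t A B) := by
    intro v hv S hS
    have hw : ∀ t, IsWave a b fun A B => S (v t A B) := fun t =>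
      IsWave.map ⟨hv.2.1 t, hv.2.2 t⟩ S
    refine ⟨fun t A B s => ?_, fun t => (hw t).1, fun t => (hw t).2⟩
    rw [hF _ (hw t), ← hS]
    let Sc : (σ → ℂ) →L[ℝ] (σ → ℂ) := (LinearMap.toContinuousLinearMap S).restrictScalars ℝ
    exact hasDerivAt_pi.1 (Sc.hasFDerivAt.comp_hasDerivAt t (hpatch hv t A B)) s
  have hrate : ∀ {v}, IsWaveSolution F a b v → ObeysRate F Λ ε fun t A B => P (v t A B) := by
    intro v hv t A B
    rw [hF _ (IsWave.map ⟨hv.2.1 t, hv.2.2 t⟩ P)]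
    exact hPε (v t A B)
  refine ⟨fun v hv => ⟨fun t A B => P (v t A B), fun t A B => R (v t A B),
    hmap hv P hPT, hmap hv R hRT, by ext; simp [hR], hrate hv, fun t ht A B => ?_⟩, ?_⟩
  · have hfast : ∀ t, HasDerivAt (fun τ => R (v τ A B)) (T (R (v t A B))) t :=
      fun t => hpatch (hmap hv R hRT) t A B
    refine (l2sq_decay hfast (fun t => hPfast (v t A B)) ht).trans ?_
    exact mul_le_mul_of_nonneg_left (hPle _) (Real.exp_pos _).le
  · obtain ⟨y, hy0, hy⟩ := exists_linear_flow hT 1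
    obtain ⟨e, he0, he⟩ := exists_isWave (Nx := Nx) (Ny := Ny) (σ := σ) a b
    have hsol : IsWaveSolution F a b fun t A B s => e A B * y t s := by
      refine ⟨fun t A B s => ?_, fun t => (he (y t)).1, fun t => (he (y t)).2⟩
      rw [hF _ (he (y t))]
      have : (fun s => e A B * y t s) = e A B • y t := rfl
      rw [this, map_smul, Pi.smul_apply, smul_eq_mul]
      exact (hasDerivAt_pi.1 (hy t) s).const_mul _
    -- `x` is the fast part of the constant field and `m` its mean.
    set x : σ → ℂ := 1 - P 1 with hx
    have hcard : (0 : ℝ) < Fintype.card σ := by exact_mod_cast Fintype.card_pos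
    have hcard' : (Fintype.card σ : ℂ) ≠ 0 := by exact_mod_cast hcard.ne'
    have hxs : ∀ s, ‖x s‖ ≤ δ := fun s => by
      have h2 := hPen 1
      have h3 : l2sq (1 : σ → ℂ) = Fintype.card σ := by simp [l2sq]
      rw [h3] at h2
      have h4 : l2sq x ≤ δ ^ 2 := le_of_mul_le_mul_left (by linarith) hγ
      exact (sq_le_sq₀ (norm_nonneg _) hδ).1 ((norm_sq_le_l2sq x s).trans h4)
    set m : ℂ := (∑ s, x s) / Fintype.card σ with hm
    have hmδ : ‖m‖ ≤ δ := by
      rw [hm, norm_div, Complex.norm_natCast, div_le_iff₀ hcard]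
      refine (norm_sum_le _ _).trans ((Finset.sum_le_sum fun s _ => hxs s).trans ?_)
      simp [mul_comm]
    have hm1 : 1 / 2 ≤ ‖1 - m‖ := by
      have := norm_sub_norm_le (1 : ℂ) m
      rw [norm_one] at this
      linarith
    have hm0 : 1 - m ≠ 0 := by
      intro h0; rw [h0, norm_zero] at hm1; norm_num at hm1
    let S : (σ → ℂ) →ₗ[ℂ] (σ → ℂ) := (1 - m)⁻¹ • LinearMap.id
    have hs0 : ∀ s, P (S fun s => e 0 0 * y 0 s) s = (1 - x s) / (1 - m) := fun s => by
      have h2 : (S fun s => e 0 0 * y 0 s) = (1 - m)⁻¹ • (1 : σ → ℂ) := by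
        ext s; simp [S, he0, hy0]
      rw [h2, map_smul, Pi.smul_apply, smul_eq_mul, hx, Pi.sub_apply, Pi.one_apply]
      field_simp
      ring
    have hsol' := hmap hsol S fun f => by simp [S]
    refine ⟨_, hmap hsol' P hPT, hrate hsol', ?_, fun s => ?_⟩
    · simp only [hs0]
      rw [← Finset.sum_div, Finset.sum_sub_distrib]
      simp only [Finset.sum_const, Finset.card_univ, nsmul_eq_mul, mul_one]
      have : (∑ s, x s) = m * Fintype.card σ := by rw [hm]; field_simp
      rw [this]
      field_simp
    · simp only [hs0]
      have h2 : (1 - x s) / (1 - m) - 1 = (m - x s) / (1 - m) := by field_simp; ring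
      rw [h2, norm_div, div_le_iff₀ (by linarith)]
      have h3 : ‖m - x s‖ ≤ δ + δ := (norm_sub_le _ _).trans (add_le_add hmδ (hxs s))
      nlinarith

end Waves

/-! ### Twisted diffusion on a finite lattice -/

section Twisted

variable {σ : Type}

/-- Diffusion along the cycles of the permutation `R`: `R s` is the right neighbour of `s`,
`a s` is the diffusivity between the two, and the field at `R s` is seen from `s` with the phase
factor `m s`, so that the field at `s` is seen from `R s` with the factor `conj (m s)`. -/
def dirOp (R : Equiv.Perm σ) (a : σ → ℝ) (m : σ → ℂ) : (σ → ℂ) →ₗ[ℂ] (σ → ℂ) where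
  toFun w s := a s * (m s * w (R s) - w s)
    + a (R.symm s) * ((starRingEnd ℂ) (m (R.symm s)) * w (R.symm s) - w s)
  map_add' f g := by ext s; simp only [Pi.add_apply]; ring
  map_smul' c f := by ext s; simp only [Pi.smul_apply, smul_eq_mul, RingHom.id_apply]; ring

lemma dirOp_apply (R : Equiv.Perm σ) (a : σ → ℝ) (m w : σ → ℂ) (s : σ) :
    dirOp R a m w s = a s * (m s * w (R s) - w s)
      + a (R.symm s) * ((starRingEnd ℂ) (m (R.symm s)) * w (R.symm s) - w s) := rfl

/-- Two-dimensional diffusion with spacings `dx`, `dy`: along `R` in `x` and along `U` in `y`. -/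
noncomputable def twistedOp (R U : Equiv.Perm σ) (a b : σ → ℝ) (m n : σ → ℂ) (dx dy : ℝ) :
    (σ → ℂ) →ₗ[ℂ] (σ → ℂ) :=
  (((dx ^ 2)⁻¹ : ℝ) : ℂ) • dirOp R a m + (((dy ^ 2)⁻¹ : ℝ) : ℂ) • dirOp U b n

lemma twistedOp_apply (R U : Equiv.Perm σ) (a b : σ → ℝ) (m n : σ → ℂ) (dx dy : ℝ) (w : σ → ℂ)
    (s : σ) : twistedOp R U a b m n dx dy w s =
      dirOp R a m w s / (dx : ℂ) ^ 2 + dirOp U b n w s / (dy : ℂ) ^ 2 := by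
  simp only [twistedOp, LinearMap.add_apply, LinearMap.smul_apply, Pi.add_apply, Pi.smul_apply,
    smul_eq_mul]
  push_cast
  rw [inv_mul_eq_div, inv_mul_eq_div]

/-- Diffusion commutes with pulling fields back along an equivariant map. -/
lemma dirOp_comp {τ : Type} {R : Equiv.Perm σ} {R' : Equiv.Perm τ} {π : σ → τ}
    (h : ∀ s, π (R s) = R' (π s)) (a : τ → ℝ) (m w : τ → ℂ) :
    dirOp R (a ∘ π) (m ∘ π) (w ∘ π) = dirOp R' a m w ∘ π := by
  have h' : ∀ s, π (R.symm s) = R'.symm (π s) := fun s => by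
    rw [Equiv.eq_symm_apply, ← h, Equiv.apply_symm_apply]
  ext s
  simp [dirOp_apply, h, h']

/-- A change of gauge `w ↦ g w` changes the phase factors from `m` to `m'`. -/
lemma dirOp_gauge {R : Equiv.Perm σ} (a : σ → ℝ) {m m' g : σ → ℂ} (hg : ∀ s, ‖g s‖ = 1)
    (h : ∀ s, m s * g (R s) = m' s * g s) (w : σ → ℂ) :
    dirOp R a m (g * w) = g * dirOp R a m' w := by
  ext s
  have hg' : ∀ s, (starRingEnd ℂ) (g s) * g s = 1 := fun s => by
    rw [Complex.conj_mul', hg]; simp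
  have h1 := h s
  have h2 : (starRingEnd ℂ) (m (R.symm s)) * g (R.symm s)
      = (starRingEnd ℂ) (m' (R.symm s)) * g s := by
    have h3 := congrArg (starRingEnd ℂ) (h (R.symm s))
    rw [map_mul, map_mul, Equiv.apply_symm_apply] at h3
    have h4 := hg' s
    have h5 := hg' (R.symm s)
    linear_combination (-(starRingEnd ℂ) (m (R.symm s)) * g (R.symm s)) * h4
      + g s * g (R.symm s) * h3 + (starRingEnd ℂ) (m' (R.symm s)) * g s * h5
  simp only [dirOp_apply, Pi.mul_apply]
  linear_combination (a s * w (R s)) * h1 + (a (R.symm s) * w (R.symm s)) * h2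

/-- Diffusion does not leave a set that is closed under `R`. -/
lemma dirOp_indicator {R : Equiv.Perm σ} (a : σ → ℝ) (m w : σ → ℂ) {O : Set σ}
    (h : ∀ s, R s ∈ O ↔ s ∈ O) : dirOp R a m (O.indicator w) = O.indicator (dirOp R a m w) := by
  have h' : ∀ s, R.symm s ∈ O ↔ s ∈ O := fun s => by rw [← h, Equiv.apply_symm_apply]
  ext s
  by_cases hs : s ∈ O
  · simp [dirOp_apply, Set.indicator, h, h', hs]
  · simp [dirOp_apply, Set.indicator, h, h', hs]

lemma twistedOp_comp {τ : Type} {R U : Equiv.Perm σ} {R' U' : Equiv.Perm τ} {π : σ → τ}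
    (hR : ∀ s, π (R s) = R' (π s)) (hU : ∀ s, π (U s) = U' (π s)) (a b : τ → ℝ) (m n w : τ → ℂ)
    (dx dy : ℝ) : twistedOp R U (a ∘ π) (b ∘ π) (m ∘ π) (n ∘ π) dx dy (w ∘ π)
      = twistedOp R' U' a b m n dx dy w ∘ π := by
  ext s
  rw [twistedOp_apply, dirOp_comp hR, dirOp_comp hU, Function.comp_apply, Function.comp_apply,
    Function.comp_apply, twistedOp_apply]

lemma twistedOp_gauge {R U : Equiv.Perm σ} (a b : σ → ℝ) {m m' n n' g : σ → ℂ}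
    (hg : ∀ s, ‖g s‖ = 1) (hm : ∀ s, m s * g (R s) = m' s * g s)
    (hn : ∀ s, n s * g (U s) = n' s * g s) (dx dy : ℝ) (w : σ → ℂ) :
    twistedOp R U a b m n dx dy (g * w) = g * twistedOp R U a b m' n' dx dy w := by
  ext s
  rw [twistedOp_apply, dirOp_gauge a hg hm, dirOp_gauge b hg hn, Pi.mul_apply, Pi.mul_apply,
    Pi.mul_apply, twistedOp_apply]
  ring

lemma twistedOp_indicator {R U : Equiv.Perm σ} (a b : σ → ℝ) (m n w : σ → ℂ) (dx dy : ℝ)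
    {O : Set σ} (hR : ∀ s, R s ∈ O ↔ s ∈ O) (hU : ∀ s, U s ∈ O ↔ s ∈ O) :
    twistedOp R U a b m n dx dy (O.indicator w)
      = O.indicator (twistedOp R U a b m n dx dy w) := by
  ext s
  rw [twistedOp_apply, dirOp_indicator a m w hR, dirOp_indicator b n w hU]
  by_cases hs : s ∈ O
  · simp [Set.indicator, hs, twistedOp_apply]
  · simp [Set.indicator, hs]

variable [Fintype σ]

/-- Summation by parts. -/
lemma star_dotProduct_dirOp (R : Equiv.Perm σ) (a : σ → ℝ) (m f g : σ → ℂ) :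
    star f ⬝ᵥ dirOp R a m g = ∑ s, (a s : ℂ) *
      ((starRingEnd ℂ) (f s) * (m s * g (R s) - g s)
        + (starRingEnd ℂ) (f (R s)) * ((starRingEnd ℂ) (m s) * g s - g (R s))) := by
  simp only [dotProduct, dirOp_apply, Pi.star_apply, RCLike.star_def, mul_add,
    Finset.sum_add_distrib]
  congr 1
  · exact Finset.sum_congr rfl fun s _ => by ring
  · rw [← Equiv.sum_comp R]
    refine Finset.sum_congr rfl fun s _ => ?_
    rw [Equiv.symm_apply_apply]; ring

lemma isHermitianOp_dirOp (R : Equiv.Perm σ) (a : σ → ℝ) (m : σ → ℂ) :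
    IsHermitianOp (dirOp R a m) := fun f g => by
  have h : star (dirOp R a m f) ⬝ᵥ g = star (star g ⬝ᵥ dirOp R a m f) := by
    rw [Matrix.star_dotProduct]
  rw [h, star_dotProduct_dirOp, star_dotProduct_dirOp, star_sum]
  refine Finset.sum_congr rfl fun s _ => ?_
  simp only [RCLike.star_def, map_mul, map_add, map_sub, conj_conj, conj_ofReal]
  ring

lemma isHermitianOp_twistedOp (R U : Equiv.Perm σ) (a b : σ → ℝ) (m n : σ → ℂ) (dx dy : ℝ) :
    IsHermitianOp (twistedOp R U a b m n dx dy) := fun f g => by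
  simp only [twistedOp, LinearMap.add_apply, LinearMap.smul_apply, dotProduct_add, star_add,
    add_dotProduct, dotProduct_smul, star_smul, smul_dotProduct]
  rw [isHermitianOp_dirOp R a m f g, isHermitianOp_dirOp U b n f g]
  simp only [RCLike.star_def, conj_ofReal]

/-- The energy of `f`, for phase factors of modulus one. -/
lemma energy_dirOp (R : Equiv.Perm σ) (a : σ → ℝ) {m : σ → ℂ} (hm : ∀ s, ‖m s‖ = 1)
    (f : σ → ℂ) :
    star f ⬝ᵥ dirOp R a m f = ((-∑ s, a s * ‖m s * f (R s) - f s‖ ^ 2 : ℝ) : ℂ) := by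
  rw [star_dotProduct_dirOp]
  push_cast
  rw [← Finset.sum_neg_distrib]
  refine Finset.sum_congr rfl fun s _ => ?_
  have h1 : (starRingEnd ℂ) (m s) * m s = 1 := by rw [Complex.conj_mul', hm]; simp
  rw [← Complex.conj_mul']
  simp only [map_sub, map_mul]
  linear_combination (a s * (starRingEnd ℂ) (f (R s)) * f (R s)) * h1

/-- The energy `-⟨f, T f⟩` of `T = twistedOp R U a b m n dx dy`. -/
noncomputable def twistedEnergy (R U : Equiv.Perm σ) (a b : σ → ℝ) (m n : σ → ℂ) (dx dy : ℝ)
    (f : σ → ℂ) : ℝ :=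
  (∑ s, a s * ‖m s * f (R s) - f s‖ ^ 2) / dx ^ 2 + (∑ s, b s * ‖n s * f (U s) - f s‖ ^ 2) / dy ^ 2

lemma energy_twistedOp (R U : Equiv.Perm σ) (a b : σ → ℝ) {m n : σ → ℂ} (hm : ∀ s, ‖m s‖ = 1)
    (hn : ∀ s, ‖n s‖ = 1) (dx dy : ℝ) (f : σ → ℂ) :
    star f ⬝ᵥ twistedOp R U a b m n dx dy f
      = ((-twistedEnergy R U a b m n dx dy f : ℝ) : ℂ) := by
  simp only [twistedOp, LinearMap.add_apply, LinearMap.smul_apply, dotProduct_add,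
    dotProduct_smul, energy_dirOp R a hm, energy_dirOp U b hn, twistedEnergy]
  push_cast
  simp only [smul_eq_mul]
  ring

lemma twistedEnergy_of_eigenvector {R U : Equiv.Perm σ} {a b : σ → ℝ} {m n : σ → ℂ}
    (hm : ∀ s, ‖m s‖ = 1) (hn : ∀ s, ‖n s‖ = 1) {dx dy μ : ℝ} {f : σ → ℂ}
    (h : twistedOp R U a b m n dx dy f = (μ : ℂ) • f) :
    twistedEnergy R U a b m n dx dy f = -μ * l2sq f := by
  have := energy_twistedOp R U a b hm hn dx dy f
  rw [h, dotProduct_smul, star_dotProduct_self, smul_eq_mul] at this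
  have h2 : μ * l2sq f = -twistedEnergy R U a b m n dx dy f := by exact_mod_cast this
  linarith

/-- The energy of the constant field, for phase factors of any modulus. -/
lemma energy_dirOp_one (R : Equiv.Perm σ) (a : σ → ℝ) (m : σ → ℂ) :
    (star (1 : σ → ℂ) ⬝ᵥ dirOp R a m 1).re = -∑ s, a s * (2 - 2 * (m s).re) := by
  rw [star_dotProduct_dirOp, re_sum, ← Finset.sum_neg_distrib]
  refine Finset.sum_congr rfl fun s _ => ?_
  simp only [Pi.one_apply, map_one, one_mul, mul_one, re_ofReal_mul, add_re, sub_re, one_re,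
    conj_re]
  ring

/-- Changing the phase factors by at most `δ` changes the operator by at most `2 K δ`. -/
lemma l2sq_dirOp_sub_le (R : Equiv.Perm σ) {a : σ → ℝ} {K δ : ℝ} (ha : ∀ s, 0 ≤ a s)
    (ha' : ∀ s, a s ≤ K) {m m' : σ → ℂ} (h : ∀ s, ‖m s - m' s‖ ≤ δ) (w : σ → ℂ) :
    l2sq (dirOp R a m w - dirOp R a m' w) ≤ (2 * K * δ) ^ 2 * l2sq w := by
  have hs : ∀ s, ‖(dirOp R a m w - dirOp R a m' w) s‖ ^ 2
      ≤ 2 * (K * δ) ^ 2 * (‖w (R s)‖ ^ 2 + ‖w (R.symm s)‖ ^ 2) := fun s => by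
    have h0 : (dirOp R a m w - dirOp R a m' w) s = a s * (m s - m' s) * w (R s)
        + a (R.symm s) * (starRingEnd ℂ) (m (R.symm s) - m' (R.symm s)) * w (R.symm s) := by
      simp only [Pi.sub_apply, dirOp_apply, map_sub]; ring
    have hδ : 0 ≤ δ := (norm_nonneg _).trans (h s)
    have hK : ∀ s, ‖(a s : ℂ)‖ ≤ K := fun s => by
      rw [norm_real, Real.norm_eq_abs, abs_of_nonneg (ha s)]; exact ha' s
    have hK0 : 0 ≤ K := (ha s).trans (ha' s)
    have h1 : ‖(dirOp R a m w - dirOp R a m' w) s‖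
        ≤ K * δ * ‖w (R s)‖ + K * δ * ‖w (R.symm s)‖ := by
      rw [h0]
      refine (norm_add_le _ _).trans (add_le_add ?_ ?_)
      · rw [norm_mul, norm_mul]
        have := hK s; have := h s
        gcongr
      · rw [norm_mul, norm_mul, RCLike.norm_conj]
        have := hK (R.symm s); have := h (R.symm s)
        gcongr
    have h2 := pow_le_pow_left₀ (norm_nonneg _) h1 2
    nlinarith [sq_nonneg (K * δ * ‖w (R s)‖ - K * δ * ‖w (R.symm s)‖)]
  refine (Finset.sum_le_sum fun s _ => hs s).trans (le_of_eq ?_)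
  rw [← Finset.mul_sum, Finset.sum_add_distrib, Equiv.sum_comp R (fun s => ‖w s‖ ^ 2),
    Equiv.sum_comp R.symm (fun s => ‖w s‖ ^ 2), l2sq]
  ring

lemma l2sq_add_le (f g : σ → ℂ) : l2sq (f + g) ≤ 2 * l2sq f + 2 * l2sq g := by
  rw [l2sq, l2sq, l2sq, Finset.mul_sum, Finset.mul_sum, ← Finset.sum_add_distrib]
  refine Finset.sum_le_sum fun s _ => ?_
  have h2 := pow_le_pow_left₀ (norm_nonneg _) (norm_add_le (f s) (g s)) 2
  rw [Pi.add_apply]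
  nlinarith [sq_nonneg (‖f s‖ - ‖g s‖)]

lemma l2sq_twistedOp_sub_le (R U : Equiv.Perm σ) {a b : σ → ℝ} {K δ δ' : ℝ}
    (ha : ∀ s, 0 ≤ a s) (ha' : ∀ s, a s ≤ K) (hb : ∀ s, 0 ≤ b s) (hb' : ∀ s, b s ≤ K)
    {m m' n n' : σ → ℂ} (hδ : 0 ≤ δ) (hδ' : 0 ≤ δ') (hm : ∀ s, ‖m s - m' s‖ ≤ δ)
    (hn : ∀ s, ‖n s - n' s‖ ≤ δ') (dx dy : ℝ) (w : σ → ℂ) :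
    l2sq (twistedOp R U a b m n dx dy w - twistedOp R U a b m' n' dx dy w)
      ≤ (4 * K * (δ / dx ^ 2 + δ' / dy ^ 2)) ^ 2 * l2sq w := by
  have h : twistedOp R U a b m n dx dy w - twistedOp R U a b m' n' dx dy w
      = (((dx ^ 2)⁻¹ : ℝ) : ℂ) • (dirOp R a m w - dirOp R a m' w)
        + (((dy ^ 2)⁻¹ : ℝ) : ℂ) • (dirOp U b n w - dirOp U b n' w) := by
    simp only [twistedOp, LinearMap.add_apply, LinearMap.smul_apply, smul_sub]
    abel
  rw [h]
  refine (l2sq_add_le _ _).trans ?_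
  rw [l2sq_smul, l2sq_smul, norm_real, norm_real, Real.norm_eq_abs, Real.norm_eq_abs, sq_abs,
    sq_abs]
  have h1 := mul_le_mul_of_nonneg_left (l2sq_dirOp_sub_le R ha ha' hm w)
    (sq_nonneg (dx ^ 2)⁻¹)
  have h2 := mul_le_mul_of_nonneg_left (l2sq_dirOp_sub_le U hb hb' hn w)
    (sq_nonneg (dy ^ 2)⁻¹)
  have h3 : 0 ≤ (δ / dx ^ 2) := by positivity
  have h4 : 0 ≤ (δ' / dy ^ 2) := by positivity
  have h5 : 0 ≤ K ^ 2 * l2sq w := mul_nonneg (sq_nonneg _) (l2sq_nonneg _)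
  have h6 : 0 ≤ K ^ 2 * l2sq w * (8 * (δ / dx ^ 2) ^ 2 + 8 * (δ' / dy ^ 2) ^ 2
      + 32 * ((δ / dx ^ 2) * (δ' / dy ^ 2))) := by positivity
  calc _ ≤ 2 * ((dx ^ 2)⁻¹ ^ 2 * ((2 * K * δ) ^ 2 * l2sq w))
        + 2 * ((dy ^ 2)⁻¹ ^ 2 * ((2 * K * δ') ^ 2 * l2sq w)) := by gcongr
    _ = K ^ 2 * l2sq w * (8 * (δ / dx ^ 2) ^ 2 + 8 * (δ' / dy ^ 2) ^ 2) := by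
        simp only [div_eq_mul_inv]; ring
    _ ≤ _ := by
        have : (4 * K * (δ / dx ^ 2 + δ' / dy ^ 2)) ^ 2 * l2sq w
          = K ^ 2 * l2sq w * (8 * (δ / dx ^ 2) ^ 2 + 8 * (δ' / dy ^ 2) ^ 2)
          + K ^ 2 * l2sq w * (8 * (δ / dx ^ 2) ^ 2 + 8 * (δ' / dy ^ 2) ^ 2
            + 32 * ((δ / dx ^ 2) * (δ' / dy ^ 2))) := by ring
        linarith

end Twisted

/-! ### The spectral gap -/

section Gap

variable {σ : Type}

/-- The fields that are constant along the cycles of both `R` and `U`. -/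
def IsInvariantField (R U : Equiv.Perm σ) (g : σ → ℂ) : Prop :=
  (∀ s, g (R s) = g s) ∧ ∀ s, g (U s) = g s

/-- The connected component of `s₀` under `R` and `U`, as the set of points not separated from `s₀`
by invariant fields. -/
def component (R U : Equiv.Perm σ) (s₀ : σ) : Set σ :=
  {s | ∀ g, IsInvariantField R U g → g s = g s₀}

lemma apply_mem_component_iff {R U : Equiv.Perm σ} {s₀ s : σ} :
    (R s ∈ component R U s₀ ↔ s ∈ component R U s₀) ∧
      (U s ∈ component R U s₀ ↔ s ∈ component R U s₀) := by
  refine ⟨⟨fun h g hg => ?_, fun h g hg => ?_⟩, ⟨fun h g hg => ?_, fun h g hg => ?_⟩⟩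
  · rw [← hg.1, h g hg]
  · rw [hg.1, h g hg]
  · rw [← hg.2, h g hg]
  · rw [hg.2, h g hg]

lemma exists_pos_le_abs {ι : Type} [Finite ι] (μ : ι → ℝ) :
    ∃ c, 0 < c ∧ ∀ i, μ i ≠ 0 → c ≤ |μ i| := by
  classical
  obtain ⟨o, ho⟩ := Finite.exists_min fun o : Option ι =>
    o.elim 1 fun i => if μ i = 0 then (1 : ℝ) else |μ i|
  refine ⟨_, ?_, fun i hi => (ho (some i)).trans (by simp [hi])⟩
  cases o with
  | none => simp
  | some i =>
    by_cases hi : μ i = 0 <;> simp [hi]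

variable [Fintype σ]

/-- The Poincaré inequality for fields orthogonal to the invariant ones. -/
lemma exists_poincare (R U : Equiv.Perm σ) : ∃ c : ℝ, 0 < c ∧ ∀ f : σ → ℂ,
    (∀ g, IsInvariantField R U g → star g ⬝ᵥ f = 0) →
      c * l2sq f ≤ ∑ s, ‖f (R s) - f s‖ ^ 2 + ∑ s, ‖f (U s) - f s‖ ^ 2 := by
  have hone : ∀ s : σ, ‖(1 : σ → ℂ) s‖ = 1 := by simp
  have hE : ∀ f, twistedEnergy R U 1 1 1 1 1 1 f
      = ∑ s, ‖f (R s) - f s‖ ^ 2 + ∑ s, ‖f (U s) - f s‖ ^ 2 := by simp [twistedEnergy]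
  obtain ⟨Φ, μ, hΦ, hμ⟩ := exists_diagonalization (isHermitianOp_twistedOp R U 1 1 1 1 1 1)
  have hEμ : ∀ f, twistedEnergy R U 1 1 1 1 1 1 f = ∑ s, -μ s * ‖Φ f s‖ ^ 2 := fun f => by
    have h1 := energy_of_diagonalization hΦ hμ f
    rw [energy_twistedOp R U 1 1 hone hone] at h1
    have h2 := ofReal_injective h1
    simp only [neg_mul, Finset.sum_neg_distrib]
    linarith
  obtain ⟨c, hc, hcμ⟩ := exists_pos_le_abs μ
  refine ⟨c, hc, fun f hf => ?_⟩
  rw [← hE, hEμ, ← l2sq_map_of_unitary hΦ, l2sq, Finset.mul_sum]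
  refine Finset.sum_le_sum fun i _ => ?_
  obtain ⟨w, hw, hTw, hwf⟩ := exists_eigenvector_of_diagonalization hμ i
  have hEw := twistedEnergy_of_eigenvector hone hone hTw
  have hE0 : ∀ f : σ → ℂ, 0 ≤ ∑ s, ‖f (R s) - f s‖ ^ 2 ∧ 0 ≤ ∑ s, ‖f (U s) - f s‖ ^ 2 :=
    fun f => ⟨Finset.sum_nonneg fun _ _ => by positivity,
      Finset.sum_nonneg fun _ _ => by positivity⟩
  rw [hE] at hEw
  by_cases hi : μ i = 0
  · have hinv : IsInvariantField R U w := by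
      rw [hi, neg_zero, zero_mul] at hEw
      have h1 : ∑ s, ‖w (R s) - w s‖ ^ 2 = 0 := by linarith [(hE0 w).1, (hE0 w).2]
      have h2 : ∑ s, ‖w (U s) - w s‖ ^ 2 = 0 := by linarith [(hE0 w).1, (hE0 w).2]
      rw [Finset.sum_eq_zero_iff_of_nonneg fun _ _ => by positivity] at h1 h2
      exact ⟨fun s => by simpa [sub_eq_zero] using h1 s (Finset.mem_univ s),
        fun s => by simpa [sub_eq_zero] using h2 s (Finset.mem_univ s)⟩
    simp [hwf f (hf w hinv) hΦ]
  · have hneg : μ i ≤ 0 := by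
      have := l2sq_pos hw
      nlinarith [(hE0 w).1, (hE0 w).2]
    have := hcμ i hi
    rw [abs_of_nonpos hneg] at this
    exact mul_le_mul_of_nonneg_right this (by positivity)

lemma sum_norm_sub_sq_le (R : Equiv.Perm σ) {ζ : ℂ} (f : σ → ℂ) :
    ∑ s, ‖f (R s) - f s‖ ^ 2 ≤ 2 * ∑ s, ‖ζ * f (R s) - f s‖ ^ 2 + 2 * ‖ζ - 1‖ ^ 2 * l2sq f := by
  have : l2sq f = ∑ s, ‖f (R s)‖ ^ 2 := (Equiv.sum_comp R fun s => ‖f s‖ ^ 2).symm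
  rw [this, Finset.mul_sum, Finset.mul_sum, ← Finset.sum_add_distrib]
  refine Finset.sum_le_sum fun s _ => ?_
  have h0 : f (R s) - f s = (ζ * f (R s) - f s) - (ζ - 1) * f (R s) := by ring
  have h1 : ‖f (R s) - f s‖ ≤ ‖ζ * f (R s) - f s‖ + ‖ζ - 1‖ * ‖f (R s)‖ := by
    rw [← norm_mul]
    conv_lhs => rw [h0]
    exact norm_sub_le _ _
  have h2 := pow_le_pow_left₀ (norm_nonneg _) h1 2
  nlinarith [sq_nonneg (‖ζ * f (R s) - f s‖ - ‖ζ - 1‖ * ‖f (R s)‖)]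

/-- For phase factors near one, the energy is coercive on fields orthogonal to the invariant ones,
whatever the ratio of the spacings. -/
lemma twistedEnergy_coercive {R U : Equiv.Perm σ} {c : ℝ}
    (hc : ∀ f : σ → ℂ, (∀ g, IsInvariantField R U g → star g ⬝ᵥ f = 0) →
      c * l2sq f ≤ ∑ s, ‖f (R s) - f s‖ ^ 2 + ∑ s, ‖f (U s) - f s‖ ^ 2)
    {a b : σ → ℝ} {κ₀ : ℝ} (hκ₀ : 0 < κ₀) (ha : ∀ s, κ₀ ≤ a s) (hb : ∀ s, κ₀ ≤ b s)
    {ζx ζy : ℂ} (hζ : ‖ζx - 1‖ ^ 2 + ‖ζy - 1‖ ^ 2 ≤ c / 4) {dx dy d : ℝ} (hdx : 0 < dx)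
    (hdy : 0 < dy) (hxd : dx ≤ d) (hyd : dy ≤ d) {f : σ → ℂ}
    (hf : ∀ g, IsInvariantField R U g → star g ⬝ᵥ f = 0) :
    κ₀ * c / 4 / d ^ 2 * l2sq f
      ≤ twistedEnergy R U a b (fun _ => ζx) (fun _ => ζy) dx dy f := by
  have hdir : ∀ (R : Equiv.Perm σ) (a : σ → ℝ) (ζ : ℂ) (e : ℝ), (∀ s, κ₀ ≤ a s) → 0 < e → e ≤ d →
      κ₀ * (∑ s, ‖ζ * f (R s) - f s‖ ^ 2) / d ^ 2
        ≤ (∑ s, a s * ‖ζ * f (R s) - f s‖ ^ 2) / e ^ 2 := by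
    intro R a ζ e ha he hed
    have h1 : κ₀ * (∑ s, ‖ζ * f (R s) - f s‖ ^ 2) ≤ ∑ s, a s * ‖ζ * f (R s) - f s‖ ^ 2 := by
      rw [Finset.mul_sum]
      exact Finset.sum_le_sum fun s _ => mul_le_mul_of_nonneg_right (ha s) (by positivity)
    have h0 : 0 ≤ κ₀ * (∑ s, ‖ζ * f (R s) - f s‖ ^ 2) := by positivity
    exact div_le_div₀ (h0.trans h1) h1 (by positivity) (by gcongr)
  have hx := hdir R a ζx dx ha hdx hxd
  have hy := hdir U b ζy dy hb hdy hyd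
  have h1 := hc f hf
  have h2 := sum_norm_sub_sq_le R (ζ := ζx) f
  have h3 := sum_norm_sub_sq_le U (ζ := ζy) f
  have h4 := mul_le_mul_of_nonneg_right hζ (l2sq_nonneg f)
  have h5 : c / 4 * l2sq f ≤ ∑ s, ‖ζx * f (R s) - f s‖ ^ 2 + ∑ s, ‖ζy * f (U s) - f s‖ ^ 2 := by
    linarith
  refine le_trans ?_ (add_le_add hx hy)
  rw [← add_div, ← mul_add, div_mul_eq_mul_div]
  have hd : 0 < d := hdx.trans_le hxd
  refine div_le_div_of_nonneg_right ?_ (by positivity)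
  calc κ₀ * c / 4 * l2sq f = κ₀ * (c / 4 * l2sq f) := by ring
    _ ≤ _ := mul_le_mul_of_nonneg_left h5 hκ₀.le

/-- On each component, any two modes with rates above the gap are linearly dependent: otherwise
some combination has mean zero, and its energy would be both small and large. -/
lemma slow_modes_dependent {R U : Equiv.Perm σ} {c : ℝ}
    (hc : ∀ f : σ → ℂ, (∀ g, IsInvariantField R U g → star g ⬝ᵥ f = 0) →
      c * l2sq f ≤ ∑ s, ‖f (R s) - f s‖ ^ 2 + ∑ s, ‖f (U s) - f s‖ ^ 2)
    {a b : σ → ℝ} {κ₀ : ℝ} (hκ₀ : 0 < κ₀) (ha : ∀ s, κ₀ ≤ a s) (hb : ∀ s, κ₀ ≤ b s)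
    {ζx ζy : ℂ} (hx1 : ‖ζx‖ = 1) (hy1 : ‖ζy‖ = 1)
    (hζ : ‖ζx - 1‖ ^ 2 + ‖ζy - 1‖ ^ 2 ≤ c / 4) {dx dy d : ℝ} (hdx : 0 < dx)
    (hdy : 0 < dy) (hxd : dx ≤ d) (hyd : dy ≤ d) {w₁ w₂ : σ → ℂ} {μ₁ μ₂ : ℝ}
    (h₁ : twistedOp R U a b (fun _ => ζx) (fun _ => ζy) dx dy w₁ = (μ₁ : ℂ) • w₁)
    (h₂ : twistedOp R U a b (fun _ => ζx) (fun _ => ζy) dx dy w₂ = (μ₂ : ℂ) • w₂)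
    (hμ₁ : -(κ₀ * c / 4 / d ^ 2) < μ₁) (hμ₂ : -(κ₀ * c / 4 / d ^ 2) < μ₂) (s₀ : σ) :
    ∃ c₁ c₂ : ℂ, (c₁ ≠ 0 ∨ c₂ ≠ 0) ∧ ∀ s ∈ component R U s₀, c₁ * w₁ s + c₂ * w₂ s = 0 := by
  wlog hle : μ₁ ≤ μ₂ generalizing w₁ w₂ μ₁ μ₂
  · obtain ⟨c₂, c₁, h0, h⟩ := this h₂ h₁ hμ₂ hμ₁ (le_of_not_ge hle)
    exact ⟨c₁, c₂, h0.symm, fun s hs => by rw [add_comm]; exact h s hs⟩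
  set T := twistedOp R U a b (fun _ => ζx) (fun _ => ζy) dx dy with hT
  have hherm : IsHermitianOp T := isHermitianOp_twistedOp R U a b _ _ dx dy
  set O := component R U s₀ with hO
  have hcomm : ∀ w, T (O.indicator w) = O.indicator (T w) := fun w =>
    twistedOp_indicator a b _ _ w dx dy (fun s => apply_mem_component_iff.1)
      fun s => apply_mem_component_iff.2
  have hu : ∀ {w : σ → ℂ} {μ : ℝ}, T w = (μ : ℂ) • w →
      T (O.indicator w) = (μ : ℂ) • O.indicator w := fun {w μ} h => by
    rw [hcomm, h]; exact Set.indicator_const_smul O (μ : ℂ) w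
  set u₁ := O.indicator w₁ with hu₁
  set u₂ := O.indicator w₂ with hu₂
  have hTu₁ := hu h₁
  have hTu₂ := hu h₂
  obtain ⟨c₁, c₂, hne, hsum⟩ : ∃ c₁ c₂ : ℂ, (c₁ ≠ 0 ∨ c₂ ≠ 0) ∧
      ∑ s, (c₁ * u₁ s + c₂ * u₂ s) = 0 := by
    by_cases h : ∑ s, u₁ s = 0
    · exact ⟨1, 0, Or.inl one_ne_zero, by simpa using h⟩
    · refine ⟨-∑ s, u₂ s, ∑ s, u₁ s, Or.inr h, ?_⟩
      rw [Finset.sum_add_distrib, ← Finset.mul_sum, ← Finset.mul_sum]; ring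
  refine ⟨c₁, c₂, hne, fun s hs => ?_⟩
  set f : σ → ℂ := c₁ • u₁ + c₂ • u₂ with hf
  have hfO : ∀ s, s ∉ O → f s = 0 := fun s hs => by simp [hf, hu₁, hu₂, hs]
  have horth : ∀ g, IsInvariantField R U g → star g ⬝ᵥ f = 0 := fun g hg => by
    have h1 : ∀ s, star g s * f s = star (g s₀) * (c₁ * u₁ s + c₂ * u₂ s) := fun s => by
      by_cases hs : s ∈ O
      · rw [Pi.star_apply, hs g hg]; rfl
      · have := hfO s hs
        rw [this, mul_zero]
        have h2 : c₁ * u₁ s + c₂ * u₂ s = f s := rfl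
        rw [h2, this, mul_zero]
    rw [dotProduct, Finset.sum_congr rfl fun s _ => h1 s, ← Finset.mul_sum, hsum, mul_zero]
  have hcoer := twistedEnergy_coercive hc hκ₀ ha hb hζ hdx hdy hxd hyd horth
  have hEf := energy_twistedOp R U a b (fun _ => hx1) (fun _ => hy1) dx dy f
  have horth12 : ((μ₂ - μ₁ : ℝ) : ℂ) * (star u₁ ⬝ᵥ u₂) = 0 := by
    by_cases h : μ₁ = μ₂
    · simp [h]
    · rw [eigenvectors_orthogonal hherm hTu₁ hTu₂ h, mul_zero]
  have hTf : star f ⬝ᵥ T f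
      = ((μ₁ * l2sq f + ‖c₂‖ ^ 2 * ((μ₂ - μ₁) * l2sq u₂) : ℝ) : ℂ) := by
    have h1 : T f = (μ₁ : ℂ) • f + (c₂ * ((μ₂ - μ₁ : ℝ) : ℂ)) • u₂ := by
      rw [hf, map_add, map_smul, map_smul, hTu₁, hTu₂]
      ext s
      simp only [Pi.add_apply, Pi.smul_apply, smul_eq_mul]
      push_cast
      ring
    rw [h1, dotProduct_add, dotProduct_smul, dotProduct_smul, star_dotProduct_self]
    have h2 : star f ⬝ᵥ u₂ = star c₁ * (star u₁ ⬝ᵥ u₂) + star c₂ * (l2sq u₂ : ℂ) := by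
      rw [hf, star_add, star_smul, star_smul, add_dotProduct, smul_dotProduct, smul_dotProduct,
        star_dotProduct_self]
      rfl
    rw [h2]
    push_cast at horth12 ⊢
    rw [← Complex.conj_mul' c₂]
    simp only [smul_eq_mul, RCLike.star_def]
    linear_combination (c₂ * (starRingEnd ℂ) c₁) * horth12
  rw [← hT, hTf] at hEf
  have hEf' := ofReal_injective hEf
  have h3 : 0 ≤ ‖c₂‖ ^ 2 * ((μ₂ - μ₁) * l2sq u₂) :=
    mul_nonneg (by positivity) (mul_nonneg (by linarith) (l2sq_nonneg _))
  have hf0 : f = 0 := by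
    by_contra h
    have := l2sq_pos h
    nlinarith
  have h4 := congrFun hf0 s
  simpa [hf, hu₁, hu₂, hs] using h4

end Gap

/-! ### The homogenised rate -/

section HomRate

variable {px py : ℕ}

/-- The phase factor between neighbours at distance `d`, at wavenumber `q`. -/
noncomputable def phase (q d : ℝ) : ℂ := exp (I * ((q * d : ℝ) : ℂ))

lemma norm_phase (q d : ℝ) : ‖phase q d‖ = 1 := by
  rw [phase, mul_comm]; exact norm_exp_ofReal_mul_I _

lemma conj_phase (q d : ℝ) : (starRingEnd ℂ) (phase q d) = phase (-q) d := by
  rw [phase, phase, ← exp_conj, map_mul, conj_I, conj_ofReal]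
  congr 1; push_cast; ring

lemma norm_phase_sub_one_le (q d : ℝ) : ‖phase q d - 1‖ ≤ |q * d| :=
  Real.norm_exp_I_mul_ofReal_sub_one_le

lemma norm_phase_sub_le (q q' d : ℝ) : ‖phase q' d - phase q d‖ ≤ |q' - q| * |d| := by
  have h : phase q' d - phase q d = phase q d * (phase (q' - q) d - 1) := by
    rw [mul_sub, mul_one, phase, phase, phase, ← exp_add]
    congr 2; push_cast; ring
  rw [h, norm_mul, norm_phase, one_mul, ← abs_mul]
  exact norm_phase_sub_one_le _ _

/-- Translation of the ensemble index in `x`. -/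
def shiftX (px py : ℕ) : Equiv.Perm (ZMod px × ZMod py) := Equiv.addRight (1, 0)

/-- Translation of the ensemble index in `y`. -/
def shiftY (px py : ℕ) : Equiv.Perm (ZMod px × ZMod py) := Equiv.addRight (0, 1)

lemma shiftX_apply (s : ZMod px × ZMod py) : shiftX px py s = (s.1 + 1, s.2) := by
  simp [shiftX, Prod.ext_iff]

lemma shiftY_apply (s : ZMod px × ZMod py) : shiftY px py s = (s.1, s.2 + 1) := by
  simp [shiftY, Prod.ext_iff]

lemma shiftX_symm_apply (s : ZMod px × ZMod py) : (shiftX px py).symm s = (s.1 - 1, s.2) := by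
  rw [Equiv.symm_apply_eq, shiftX_apply]; simp

lemma shiftY_symm_apply (s : ZMod px × ZMod py) : (shiftY px py).symm s = (s.1, s.2 - 1) := by
  rw [Equiv.symm_apply_eq, shiftY_apply]; simp

lemma shiftX_pow (p : ℕ) (s : ZMod px × ZMod py) : (shiftX px py ^ p) s = (s.1 + p, s.2) := by
  induction p with
  | zero => simp
  | succ p ih =>
    rw [pow_succ', Equiv.Perm.mul_apply, ih, shiftX_apply]; push_cast; rw [add_assoc]

lemma shiftY_pow (p : ℕ) (s : ZMod px × ZMod py) : (shiftY px py ^ p) s = (s.1, s.2 + p) := by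
  induction p with
  | zero => simp
  | succ p ih =>
    rw [pow_succ', Equiv.Perm.mul_apply, ih, shiftY_apply]; push_cast; rw [add_assoc]

/-- The Fourier symbol of the ensemble system, as a twisted diffusion on one period. -/
noncomputable def latticeOp (κx κy : ZMod px → ZMod py → ℝ) (dx dy : ℝ) (q : ℝ × ℝ) :
    (ZMod px × ZMod py → ℂ) →ₗ[ℂ] (ZMod px × ZMod py → ℂ) :=
  twistedOp (shiftX px py) (shiftY px py) (Function.uncurry κx) (Function.uncurry κy)
    (fun _ => phase q.1 dx) (fun _ => phase q.2 dy) dx dy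

/-- The energy of the Fourier symbol. -/
noncomputable def latticeEnergy [NeZero px] [NeZero py] (κx κy : ZMod px → ZMod py → ℝ)
    (dx dy : ℝ) (q : ℝ × ℝ) : (ZMod px × ZMod py → ℂ) → ℝ :=
  twistedEnergy (shiftX px py) (shiftY px py) (Function.uncurry κx) (Function.uncurry κy)
    (fun _ => phase q.1 dx) (fun _ => phase q.2 dy) dx dy

lemma uncurry_ensembleSymbol (κx κy : ZMod px → ZMod py → ℝ) (dx dy : ℝ) (q : ℝ × ℝ)
    (w : ZMod px → ZMod py → ℂ) :
    Function.uncurry (ensembleSymbol κx κy dx dy q.1 q.2 w)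
      = latticeOp κx κy dx dy q (Function.uncurry w) := by
  ext ⟨k, l⟩
  simp only [latticeOp, twistedOp_apply, dirOp_apply, shiftX_apply, shiftY_apply,
    shiftX_symm_apply, shiftY_symm_apply, Function.uncurry, ensembleSymbol, conj_phase]
  have h : ∀ q d : ℝ, exp (I * q * d) = phase q d := fun q d => by
    rw [phase]; congr 1; push_cast; ring
  have h' : ∀ q d : ℝ, exp (-(I * q * d)) = phase (-q) d := fun q d => by
    rw [phase]; congr 1; push_cast; ring
  rw [h, h, h', h']

lemma isLatticeMode_iff {κx κy : ZMod px → ZMod py → ℝ} {dx dy : ℝ} {q : ℝ × ℝ} {μ : ℝ}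
    {w : ZMod px → ZMod py → ℂ} : IsLatticeMode κx κy dx dy q μ w ↔ Function.uncurry w ≠ 0 ∧
      latticeOp κx κy dx dy q (Function.uncurry w) = (μ : ℂ) • Function.uncurry w := by
  have h1 : ∀ v v' : ZMod px → ZMod py → ℂ, Function.uncurry v = Function.uncurry v' ↔ v = v' :=
    fun v v' => ⟨fun h => by rw [← Function.curry_uncurry v, h, Function.curry_uncurry],
      fun h => by rw [h]⟩
  rw [← uncurry_ensembleSymbol, IsLatticeMode]
  have h2 : (μ : ℂ) • Function.uncurry w = Function.uncurry ((μ : ℂ) • w) := rfl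
  have h3 : (0 : ZMod px × ZMod py → ℂ) = Function.uncurry (0 : ZMod px → ZMod py → ℂ) := rfl
  rw [h2, h3, Ne, Ne, h1, h1]

lemma exists_isLatticeMode_iff {κx κy : ZMod px → ZMod py → ℝ} {dx dy : ℝ} {q : ℝ × ℝ} {μ : ℝ} :
    (∃ w, IsLatticeMode κx κy dx dy q μ w) ↔
      ∃ w, w ≠ 0 ∧ latticeOp κx κy dx dy q w = (μ : ℂ) • w := by
  refine ⟨fun ⟨w, hw⟩ => ⟨_, isLatticeMode_iff.1 hw⟩, fun ⟨w, hw⟩ => ⟨Function.curry w, ?_⟩⟩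
  rw [isLatticeMode_iff, Function.uncurry_curry]
  exact hw

/-- The homogenised rate is even, as the operators at `q` and `-q` are complex conjugate. -/
lemma homRate_neg (κx κy : ZMod px → ZMod py → ℝ) (dx dy : ℝ) (q : ℝ × ℝ) :
    homRate κx κy dx dy (-q) = homRate κx κy dx dy q := by
  have key : ∀ q μ, (∃ w, w ≠ 0 ∧ latticeOp κx κy dx dy q w = ((μ : ℝ) : ℂ) • w) →
      ∃ w, w ≠ 0 ∧ latticeOp κx κy dx dy (-q) w = ((μ : ℝ) : ℂ) • w := by
    rintro q μ ⟨w, hw, h⟩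
    refine ⟨star w, by simpa using hw, ?_⟩
    ext s
    have h1 := congrArg (starRingEnd ℂ) (congrFun h s)
    simp only [latticeOp, twistedOp_apply, dirOp_apply, Pi.smul_apply, smul_eq_mul, map_add,
      map_sub, map_mul, map_div₀, map_pow, conj_ofReal, conj_phase] at h1
    simp only [latticeOp, twistedOp_apply, dirOp_apply, Pi.smul_apply, smul_eq_mul,
      conj_phase, Pi.star_apply, RCLike.star_def, Prod.fst_neg, Prod.snd_neg]
    exact h1
  rw [homRate, homRate]
  congr 1
  ext μ
  simp only [Set.mem_ofPred_eq, exists_isLatticeMode_iff]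
  refine ⟨fun h => ?_, key q μ⟩
  simpa using key _ _ h

variable [NeZero px] [NeZero py]

lemma latticeEnergy_nonneg {κx κy : ZMod px → ZMod py → ℝ} (hκx : ∀ k l, 0 < κx k l)
    (hκy : ∀ k l, 0 < κy k l) (dx dy : ℝ) (q : ℝ × ℝ) (f : ZMod px × ZMod py → ℂ) :
    0 ≤ latticeEnergy κx κy dx dy q f := by
  refine add_nonneg (div_nonneg (Finset.sum_nonneg fun s _ => ?_) (sq_nonneg _))
    (div_nonneg (Finset.sum_nonneg fun s _ => ?_) (sq_nonneg _))
  · exact mul_nonneg (hκx s.1 s.2).le (sq_nonneg _)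
  · exact mul_nonneg (hκy s.1 s.2).le (sq_nonneg _)

lemma latticeEnergy_of_eigenvector {κx κy : ZMod px → ZMod py → ℝ} {dx dy : ℝ} {q : ℝ × ℝ}
    {μ : ℝ} {w : ZMod px × ZMod py → ℂ} (h : latticeOp κx κy dx dy q w = (μ : ℂ) • w) :
    latticeEnergy κx κy dx dy q w = -μ * l2sq w :=
  twistedEnergy_of_eigenvector (fun _ => norm_phase _ _) (fun _ => norm_phase _ _) h

/-- The homogenised rate is the largest eigenvalue, given by the Rayleigh principle. -/
lemma homRate_spec (κx κy : ZMod px → ZMod py → ℝ) (dx dy : ℝ) (q : ℝ × ℝ) :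
    (∃ w, w ≠ 0 ∧ latticeOp κx κy dx dy q w = (homRate κx κy dx dy q : ℂ) • w) ∧
    (∀ μ : ℝ, (∃ w, w ≠ 0 ∧ latticeOp κx κy dx dy q w = (μ : ℂ) • w) →
      μ ≤ homRate κx κy dx dy q) ∧
    ∀ f, -homRate κx κy dx dy q * l2sq f ≤ latticeEnergy κx κy dx dy q f := by
  obtain ⟨Φ, m, hΦ, hm⟩ := exists_diagonalization
    (isHermitianOp_twistedOp (shiftX px py) (shiftY px py) (Function.uncurry κx)
      (Function.uncurry κy) (fun _ => phase q.1 dx) (fun _ => phase q.2 dy) dx dy)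
  have hset : {μ : ℝ | ∃ w, IsLatticeMode κx κy dx dy q μ w} = Set.range m := by
    ext μ
    rw [Set.mem_ofPred_eq, exists_isLatticeMode_iff]
    constructor
    · rintro ⟨w, hw, h⟩
      exact exists_eq_of_eigenvector hm hw h
    · rintro ⟨i, rfl⟩
      obtain ⟨w, hw, h, -⟩ := exists_eigenvector_of_diagonalization hm i
      exact ⟨w, hw, h⟩
  have hΛ : homRate κx κy dx dy q = sSup (Set.range m) := by rw [homRate, hset]
  have hle : ∀ i, m i ≤ homRate κx κy dx dy q := fun i => by
    rw [hΛ]; exact le_csSup (Set.finite_range m).bddAbove ⟨i, rfl⟩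
  refine ⟨?_, fun μ h => ?_, fun f => ?_⟩
  · rw [← exists_isLatticeMode_iff]
    have h : homRate κx κy dx dy q ∈ Set.range m := by
      rw [hΛ]; exact (Set.range_nonempty m).csSup_mem (Set.finite_range m)
    rw [← hset] at h
    exact h
  · rw [← exists_isLatticeMode_iff] at h
    have h' : μ ∈ Set.range m := by rw [← hset]; exact h
    obtain ⟨i, rfl⟩ := h'
    exact hle i
  · have h1 := energy_of_diagonalization hΦ hm f
    rw [energy_twistedOp _ _ _ _ (fun _ => norm_phase _ _) (fun _ => norm_phase _ _)] at h1
    have h2 := ofReal_injective h1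
    have h3 : ∑ s, m s * ‖Φ f s‖ ^ 2 ≤ homRate κx κy dx dy q * l2sq f := by
      rw [← l2sq_map_of_unitary hΦ, l2sq, Finset.mul_sum]
      exact Finset.sum_le_sum fun s _ => mul_le_mul_of_nonneg_right (hle s) (by positivity)
    rw [latticeEnergy]
    linarith

lemma homRate_nonpos {κx κy : ZMod px → ZMod py → ℝ} (hκx : ∀ k l, 0 < κx k l)
    (hκy : ∀ k l, 0 < κy k l) (dx dy : ℝ) (q : ℝ × ℝ) : homRate κx κy dx dy q ≤ 0 := by
  obtain ⟨w, hw, h⟩ := (homRate_spec κx κy dx dy q).1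
  have h1 := latticeEnergy_of_eigenvector h
  have h2 := latticeEnergy_nonneg hκx hκy dx dy q w
  have h3 := l2sq_pos hw
  nlinarith

/-- The constant field bounds the homogenised rate from below. -/
lemma neg_homRate_le {κx κy : ZMod px → ZMod py → ℝ} {K : ℝ} (hK : 0 ≤ K)
    (hκx : ∀ k l, κx k l ≤ K) (hκy : ∀ k l, κy k l ≤ K) {dx dy : ℝ} (hdx : 0 < dx)
    (hdy : 0 < dy) (q : ℝ × ℝ) : -homRate κx κy dx dy q ≤ K * (q.1 ^ 2 + q.2 ^ 2) := by
  have h := (homRate_spec κx κy dx dy q).2.2 1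
  have hcard : 0 < l2sq (1 : ZMod px × ZMod py → ℂ) := l2sq_pos one_ne_zero
  have hdir : ∀ (a : ZMod px × ZMod py → ℝ) (q d : ℝ), 0 < d → (∀ s, a s ≤ K) →
      (∑ s, a s * ‖phase q d * 1 - 1‖ ^ 2) / d ^ 2
        ≤ K * q ^ 2 * l2sq (1 : ZMod px × ZMod py → ℂ) := by
    intro a q d hd ha
    rw [div_le_iff₀ (by positivity), l2sq, Finset.mul_sum, Finset.sum_mul]
    refine Finset.sum_le_sum fun s _ => ?_
    have h1 : ‖phase q d - 1‖ ^ 2 ≤ q ^ 2 * d ^ 2 := by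
      rw [← mul_pow, ← sq_abs (q * d)]
      exact pow_le_pow_left₀ (norm_nonneg _) (norm_phase_sub_one_le q d) 2
    rw [Pi.one_apply, norm_one, one_pow, mul_one, mul_one]
    calc a s * ‖phase q d - 1‖ ^ 2 ≤ K * ‖phase q d - 1‖ ^ 2 :=
          mul_le_mul_of_nonneg_right (ha s) (by positivity)
      _ ≤ K * (q ^ 2 * d ^ 2) := mul_le_mul_of_nonneg_left h1 hK
      _ = _ := by ring
  have h1 := hdir (Function.uncurry κx) q.1 dx hdx fun s => hκx s.1 s.2
  have h2 := hdir (Function.uncurry κy) q.2 dy hdy fun s => hκy s.1 s.2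
  have h3 : -homRate κx κy dx dy q * l2sq (1 : ZMod px × ZMod py → ℂ)
      ≤ K * (q.1 ^ 2 + q.2 ^ 2) * l2sq (1 : ZMod px × ZMod py → ℂ) :=
    h.trans ((add_le_add h1 h2).trans (le_of_eq (by ring)))
  exact le_of_mul_le_mul_right h3 hcard

lemma norm_add_sq_le (x y : ℂ) {t : ℝ} (ht : 0 < t) :
    ‖x + y‖ ^ 2 ≤ (1 + t) * ‖x‖ ^ 2 + (1 + t⁻¹) * ‖y‖ ^ 2 := by
  have h1 := pow_le_pow_left₀ (norm_nonneg _) (norm_add_le x y) 2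
  have h2 : 0 ≤ t⁻¹ * (t * ‖x‖ - ‖y‖) ^ 2 := by positivity
  have h3 : t⁻¹ * (t * ‖x‖ - ‖y‖) ^ 2 = t * ‖x‖ ^ 2 - 2 * ‖x‖ * ‖y‖ + t⁻¹ * ‖y‖ ^ 2 := by
    field_simp
    ring
  nlinarith

/-- One half of the local Lipschitz continuity of the homogenised rate, uniformly in the
spacings: the slow mode at `q` is a trial field at `q'`. -/
lemma homRate_sub_le {κx κy : ZMod px → ZMod py → ℝ} {K : ℝ} (hK : 0 ≤ K)
    (hκx : ∀ k l, 0 < κx k l) (hκy : ∀ k l, 0 < κy k l)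
    (hκx' : ∀ k l, κx k l ≤ K) (hκy' : ∀ k l, κy k l ≤ K) {dx dy : ℝ} (hdx : 0 < dx)
    (hdy : 0 < dy) (q q' : ℝ × ℝ) {δ : ℝ} (hδ : 0 < δ) (h1 : |q'.1 - q.1| ≤ δ)
    (h2 : |q'.2 - q.2| ≤ δ) :
    homRate κx κy dx dy q - homRate κx κy dx dy q'
      ≤ δ * (K * (q.1 ^ 2 + q.2 ^ 2) + 2 * K * (1 + δ)) := by
  obtain ⟨w, hw, hmode⟩ := (homRate_spec κx κy dx dy q).1
  have hE := latticeEnergy_of_eigenvector hmode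
  have hE' := (homRate_spec κx κy dx dy q').2.2 w
  have hpos := l2sq_pos hw
  have hdir : ∀ (R : Equiv.Perm (ZMod px × ZMod py)) (a : ZMod px × ZMod py → ℝ) (q q' d : ℝ),
      0 < d → (∀ s, 0 < a s) → (∀ s, a s ≤ K) → |q' - q| ≤ δ →
      (∑ s, a s * ‖phase q' d * w (R s) - w s‖ ^ 2) / d ^ 2
        ≤ (1 + δ) * ((∑ s, a s * ‖phase q d * w (R s) - w s‖ ^ 2) / d ^ 2)
          + K * (δ + δ ^ 2) * l2sq w := by
    intro R a q q' d hd ha ha' hq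
    have hl : l2sq w = ∑ s, ‖w (R s)‖ ^ 2 := (Equiv.sum_comp R fun s => ‖w s‖ ^ 2).symm
    rw [← mul_div_assoc, div_le_iff₀ (by positivity), add_mul, div_mul_cancel₀ _ (by positivity),
      hl, Finset.mul_sum, Finset.mul_sum, Finset.sum_mul, ← Finset.sum_add_distrib]
    refine Finset.sum_le_sum fun s _ => ?_
    have h0 : phase q' d * w (R s) - w s
        = (phase q d * w (R s) - w s) + (phase q' d - phase q d) * w (R s) := by ring
    have h3 := norm_add_sq_le (phase q d * w (R s) - w s) ((phase q' d - phase q d) * w (R s)) hδ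
    rw [← h0, norm_mul, mul_pow] at h3
    have h4 : ‖phase q' d - phase q d‖ ^ 2 ≤ δ ^ 2 * d ^ 2 := by
      rw [← mul_pow]
      refine pow_le_pow_left₀ (norm_nonneg _) ((norm_phase_sub_le q q' d).trans ?_) 2
      rw [abs_of_pos hd]
      gcongr
    have h5 : (1 + δ⁻¹) * (‖phase q' d - phase q d‖ ^ 2 * ‖w (R s)‖ ^ 2)
        ≤ (δ + δ ^ 2) * d ^ 2 * ‖w (R s)‖ ^ 2 := by
      calc _ ≤ (1 + δ⁻¹) * (δ ^ 2 * d ^ 2 * ‖w (R s)‖ ^ 2) := by gcongr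
        _ = _ := by field_simp; ring
    calc a s * ‖phase q' d * w (R s) - w s‖ ^ 2
        ≤ a s * ((1 + δ) * ‖phase q d * w (R s) - w s‖ ^ 2
            + (δ + δ ^ 2) * d ^ 2 * ‖w (R s)‖ ^ 2) := by
          have := (ha s).le
          gcongr
          linarith
      _ ≤ (1 + δ) * (a s * ‖phase q d * w (R s) - w s‖ ^ 2)
            + K * ((δ + δ ^ 2) * d ^ 2 * ‖w (R s)‖ ^ 2) := by
          have := mul_le_mul_of_nonneg_right (ha' s)
            (by positivity : 0 ≤ (δ + δ ^ 2) * d ^ 2 * ‖w (R s)‖ ^ 2)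
          linarith
      _ = _ := by ring
  have hx := hdir (shiftX px py) (Function.uncurry κx) q.1 q'.1 dx hdx (fun s => hκx s.1 s.2)
    (fun s => hκx' s.1 s.2) h1
  have hy := hdir (shiftY px py) (Function.uncurry κy) q.2 q'.2 dy hdy (fun s => hκy s.1 s.2)
    (fun s => hκy' s.1 s.2) h2
  have h3 : -homRate κx κy dx dy q' * l2sq w
      ≤ ((1 + δ) * -homRate κx κy dx dy q + 2 * K * (δ + δ ^ 2)) * l2sq w := by
    have h4 : latticeEnergy κx κy dx dy q' w
        ≤ (1 + δ) * latticeEnergy κx κy dx dy q w + 2 * K * (δ + δ ^ 2) * l2sq w := by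
      refine (add_le_add hx hy).trans (le_of_eq ?_)
      rw [latticeEnergy, twistedEnergy]; ring
    rw [hE] at h4
    linarith
  have h4 := le_of_mul_le_mul_right h3 hpos
  have h5 := mul_le_mul_of_nonneg_left (neg_homRate_le hK hκx' hκy' hdx hdy q) hδ.le
  linarith

lemma abs_homRate_sub_le {κx κy : ZMod px → ZMod py → ℝ} {K : ℝ} (hK : 0 ≤ K)
    (hκx : ∀ k l, 0 < κx k l) (hκy : ∀ k l, 0 < κy k l)
    (hκx' : ∀ k l, κx k l ≤ K) (hκy' : ∀ k l, κy k l ≤ K) {dx dy : ℝ} (hdx : 0 < dx)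
    (hdy : 0 < dy) {q q' : ℝ × ℝ} {δ Q : ℝ} (hδ : 0 ≤ δ) (h1 : |q'.1 - q.1| ≤ δ)
    (h2 : |q'.2 - q.2| ≤ δ) (hQ : q.1 ^ 2 + q.2 ^ 2 ≤ Q) (hQ' : q'.1 ^ 2 + q'.2 ^ 2 ≤ Q) :
    |homRate κx κy dx dy q' - homRate κx κy dx dy q| ≤ δ * (K * Q + 2 * K * (1 + δ)) := by
  rcases hδ.eq_or_lt with rfl | hδ
  · have : q' = q := Prod.ext (by simpa [sub_eq_zero] using h1) (by simpa [sub_eq_zero] using h2)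
    simp [this]
  · have ha := homRate_sub_le hK hκx hκy hκx' hκy' hdx hdy q q' hδ h1 h2
    rw [abs_sub_comm] at h1 h2
    have hb := homRate_sub_le hK hκx hκy hκx' hκy' hdx hdy q' q hδ h1 h2
    have hc := mul_le_mul_of_nonneg_left hQ hK
    have hd := mul_le_mul_of_nonneg_left hQ' hK
    rw [abs_le]
    constructor <;> nlinarith

/-- A field cannot be nearly constant up to the phase `ζ` along a cycle of length `p`, unless
`ζ ^ p` is close to one. -/
lemma holonomy_le {σ : Type} [Fintype σ] (R : Equiv.Perm σ) {p : ℕ} (hR : R ^ p = 1) {ζ : ℂ}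
    (hζ : ‖ζ‖ = 1) (f : σ → ℂ) :
    ‖ζ ^ p - 1‖ ^ 2 * l2sq f ≤ p ^ 2 * ∑ s, ‖ζ * f (R s) - f s‖ ^ 2 := by
  have h1 : ∀ s, ‖ζ ^ p - 1‖ ^ 2 * ‖f s‖ ^ 2
      ≤ p * ∑ j ∈ Finset.range p, ‖ζ * f (R ((R ^ j) s)) - f ((R ^ j) s)‖ ^ 2 := fun s => by
    have htel : (ζ ^ p - 1) * f s
        = ∑ j ∈ Finset.range p, ζ ^ j * (ζ * f (R ((R ^ j) s)) - f ((R ^ j) s)) := by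
      have h2 := Finset.sum_range_sub (fun j => ζ ^ j * f ((R ^ j) s)) p
      simp only [hR, Equiv.Perm.coe_one, id_eq, pow_zero, one_mul] at h2
      rw [sub_mul, one_mul, ← h2]
      refine Finset.sum_congr rfl fun j _ => ?_
      rw [pow_succ' R, Equiv.Perm.mul_apply]; ring
    have h3 : ‖(ζ ^ p - 1) * f s‖
        ≤ ∑ j ∈ Finset.range p, ‖ζ * f (R ((R ^ j) s)) - f ((R ^ j) s)‖ := by
      rw [htel]
      refine (norm_sum_le _ _).trans (Finset.sum_le_sum fun j _ => ?_)
      rw [norm_mul, norm_pow, hζ, one_pow, one_mul]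
    rw [← mul_pow, ← norm_mul]
    refine (pow_le_pow_left₀ (norm_nonneg _) h3 2).trans ?_
    simpa using sq_sum_le_card_mul_sum_sq (s := Finset.range p)
      (f := fun j => ‖ζ * f (R ((R ^ j) s)) - f ((R ^ j) s)‖)
  rw [l2sq, Finset.mul_sum]
  refine (Finset.sum_le_sum fun s _ => h1 s).trans (le_of_eq ?_)
  rw [← Finset.mul_sum, Finset.sum_comm]
  have h4 : ∀ j ∈ Finset.range p, ∑ s, ‖ζ * f (R ((R ^ j) s)) - f ((R ^ j) s)‖ ^ 2
      = ∑ s, ‖ζ * f (R s) - f s‖ ^ 2 := fun j _ =>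
    Equiv.sum_comp (R ^ j) fun s => ‖ζ * f (R s) - f s‖ ^ 2
  rw [Finset.sum_congr rfl h4, Finset.sum_const, Finset.card_range, nsmul_eq_mul]
  ring

/-- The phase factor of a whole period cannot be removed by a change of gauge, so it keeps the
homogenised rate away from zero. -/
lemma homRate_le_holonomy {κx κy : ZMod px → ZMod py → ℝ} {κ₀ : ℝ} (hκ₀ : 0 ≤ κ₀)
    (hκx : ∀ k l, κ₀ ≤ κx k l) (hκy : ∀ k l, κ₀ ≤ κy k l) (dx dy : ℝ) (q : ℝ × ℝ) :
    homRate κx κy dx dy q ≤ -(κ₀ * (‖phase q.1 dx ^ px - 1‖ ^ 2 / px ^ 2 / dx ^ 2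
      + ‖phase q.2 dy ^ py - 1‖ ^ 2 / py ^ 2 / dy ^ 2)) := by
  obtain ⟨w, hw, hmode⟩ := (homRate_spec κx κy dx dy q).1
  have hE := latticeEnergy_of_eigenvector hmode
  have hpos := l2sq_pos hw
  have hdir : ∀ (R : Equiv.Perm (ZMod px × ZMod py)) (p : ℕ) [NeZero p]
      (a : ZMod px × ZMod py → ℝ) (q d : ℝ), R ^ p = 1 → (∀ s, κ₀ ≤ a s) →
      κ₀ * (‖phase q d ^ p - 1‖ ^ 2 / p ^ 2 / d ^ 2) * l2sq w
        ≤ (∑ s, a s * ‖phase q d * w (R s) - w s‖ ^ 2) / d ^ 2 := by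
    intro R p _ a q d hR ha
    have hp : (0 : ℝ) < p := by exact_mod_cast Nat.pos_of_neZero p
    have h1 := holonomy_le R hR (norm_phase q d) w
    have h2 : κ₀ * ∑ s, ‖phase q d * w (R s) - w s‖ ^ 2
        ≤ ∑ s, a s * ‖phase q d * w (R s) - w s‖ ^ 2 := by
      rw [Finset.mul_sum]
      exact Finset.sum_le_sum fun s _ => mul_le_mul_of_nonneg_right (ha s) (by positivity)
    have h3 : κ₀ * (‖phase q d ^ p - 1‖ ^ 2 / p ^ 2 / d ^ 2) * l2sq w
        = κ₀ * (‖phase q d ^ p - 1‖ ^ 2 * l2sq w / p ^ 2) / d ^ 2 := by ring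
    rw [h3]
    refine div_le_div_of_nonneg_right (le_trans ?_ h2) (sq_nonneg _)
    refine mul_le_mul_of_nonneg_left ?_ hκ₀
    rw [div_le_iff₀ (by positivity), mul_comm _ ((p : ℝ) ^ 2)]
    exact h1
  have hx := hdir (shiftX px py) px (Function.uncurry κx) q.1 dx
    (by ext s <;> simp [shiftX_pow]) fun s => hκx s.1 s.2
  have hy := hdir (shiftY px py) py (Function.uncurry κy) q.2 dy
    (by ext s <;> simp [shiftY_pow]) fun s => hκy s.1 s.2
  have h1 := add_le_add hx hy
  rw [← add_mul, ← mul_add] at h1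
  have h2 := h1.trans (le_of_eq hE)
  have h3 := le_of_mul_le_mul_right h2 hpos
  linarith

/-- A twisted diffusion on any lattice that maps to one period of the diffusivities has no rates
in the gap except for the homogenised one: pull back the slowest mode of one period. -/
lemma rate_eq_homRate_or_le {σ : Type} [Fintype σ] {R U : Equiv.Perm σ}
    {π : σ → ZMod px × ZMod py} (hR : ∀ s, π (R s) = shiftX px py (π s))
    (hU : ∀ s, π (U s) = shiftY px py (π s)) {c : ℝ}
    (hc : ∀ f : σ → ℂ, (∀ g, IsInvariantField R U g → star g ⬝ᵥ f = 0) →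
      c * l2sq f ≤ ∑ s, ‖f (R s) - f s‖ ^ 2 + ∑ s, ‖f (U s) - f s‖ ^ 2)
    {κx κy : ZMod px → ZMod py → ℝ} {κ₀ : ℝ} (hκ₀ : 0 < κ₀) (hκx : ∀ k l, κ₀ ≤ κx k l)
    (hκy : ∀ k l, κ₀ ≤ κy k l) {dx dy d : ℝ} (hdx : 0 < dx)
    (hdy : 0 < dy) (hxd : dx ≤ d) (hyd : dy ≤ d) {q : ℝ × ℝ}
    (hζ : ‖phase q.1 dx - 1‖ ^ 2 + ‖phase q.2 dy - 1‖ ^ 2 ≤ c / 4)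
    (hΛ : -(κ₀ * c / 4 / d ^ 2) < homRate κx κy dx dy q) {w : σ → ℂ} (hw : w ≠ 0) {μ : ℝ}
    (h : twistedOp R U (Function.uncurry κx ∘ π) (Function.uncurry κy ∘ π)
      (fun _ => phase q.1 dx) (fun _ => phase q.2 dy) dx dy w = (μ : ℂ) • w) :
    μ = homRate κx κy dx dy q ∨ μ ≤ -(κ₀ * c / 4 / d ^ 2) := by
  by_contra hcon
  rw [not_or, not_le] at hcon
  obtain ⟨W, hW, hmode⟩ := (homRate_spec κx κy dx dy q).1
  have hπW : twistedOp R U (Function.uncurry κx ∘ π) (Function.uncurry κy ∘ π)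
      (fun _ => phase q.1 dx) (fun _ => phase q.2 dy) dx dy (W ∘ π)
        = (homRate κx κy dx dy q : ℂ) • (W ∘ π) := by
    have h1 := twistedOp_comp hR hU (Function.uncurry κx) (Function.uncurry κy)
      (fun _ => phase q.1 dx) (fun _ => phase q.2 dy) W dx dy
    have h2 := congrArg (· ∘ π) hmode
    exact h1.trans h2
  obtain ⟨s₀, hs₀⟩ := Function.ne_iff.1 hw
  obtain ⟨t, ht⟩ := Function.ne_iff.1 hW
  obtain ⟨s₁, hs₁, hπs₁⟩ : ∃ s ∈ component R U s₀, π s = t := by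
    have hpow : ∀ (S S' : Equiv.Perm _) (_ : ∀ s, π (S s) = S' (π s)) (j : ℕ) (s : σ),
        π ((S ^ j) s) = (S' ^ j) (π s) := fun S S' hS j s => by
      induction j with
      | zero => simp
      | succ j ih => rw [pow_succ', pow_succ', Equiv.Perm.mul_apply, Equiv.Perm.mul_apply, hS, ih]
    have hmem : ∀ (S : Equiv.Perm σ) (_ : ∀ s, S s ∈ component R U s₀ ↔ s ∈ component R U s₀)
        (j : ℕ) (s : σ), s ∈ component R U s₀ → (S ^ j) s ∈ component R U s₀ :=
      fun S hS j s hs => by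
        induction j with
        | zero => simpa using hs
        | succ j ih => rw [pow_succ', Equiv.Perm.mul_apply, hS]; exact ih
    refine ⟨(R ^ (t.1 - (π s₀).1).val) ((U ^ (t.2 - (π s₀).2).val) s₀),
      hmem R (fun s => apply_mem_component_iff.1) _ _
        (hmem U (fun s => apply_mem_component_iff.2) _ _ fun g _ => rfl), ?_⟩
    rw [hpow R _ hR, hpow U _ hU, shiftX_pow, shiftY_pow]
    simp
  obtain ⟨c₁, c₂, hne, hdep⟩ := slow_modes_dependent hc hκ₀ (fun s => hκx _ _)
    (fun s => hκy _ _) (norm_phase _ _) (norm_phase _ _) hζ hdx hdy hxd hyd h hπW hcon.2 hΛ s₀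
  -- Both modes are nonzero on the component, so they are proportional there.
  have h₁ : c₁ ≠ 0 := fun h0 => by
    have h2 := hdep s₁ hs₁
    rw [h0, zero_mul, zero_add, Function.comp_apply, hπs₁] at h2
    rcases mul_eq_zero.1 h2 with h3 | h3
    · exact hne.elim (absurd h0) (absurd h3)
    · exact ht h3
  -- Cut off to the component, `w` is an eigenvector for both rates.
  set O := component R U s₀ with hO
  have hu : ∀ {w : σ → ℂ} {μ : ℝ}, twistedOp R U (Function.uncurry κx ∘ π)
      (Function.uncurry κy ∘ π) (fun _ => phase q.1 dx) (fun _ => phase q.2 dy) dx dy w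
        = (μ : ℂ) • w → twistedOp R U (Function.uncurry κx ∘ π)
      (Function.uncurry κy ∘ π) (fun _ => phase q.1 dx) (fun _ => phase q.2 dy) dx dy
        (O.indicator w) = (μ : ℂ) • O.indicator w := fun {w μ} h => by
    rw [twistedOp_indicator _ _ _ _ _ _ _ (fun s => apply_mem_component_iff.1)
      fun s => apply_mem_component_iff.2, h]
    exact Set.indicator_const_smul O (μ : ℂ) w
  have hprop : O.indicator w = (-(c₂ / c₁)) • O.indicator (W ∘ π) := by
    ext s
    by_cases hs : s ∈ O
    · have := hdep s hs
      simp only [hs, Set.indicator_of_mem, Pi.smul_apply, smul_eq_mul]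
      field_simp
      linear_combination this
    · simp [hs]
  have hs₀' : s₀ ∈ O := fun g _ => rfl
  have h2 := congrFun (hu h) s₀
  have h3 := congrFun (hu hπW) s₀
  have h4 : twistedOp R U (Function.uncurry κx ∘ π)
      (Function.uncurry κy ∘ π) (fun _ => phase q.1 dx) (fun _ => phase q.2 dy) dx dy
        (O.indicator w) s₀ = (homRate κx κy dx dy q : ℂ) * O.indicator w s₀ := by
    rw [hprop, map_smul, Pi.smul_apply, h3]
    simp only [Pi.smul_apply, smul_eq_mul]
    ring
  rw [h4, Pi.smul_apply, smul_eq_mul, Set.indicator_of_mem hs₀'] at h2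
  exact hcon.1 (by exact_mod_cast (mul_right_cancel₀ hs₀ h2).symm)

end HomRate

/-! ### Interpolation of plane waves -/

section Interpolation

/-- The coefficient `∏_{l<k} (r² - l²) / (2k)!` of Lagrangian interpolation. -/
noncomputable def lagrangeCoeff (r : ℝ) (k : ℕ) : ℝ :=
  (∏ l ∈ Finset.range k, (r ^ 2 - (l : ℝ) ^ 2)) / ((2 * k).factorial : ℝ)

lemma lagrangeCoeff_zero (r : ℝ) : lagrangeCoeff r 0 = 1 := by simp [lagrangeCoeff]

lemma lagrangeCoeff_succ (r : ℝ) (k : ℕ) : lagrangeCoeff r (k + 1) * ((2 * k + 2) * (2 * k + 1))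
    = lagrangeCoeff r k * (r ^ 2 - k ^ 2) := by
  have h : ((2 * (k + 1)).factorial : ℝ) = (2 * k + 2) * ((2 * k + 1) * (2 * k).factorial) := by
    rw [show 2 * (k + 1) = 2 * k + 1 + 1 by ring, Nat.factorial_succ, Nat.factorial_succ]
    push_cast; ring
  have h0 : ((2 * k).factorial : ℝ) ≠ 0 := by positivity
  rw [lagrangeCoeff, lagrangeCoeff, Finset.prod_range_succ, h]
  field_simp

/-- The factor `r²` makes the interpolation errors uniform in the size ratio `r`. -/
lemma exists_lagrangeCoeff_le (k : ℕ) :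
    ∃ B, 0 ≤ B ∧ ∀ r : ℝ, 0 < r → r ≤ 1 → |lagrangeCoeff r (k + 1)| ≤ B * r ^ 2 := by
  induction k with
  | zero =>
    refine ⟨1, zero_le_one, fun r hr _ => ?_⟩
    have h := lagrangeCoeff_succ r 0
    rw [lagrangeCoeff_zero] at h
    norm_num at h
    rw [zero_add, abs_le]
    constructor <;> nlinarith
  | succ k ih =>
    obtain ⟨B, hB, h⟩ := ih
    refine ⟨B * (1 + (k + 1) ^ 2), by positivity, fun r hr hr1 => ?_⟩
    have h1 := lagrangeCoeff_succ r (k + 1)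
    have h2 := h r hr hr1
    have h3 : |r ^ 2 - ((k + 1 : ℕ) : ℝ) ^ 2| ≤ 1 + (k + 1) ^ 2 := by
      push_cast
      rw [abs_le]
      constructor <;> nlinarith
    have h4 : (1 : ℝ) ≤ (2 * ((k + 1 : ℕ) : ℝ) + 2) * (2 * ((k + 1 : ℕ) : ℝ) + 1) := by
      push_cast; nlinarith [(Nat.cast_nonneg k : (0 : ℝ) ≤ k)]
    calc |lagrangeCoeff r (k + 1 + 1)|
        ≤ |lagrangeCoeff r (k + 1 + 1)|
            * |(2 * ((k + 1 : ℕ) : ℝ) + 2) * (2 * ((k + 1 : ℕ) : ℝ) + 1)| := by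
          rw [abs_of_nonneg (zero_le_one.trans h4)]
          exact le_mul_of_one_le_right (abs_nonneg _) h4
      _ = |lagrangeCoeff r (k + 1)| * |r ^ 2 - ((k + 1 : ℕ) : ℝ) ^ 2| := by
          rw [← abs_mul, h1, abs_mul]
      _ ≤ B * r ^ 2 * (1 + (k + 1) ^ 2) := by gcongr
      _ = _ := by ring

/-- The factor `∑_{k ≤ P} c_k x^k`, `x = 2 cos θ - 2`, by which the even part of Lagrangian
interpolation multiplies the plane wave of phase difference `θ`; an approximation to `cos (r θ)`. -/
noncomputable def lagrangeEven (P : ℕ) (r θ : ℝ) : ℝ :=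
  ∑ k ∈ Finset.range (P + 1), lagrangeCoeff r k * (2 * Real.cos θ - 2) ^ k

/-- The derivative of `lagrangeEven` in `θ`; divided by `-r` it is the factor for the odd part. -/
noncomputable def lagrangeEvenDeriv (P : ℕ) (r θ : ℝ) : ℝ :=
  ∑ k ∈ Finset.range (P + 1),
    lagrangeCoeff r k * (k * (2 * Real.cos θ - 2) ^ (k - 1) * (-(2 * Real.sin θ)))

/-- The residual of `lagrangeEven` in the differential equation of `cos (r θ)`. -/
noncomputable def lagrangeResidual (P : ℕ) (r θ : ℝ) : ℝ :=
  lagrangeCoeff r P * (r ^ 2 - P ^ 2) * (2 * Real.cos θ - 2) ^ P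

lemma hasDerivAt_two_cos (θ : ℝ) :
    HasDerivAt (fun θ => 2 * Real.cos θ - 2) (-(2 * Real.sin θ)) θ := by
  refine (((Real.hasDerivAt_cos θ).const_mul 2).sub_const 2).congr_deriv ?_
  ring

lemma hasDerivAt_lagrangeEven (P : ℕ) (r θ : ℝ) :
    HasDerivAt (lagrangeEven P r) (lagrangeEvenDeriv P r θ) θ :=
  HasDerivAt.fun_sum fun k _ => ((hasDerivAt_two_cos θ).fun_pow k).const_mul _

/-- `G = lagrangeEven` satisfies `G'' + r² G = lagrangeResidual`, as the sum telescopes. -/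
lemma hasDerivAt_lagrangeEvenDeriv (P : ℕ) (r θ : ℝ) :
    HasDerivAt (lagrangeEvenDeriv P r) (lagrangeResidual P r θ - r ^ 2 * lagrangeEven P r θ) θ := by
  induction P with
  | zero =>
    have h : lagrangeEvenDeriv 0 r = fun _ => 0 := by ext; simp [lagrangeEvenDeriv]
    rw [h]
    refine (hasDerivAt_const θ (0 : ℝ)).congr_deriv ?_
    simp [lagrangeResidual, lagrangeEven, lagrangeCoeff_zero]
  | succ P ih =>
    have h : lagrangeEvenDeriv (P + 1) r = fun θ => lagrangeEvenDeriv P r θ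
        + lagrangeCoeff r (P + 1)
          * ((P + 1) * ((2 * Real.cos θ - 2) ^ P * (-(2 * Real.sin θ)))) := by
      ext θ
      rw [lagrangeEvenDeriv, Finset.sum_range_succ, lagrangeEvenDeriv]
      push_cast
      ring
    rw [h]
    have h1 : HasDerivAt (fun θ => -(2 * Real.sin θ)) (-(2 * Real.cos θ)) θ :=
      ((Real.hasDerivAt_sin θ).const_mul 2).neg
    refine (ih.add
      (((((hasDerivAt_two_cos θ).fun_pow P).mul h1).const_mul _).const_mul _)).congr_deriv ?_
    have h2 := lagrangeCoeff_succ r P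
    have h3 : lagrangeEven (P + 1) r θ = lagrangeEven P r θ
        + lagrangeCoeff r (P + 1) * (2 * Real.cos θ - 2) ^ (P + 1) := Finset.sum_range_succ _ _
    have h4 : (P : ℝ) * (2 * Real.cos θ - 2) ^ (P - 1) * (2 * Real.cos θ - 2)
        = P * (2 * Real.cos θ - 2) ^ P := by
      cases P with
      | zero => simp
      | succ P => rw [Nat.add_sub_cancel, pow_succ]; ring
    have h5 := Real.sin_sq_add_cos_sq θ
    rw [h3, lagrangeResidual, lagrangeResidual, ← h2]
    push_cast
    rw [pow_succ]
    set x := (2 * Real.cos θ - 2) ^ P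
    set y := (P : ℝ) * (2 * Real.cos θ - 2) ^ (P - 1)
    linear_combination (4 * lagrangeCoeff r (P + 1) * (P + 1) * y) * h5
      - (lagrangeCoeff r (P + 1) * (P + 1) * (2 * Real.cos θ + 2)) * h4

lemma abs_two_cos_sub_le (θ : ℝ) : |2 * Real.cos θ - 2| ≤ θ ^ 2 ∧ |2 * Real.cos θ - 2| ≤ 4 := by
  have h1 := Real.one_sub_sq_div_two_le_cos (x := θ)
  have h2 := Real.cos_le_one θ
  have h3 := Real.neg_one_le_cos θ
  rw [abs_of_nonpos (by linarith)]
  constructor <;> linarith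

lemma exists_lagrangeResidual_le (P : ℕ) : ∃ B, 0 ≤ B ∧ ∀ r θ : ℝ, 0 < r → r ≤ 1 →
    |lagrangeResidual P r θ| ≤ B * r ^ 2 * |θ| ^ (2 * P) := by
  obtain ⟨B, hB, h⟩ := exists_lagrangeCoeff_le P
  refine ⟨B * ((2 * P + 2) * (2 * P + 1)), by positivity, fun r θ hr hr1 => ?_⟩
  rw [lagrangeResidual, ← lagrangeCoeff_succ, abs_mul, abs_mul,
    abs_of_nonneg (by positivity : (0 : ℝ) ≤ (2 * P + 2) * (2 * P + 1)), abs_pow]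
  have h1 := h r hr hr1
  have h2 : |2 * Real.cos θ - 2| ^ P ≤ |θ| ^ (2 * P) := by
    rw [pow_mul, sq_abs]
    exact pow_le_pow_left₀ (abs_nonneg _) (abs_two_cos_sub_le θ).1 P
  calc _ ≤ B * r ^ 2 * ((2 * P + 2) * (2 * P + 1)) * |θ| ^ (2 * P) := by gcongr
    _ = _ := by ring

lemma exists_lagrangeEvenDeriv_le (P : ℕ) : ∃ B, 0 ≤ B ∧ ∀ r θ : ℝ, 0 < r → r ≤ 1 →
    |lagrangeEvenDeriv P r θ| ≤ B * r ^ 2 * |θ| := by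
  induction P with
  | zero => exact ⟨0, le_rfl, fun r θ _ _ => by simp [lagrangeEvenDeriv]⟩
  | succ P ih =>
    obtain ⟨B, hB, h⟩ := ih
    obtain ⟨B', hB', h'⟩ := exists_lagrangeCoeff_le P
    refine ⟨B + B' * ((P + 1) * 4 ^ P * 2), by positivity, fun r θ hr hr1 => ?_⟩
    rw [lagrangeEvenDeriv, Finset.sum_range_succ]
    have h1 := h r θ hr hr1
    have h2 := h' r hr hr1
    have h3 : |2 * Real.cos θ - 2| ^ P ≤ 4 ^ P :=
      pow_le_pow_left₀ (abs_nonneg _) (abs_two_cos_sub_le θ).2 P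
    have h4 : |Real.sin θ| ≤ |θ| := Real.abs_sin_le_abs
    refine (abs_add_le _ _).trans ?_
    have h5 : |lagrangeCoeff r (P + 1) * (((P + 1 : ℕ) : ℝ) * (2 * Real.cos θ - 2) ^ (P + 1 - 1)
        * (-(2 * Real.sin θ)))| ≤ B' * r ^ 2 * ((P + 1) * 4 ^ P * (2 * |θ|)) := by
      rw [Nat.add_sub_cancel, abs_mul, abs_mul, abs_mul, abs_neg, abs_mul, abs_pow, Nat.abs_cast,
        abs_two]
      push_cast
      gcongr
    calc _ ≤ B * r ^ 2 * |θ| + B' * r ^ 2 * ((P + 1) * 4 ^ P * (2 * |θ|)) := add_le_add h1 h5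
      _ = _ := by ring

/-- The factor by which Lagrangian interpolation multiplies the plane wave of phase difference
`θ`; an approximation to `exp (i r θ)`. -/
noncomputable def lagrangeFactor (P : ℕ) (r θ : ℝ) : ℂ :=
  lagrangeEven P r θ - I / r * lagrangeEvenDeriv P r θ

lemma lagrangeFactor_neg (P : ℕ) (r θ : ℝ) :
    lagrangeFactor P (-r) θ = (starRingEnd ℂ) (lagrangeFactor P r θ) := by
  have h : ∀ k, lagrangeCoeff (-r) k = lagrangeCoeff r k := fun k => by simp [lagrangeCoeff]
  simp only [lagrangeFactor, lagrangeEven, lagrangeEvenDeriv, h, map_sub, map_mul, map_div₀,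
    conj_ofReal, conj_I]
  push_cast
  ring

lemma norm_sub_le_of_deriv_le {E : Type} [NormedAddCommGroup E] [NormedSpace ℝ E] {f f' : ℝ → E}
    (hf : ∀ x, HasDerivAt f (f' x) x) {B θ : ℝ} {n : ℕ} (hB : 0 ≤ B)
    (hle : ∀ x, ‖f' x‖ ≤ B * |x| ^ n) : ‖f θ - f 0‖ ≤ B * |θ| ^ (n + 1) := by
  have h := Convex.norm_image_sub_le_of_norm_hasDerivWithin_le (f := f) (f' := f')
    (s := Set.Icc (-|θ|) |θ|) (C := B * |θ| ^ n) (x := 0) (y := θ)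
    (fun x _ => (hf x).hasDerivWithinAt) (fun x hx => (hle x).trans ?_) (convex_Icc _ _)
    ⟨by simp, by simp⟩ ⟨neg_abs_le θ, le_abs_self θ⟩
  · rw [sub_zero, Real.norm_eq_abs] at h
    rwa [pow_succ, ← mul_assoc]
  · have := abs_le.2 hx
    gcongr

lemma lagrangeFactor_zero (P : ℕ) (r : ℝ) :
    lagrangeEven P r 0 = 1 ∧ lagrangeEvenDeriv P r 0 = 0 := by
  constructor
  · rw [lagrangeEven, Finset.sum_range_succ']
    simp [lagrangeCoeff_zero]
  · simp [lagrangeEvenDeriv]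

/-- The error of Lagrangian interpolation.  The factor `M` satisfies
`M' = i r M - (i / r) lagrangeResidual`. -/
lemma exists_lagrangeFactor_sub_exp_le (P : ℕ) : ∃ B, 0 ≤ B ∧ ∀ r θ : ℝ, 0 < r → r ≤ 1 →
    ‖lagrangeFactor P r θ * exp (-(I * r * θ)) - 1‖ ≤ B * r * |θ| ^ (2 * P + 1) := by
  obtain ⟨B, hB, h⟩ := exists_lagrangeResidual_le P
  refine ⟨B, hB, fun r θ hr hr1 => ?_⟩
  have hr0 : (r : ℂ) ≠ 0 := by exact_mod_cast hr.ne'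
  have hd : ∀ x : ℝ, HasDerivAt (fun x : ℝ => lagrangeFactor P r x * exp (-(I * r * x)))
      (-(I / r * lagrangeResidual P r x) * exp (-(I * r * x))) x := fun x => by
    have h1 : HasDerivAt (fun x : ℝ => lagrangeFactor P r x)
        (lagrangeEvenDeriv P r x
          - I / r * ((lagrangeResidual P r x - r ^ 2 * lagrangeEven P r x : ℝ) : ℂ)) x :=
      (hasDerivAt_lagrangeEven P r x).ofReal_comp.sub
        ((hasDerivAt_lagrangeEvenDeriv P r x).ofReal_comp.const_mul _)
    have h2 : HasDerivAt (fun x : ℝ => -(I * r * (x : ℂ))) (-(I * r)) x := by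
      simpa using ((hasDerivAt_id x).ofReal_comp.const_mul (I * r)).fun_neg
    refine (h1.mul h2.cexp).congr_deriv ?_
    rw [lagrangeFactor]
    push_cast
    field_simp
    linear_combination ((lagrangeEvenDeriv P r x : ℂ) * r) * I_sq
  have h0 : lagrangeFactor P r 0 * exp (-(I * r * (0 : ℝ))) = 1 := by
    simp [lagrangeFactor, lagrangeFactor_zero]
  have h1 := norm_sub_le_of_deriv_le hd (B := B * r) (n := 2 * P) (θ := θ) (by positivity)
    fun x => by
      have h2 : exp (-(I * r * x)) = exp (((-(r * x) : ℝ) : ℂ) * I) := by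
        congr 1; push_cast; ring
      rw [norm_mul, h2, norm_exp_ofReal_mul_I, mul_one, norm_neg, norm_mul, norm_div, norm_I,
        norm_real, norm_real, Real.norm_eq_abs, Real.norm_eq_abs, abs_of_pos hr]
      have h3 := h r x hr hr1
      rw [div_mul_eq_mul_div, one_mul, div_le_iff₀ hr]
      calc _ ≤ _ := h3
        _ = _ := by ring
  rw [h0] at h1
  exact h1

/-- The modulus of the factor is much closer to one than the factor is to `exp (i r θ)`. -/
lemma exists_lagrangeFactor_norm_le (P : ℕ) : ∃ B, 0 ≤ B ∧ ∀ r θ : ℝ, 0 < r → r ≤ 1 →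
    |‖lagrangeFactor P r θ‖ - 1| ≤ B * r ^ 2 * |θ| ^ (2 * P + 2) := by
  obtain ⟨B, hB, h⟩ := exists_lagrangeResidual_le P
  obtain ⟨B', hB', h'⟩ := exists_lagrangeEvenDeriv_le P
  refine ⟨2 * B * B', by positivity, fun r θ hr hr1 => ?_⟩
  have hnorm : ‖lagrangeFactor P r θ‖ ^ 2
      = lagrangeEven P r θ ^ 2 + lagrangeEvenDeriv P r θ ^ 2 / r ^ 2 := by
    have : lagrangeFactor P r θ
        = ((lagrangeEven P r θ : ℝ) : ℂ) + ((-(lagrangeEvenDeriv P r θ / r) : ℝ) : ℂ) * I := by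
      rw [lagrangeFactor]; push_cast; ring
    rw [this, Complex.sq_norm, normSq_add_mul_I]; ring
  have hd : ∀ x, HasDerivAt (fun x => lagrangeEven P r x ^ 2 + lagrangeEvenDeriv P r x ^ 2 / r ^ 2)
      (2 * lagrangeEvenDeriv P r x * lagrangeResidual P r x / r ^ 2) x := fun x => by
    refine (((hasDerivAt_lagrangeEven P r x).fun_pow 2).add
      (((hasDerivAt_lagrangeEvenDeriv P r x).fun_pow 2).div_const _)).congr_deriv ?_
    field_simp
    ring
  have h1 := norm_sub_le_of_deriv_le hd (B := 2 * B * B' * r ^ 2) (n := 2 * P + 1) (θ := θ)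
    (by positivity) fun x => by
      rw [Real.norm_eq_abs, abs_div, abs_mul, abs_mul, abs_two,
        abs_of_pos (by positivity : 0 < r ^ 2), div_le_iff₀ (by positivity)]
      have h2 := h r x hr hr1
      have h3 := h' r x hr hr1
      calc _ ≤ 2 * (B' * r ^ 2 * |x|) * (B * r ^ 2 * |x| ^ (2 * P)) := by gcongr
        _ = _ := by ring
  rw [← hnorm, (lagrangeFactor_zero P r).1, (lagrangeFactor_zero P r).2, Real.norm_eq_abs] at h1
  refine le_trans ?_ (h1.trans (le_of_eq (by ring)))
  have h2 : ‖lagrangeFactor P r θ‖ ^ 2 - (1 ^ 2 + 0 ^ 2 / r ^ 2)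
      = (‖lagrangeFactor P r θ‖ - 1) * (‖lagrangeFactor P r θ‖ + 1) := by ring
  rw [h2, abs_mul]
  refine le_mul_of_one_le_right (abs_nonneg _) ?_
  rw [abs_of_nonneg (by positivity)]
  linarith [norm_nonneg (lagrangeFactor P r θ)]

lemma lagrangeShift_wave (P : ℕ) {N : ℕ} (r : ℝ) {θ : ℝ} {f : ZMod N → ℂ}
    (hf : ∀ A, f (A + 1) = exp (I * θ) * f A) (A : ZMod N) :
    lagrangeShift P r f A = lagrangeFactor P r θ * f A := by
  have hf' : ∀ A, f (A - 1) = exp (-(I * θ)) * f A := fun A => by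
    have := hf (A - 1)
    rw [sub_add_cancel] at this
    rw [this, ← mul_assoc, ← exp_add, neg_add_cancel, exp_zero, one_mul]
  have hcos : exp (I * θ) + exp (-(I * θ)) = 2 * (Real.cos θ : ℂ) := by
    rw [ofReal_cos, Complex.cos, mul_comm I, neg_mul]; ring
  have hsin : exp (I * θ) - exp (-(I * θ)) = 2 * (Real.sin θ : ℂ) * I := by
    rw [ofReal_sin, Complex.sin, mul_comm I, neg_mul]
    linear_combination (exp (θ * I) - exp (-(θ * I))) * I_sq
  have hpow : ∀ k, macroDelta2^[k] f = fun A => (2 * (Real.cos θ : ℂ) - 2) ^ k * f A := fun k => by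
    induction k with
    | zero => simp
    | succ k ih =>
      rw [Function.iterate_succ_apply', ih]
      ext A
      simp only [macroDelta2, hf, hf']
      rw [pow_succ]
      linear_combination ((2 * (Real.cos θ : ℂ) - 2) ^ k * f A) * hcos
  have hmu : ∀ k, macroMuDelta (macroDelta2^[k] f) A
      = I * Real.sin θ * (2 * (Real.cos θ : ℂ) - 2) ^ k * f A := fun k => by
    rw [hpow, macroMuDelta, hf, hf']
    linear_combination ((2 * (Real.cos θ : ℂ) - 2) ^ k * f A / 2) * hsin
  have hrange : Finset.range (P + 1) = insert 0 (Finset.Icc 1 P) := by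
    ext k; simp only [Finset.mem_range, Finset.mem_insert, Finset.mem_Icc]; omega
  rw [lagrangeShift, lagrangeFactor, lagrangeEven, lagrangeEvenDeriv, hrange,
    Finset.sum_insert (by simp), Finset.sum_insert (by simp), lagrangeCoeff_zero]
  push_cast
  simp only [pow_zero, mul_one, zero_mul, mul_zero, zero_add]
  rw [Finset.mul_sum, sub_mul, add_mul, one_mul, add_sub_assoc, Finset.sum_mul, Finset.sum_mul,
    ← Finset.sum_sub_distrib]
  congr 1
  refine Finset.sum_congr rfl fun k _ => ?_
  rw [hmu, hpow, lagrangeCoeff]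
  push_cast
  ring

/-- Below the highest frequency, which is split in two, a plane wave is a single Fourier mode. -/
lemma spectralShift_wave {N : ℕ} [NeZero N] (r : ℝ) {a : ℤ} (ha : 2 * |a| < N) {f : ZMod N → ℂ}
    (hf : ∀ A, f (A + 1) = exp (2 * Real.pi * I * a / N) * f A) (A : ZMod N) :
    spectralShift r f A = exp (2 * Real.pi * I * a * r / N) * f A := by
  have hN : (N : ℂ) ≠ 0 := by exact_mod_cast NeZero.ne N
  have hfn : ∀ n : ℕ, f (n : ZMod N) = exp (2 * Real.pi * I * a * n / N) * f 0 := fun n => by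
    induction n with
    | zero => simp
    | succ n ih =>
      rw [Nat.cast_succ, hf, ih, ← mul_assoc, ← exp_add]
      congr 2; push_cast; ring
  have hfv : ∀ B : ZMod N, f B = exp (2 * Real.pi * I * a * B.val / N) * f 0 := fun B => by
    have := hfn B.val
    rwa [ZMod.natCast_zmod_val] at this
  have hcoef : ∀ m : ℤ, fourierCoeffPatch f m = if ((a - m : ℤ) : ZMod N) = 0 then f 0 else 0 := by
    intro m
    have h1 : ∀ B : ZMod N, f B * exp (-(2 * Real.pi * I * m * (B.val : ℂ) / N))
        = ZMod.stdAddChar (B * ((a - m : ℤ) : ZMod N)) * f 0 := fun B => by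
      have h2 : B * ((a - m : ℤ) : ZMod N) = ((B.val * (a - m) : ℤ) : ZMod N) := by
        push_cast; rw [ZMod.natCast_zmod_val]
      rw [h2, ZMod.stdAddChar_coe, hfv B, mul_right_comm, ← exp_add]
      congr 2; push_cast; ring
    rw [fourierCoeffPatch, Finset.sum_congr rfl fun B _ => h1 B, ← Finset.sum_mul,
      AddChar.sum_mulShift _ (ZMod.isPrimitive_stdAddChar N), ZMod.card]
    split_ifs
    · field_simp
    · simp
  have hmem : a ∈ (Finset.Icc (-(N : ℤ)) N).filter (fun m => 2 * |m| ≤ (N : ℤ)) := by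
    rw [Finset.mem_filter, Finset.mem_Icc]
    have := abs_le.1 (le_refl |a|)
    have := abs_nonneg a
    omega
  rw [spectralShift, Finset.sum_eq_single_of_mem a hmem]
  · rw [if_neg ha.ne, hcoef, if_pos (by simp), hfv A, one_mul, mul_comm (f 0), ← mul_assoc,
      ← exp_add]
    congr 2; ring
  · intro m hm hma
    have h0 : fourierCoeffPatch f m = 0 := by
      rw [hcoef, if_neg]
      intro h
      rw [ZMod.intCast_zmod_eq_zero_iff_dvd] at h
      rw [Finset.mem_filter] at hm
      have h2 := Int.eq_zero_of_abs_lt_dvd h (by have := abs_sub a m; omega)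
      omega
    rw [h0, mul_zero, zero_mul]

end Interpolation

/-! ### The coupling of patches as a phase factor -/

section Coupling

lemma abs_arg_le {z : ℂ} (hz : ‖z - 1‖ ≤ 1 / 2) : |arg z| ≤ Real.pi * ‖z - 1‖ := by
  have hre : 1 / 2 ≤ z.re := by
    have := (abs_le.1 ((abs_re_le_norm (z - 1)).trans hz)).1
    rw [sub_re, one_re] at this
    linarith
  have hnorm : 1 / 2 ≤ ‖z‖ := hre.trans (re_le_norm z)
  have h1 : |arg z| ≤ Real.pi / 2 := abs_arg_le_pi_div_two_iff.2 (by linarith)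
  have h2 := Real.mul_abs_le_abs_sin h1
  have h3 : |Real.sin (arg z)| ≤ 2 * ‖z - 1‖ := by
    rw [sin_arg, abs_div, abs_of_nonneg (norm_nonneg z), div_le_iff₀ (by linarith)]
    have := abs_im_le_norm (z - 1)
    rw [sub_im, one_im, sub_zero] at this
    nlinarith [norm_nonneg (z - 1)]
  have h4 : |arg z| = Real.pi / 2 * (2 / Real.pi * |arg z|) := by
    field_simp
  rw [h4]
  calc _ ≤ Real.pi / 2 * (2 * ‖z - 1‖) :=
        mul_le_mul_of_nonneg_left (h2.trans h3) (by positivity)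
    _ = _ := by ring

lemma phase_add (q d d' : ℝ) : phase q (d + d') = phase q d * phase q d' := by
  rw [phase, phase, phase, ← exp_add]; congr 1; push_cast; ring

lemma phase_zero (q : ℝ) : phase q 0 = 1 := by simp [phase]

/-- On the plane wave of wavenumber `2 π a / L`, the couplings `E^{±r}` are multiplication by
`ρ exp (± i q' r H)` with `ρ` close to one and `q'` close to `2 π a / L`. -/
lemma exists_coupling_factor (c : Coupling) {L : ℝ} (hL : 0 < L) (a : ℤ) :
    ∃ C : ℝ, 0 ≤ C ∧ ∃ N₀ : ℕ, ∀ (N : ℕ) [NeZero N], N₀ ≤ N → ∀ r : ℝ, 0 < r → r ≤ 1 →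
      ∀ H : ℝ, H = L / N → ∃ ρ q' : ℝ,
        (∀ f : ZMod N → ℂ, (∀ A, f (A + 1) = exp (2 * Real.pi * I * a / N) * f A) → ∀ A,
          c.shift r f A = ρ * phase q' (r * H) * f A ∧
          c.shift (-r) f A = (starRingEnd ℂ) (ρ * phase q' (r * H)) * f A) ∧
        |ρ - 1| ≤ C * (r * H) ^ 2 * c.error H ∧ |q' - 2 * Real.pi * a / L| ≤ C * c.error H := by
  cases c with
  | spectral =>
    refine ⟨0, le_rfl, 2 * a.natAbs + 1, fun N _ hN r _ _ H hH => ⟨1, 2 * Real.pi * a / L,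
      fun f hf A => ?_, by simp, by simp⟩⟩
    have ha : 2 * |a| < (N : ℤ) := by rw [Int.abs_eq_natAbs]; omega
    have hN0 : (N : ℂ) ≠ 0 := by exact_mod_cast NeZero.ne N
    have hL0 : (L : ℂ) ≠ 0 := by exact_mod_cast hL.ne'
    have h : ∀ r : ℝ, exp (2 * Real.pi * I * a * r / N) = phase (2 * Real.pi * a / L) (r * H) :=
      fun r => by
        rw [phase, hH]; congr 1; push_cast; field_simp
    refine ⟨?_, ?_⟩
    · rw [Coupling.shift, spectralShift_wave r ha hf, h, ofReal_one, one_mul]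
    · rw [Coupling.shift, spectralShift_wave (-r) ha hf, ofReal_one, one_mul, conj_phase, h]
      congr 1
      rw [phase, phase]; congr 2; push_cast; ring
  | lagrange P =>
    obtain ⟨B, hB, hexp⟩ := exists_lagrangeFactor_sub_exp_le P
    obtain ⟨B', hB', hnorm⟩ := exists_lagrangeFactor_norm_le P
    set q := 2 * Real.pi * a / L with hq
    obtain ⟨N₀, hN₀⟩ := exists_nat_ge (|q| * L + 2 * B * (|q| * L))
    refine ⟨B' * |q| ^ (2 * P + 2) + Real.pi * (B * |q| ^ (2 * P + 1)), by positivity, N₀ + 1,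
      fun N _ hN r hr hr1 H hH => ?_⟩
    have hNpos : (0 : ℝ) < N := by exact_mod_cast Nat.pos_of_neZero N
    have hHpos : 0 < H := by rw [hH]; positivity
    have hNN : |q| * L + 2 * B * (|q| * L) ≤ N :=
      hN₀.trans (by exact_mod_cast (Nat.le_succ _).trans hN)
    have hθ0 : 0 ≤ |q| * L := by positivity
    have hθabs : |q * H| = |q| * L / N := by rw [abs_mul, abs_of_pos hHpos, hH]; ring
    have hθ1 : |q * H| ≤ 1 := by
      rw [hθabs, div_le_one hNpos]; nlinarith [mul_nonneg hB hθ0]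
    have hθ2 : B * |q * H| ≤ 1 / 2 := by
      rw [hθabs, ← mul_div_assoc, div_le_iff₀ hNpos]; linarith
    set M := lagrangeFactor P r (q * H) with hM
    set z := M * exp (-(I * r * ((q * H : ℝ) : ℂ))) with hz
    have hz1 : ‖z - 1‖ ≤ B * r * |q * H| ^ (2 * P + 1) := hexp r (q * H) hr hr1
    have hz2 : ‖z - 1‖ ≤ 1 / 2 := by
      refine hz1.trans (le_trans ?_ hθ2)
      have h1 : |q * H| ^ (2 * P + 1) ≤ |q * H| :=
        pow_le_of_le_one (abs_nonneg _) hθ1 (by omega)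
      calc B * r * |q * H| ^ (2 * P + 1) ≤ B * 1 * |q * H| := by gcongr
        _ = _ := by ring
    have hunit : exp (-(I * r * ((q * H : ℝ) : ℂ))) = phase (-q) (r * H) := by
      rw [phase]; congr 1; push_cast; ring
    have hzM : ‖z‖ = ‖M‖ := by rw [hz, hunit, norm_mul, norm_phase, mul_one]
    have hrH : 0 < r * H := mul_pos hr hHpos
    have hMeq : M = (‖M‖ : ℂ) * phase (q + arg z / (r * H)) (r * H) := by
      have h1 : M = z * phase q (r * H) := by
        rw [hz, hunit, mul_assoc, phase, phase, ← exp_add]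
        rw [show I * ((-q * (r * H) : ℝ) : ℂ) + I * ((q * (r * H) : ℝ) : ℂ) = 0 by
          push_cast; ring, exp_zero, mul_one]
      have h2 := norm_mul_exp_arg_mul_I z
      have h3 : phase (q + arg z / (r * H)) (r * H) = exp (arg z * I) * phase q (r * H) := by
        rw [phase, phase, ← exp_add]
        congr 1
        have : (q + arg z / (r * H)) * (r * H) = q * (r * H) + arg z := by field_simp
        rw [this]; push_cast; ring
      rw [h3, ← mul_assoc, ← hzM, h2, ← h1]
    have hθ : ∀ f : ZMod N → ℂ, (∀ A, f (A + 1) = exp (2 * Real.pi * I * a / N) * f A) →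
        ∀ A, f (A + 1) = exp (I * ((q * H : ℝ) : ℂ)) * f A := fun f hf A => by
      rw [hf]
      congr 2
      have hN0 : (N : ℂ) ≠ 0 := by exact_mod_cast hNpos.ne'
      have hL0 : (L : ℂ) ≠ 0 := by exact_mod_cast hL.ne'
      rw [hq, hH]; push_cast; field_simp
    -- The phase error `arg z` acts over the width `r H`, and so as a change of the wavenumber.
    refine ⟨‖M‖, q + arg z / (r * H), fun f hf A => ⟨?_, ?_⟩, ?_, ?_⟩
    · rw [Coupling.shift, lagrangeShift_wave P r (hθ f hf), ← hMeq]
    · rw [Coupling.shift, lagrangeShift_wave P (-r) (hθ f hf), ← hMeq, lagrangeFactor_neg]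
    · refine (hnorm r (q * H) hr hr1).trans ?_
      rw [Coupling.error, abs_mul, abs_of_pos hHpos, mul_pow]
      have h1 : 0 ≤ Real.pi * (B * |q| ^ (2 * P + 1)) * ((r * H) ^ 2 * H ^ (2 * P)) := by
        positivity
      calc B' * r ^ 2 * (|q| ^ (2 * P + 2) * H ^ (2 * P + 2))
          = B' * |q| ^ (2 * P + 2) * ((r * H) ^ 2 * H ^ (2 * P)) := by ring
        _ ≤ _ := by linarith
    · rw [add_sub_cancel_left, abs_div, abs_of_pos hrH, div_le_iff₀ hrH]
      refine (abs_arg_le hz2).trans ((mul_le_mul_of_nonneg_left hz1 Real.pi_pos.le).trans ?_)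
      rw [Coupling.error, abs_mul, abs_of_pos hHpos, mul_pow]
      have h1 : 0 ≤ B' * |q| ^ (2 * P + 2) * (H ^ (2 * P) * (r * H)) := by positivity
      calc Real.pi * (B * r * (|q| ^ (2 * P + 1) * H ^ (2 * P + 1)))
          = Real.pi * (B * |q| ^ (2 * P + 1)) * (H ^ (2 * P) * (r * H)) := by ring
        _ ≤ _ := by linarith

lemma Coupling.error_nonneg (c : Coupling) {H : ℝ} (hH : 0 ≤ H) : 0 ≤ c.error H := by
  cases c
  · exact le_rfl
  · exact pow_nonneg hH _

lemma Coupling.error_mono (c : Coupling) {H L : ℝ} (hH : 0 ≤ H) (h : H ≤ L) :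
    c.error H ≤ c.error L := by
  cases c
  · exact le_rfl
  · exact pow_le_pow_left₀ hH h _

/-- The phase factor from an interior point to its right neighbour, when the rows of a patch are
closed up to cycles: it is one except at the last point, where it is the coupling factor `M`. -/
def edgeFactor {n : ℕ} (M : ℂ) (i : Fin n) : ℂ := if i.val + 1 < n then 1 else M

lemma norm_edgeFactor_sub_le (ρ : ℝ) {u : ℂ} (hu : ‖u‖ = 1) {n : ℕ} (i : Fin n) :
    ‖edgeFactor (ρ * u) i - edgeFactor u i‖ ≤ |ρ - 1| := by
  rw [edgeFactor, edgeFactor]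
  split_ifs
  · simp
  · have : (ρ : ℂ) * u - u = ((ρ - 1 : ℝ) : ℂ) * u := by push_cast; ring
    rw [this, norm_mul, hu, mul_one, norm_real, Real.norm_eq_abs]

/-- The energy of the constant field at one bond. -/
lemma two_sub_re_edgeFactor_le (ρ q d : ℝ) {n : ℕ} (i : Fin n) :
    2 - 2 * (edgeFactor (ρ * phase q d) i).re ≤ (q * d) ^ 2 + 2 * |ρ - 1| := by
  rw [edgeFactor]
  split_ifs
  · rw [one_re]; nlinarith [sq_nonneg (q * d), abs_nonneg (ρ - 1)]
  · have h1 : (phase q d).re = Real.cos (q * d) := by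
      rw [phase, mul_comm, exp_ofReal_mul_I_re]
    rw [re_ofReal_mul, h1]
    have h2 := Real.one_sub_sq_div_two_le_cos (x := q * d)
    have h3 : (1 - ρ) * Real.cos (q * d) ≤ |ρ - 1| := by
      refine (le_abs_self _).trans ?_
      rw [abs_mul, abs_sub_comm]
      exact mul_le_of_le_one_right (abs_nonneg _) (Real.abs_cos_le_one _)
    linarith

variable {n : ℕ} [NeZero n]

lemma val_add_one_of_lt {i : Fin n} (h : i.val + 1 < n) : (i + 1).val = i.val + 1 := by
  rw [Fin.val_add, Fin.val_one', Nat.add_mod_mod, Nat.mod_eq_of_lt h]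

lemma val_add_one_of_not_lt {i : Fin n} (h : ¬i.val + 1 < n) : (i + 1).val = 0 := by
  have h1 : i.val + 1 = n := by omega
  rw [Fin.val_add, Fin.val_one', Nat.add_mod_mod, h1, Nat.mod_self]

lemma coupledRow_right {c : Coupling} {N : ℕ} [NeZero N] {r : ℝ} {w : ZMod N → Fin n → ℂ}
    {A : ZMod N} {M : ℂ}
    (h : c.shift r (fun K => w K (firstPt n)) A = M * w A (firstPt n)) (i : Fin n) :
    coupledRow c r w A (i.val + 2) = edgeFactor M i * w A (i + 1) := by
  rw [coupledRow, withEdges, if_neg (by omega), edgeFactor]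
  by_cases hi : i.val + 1 < n
  · rw [dif_pos (by omega), if_pos hi, one_mul]
    congr 1
    exact Fin.ext (val_add_one_of_lt hi).symm
  · rw [dif_neg (by omega), if_neg hi, h]
    congr 2
    exact Fin.ext (val_add_one_of_not_lt hi).symm

lemma coupledRow_left {c : Coupling} {N : ℕ} [NeZero N] {r : ℝ} {w : ZMod N → Fin n → ℂ}
    {A : ZMod N} {M : ℂ}
    (h : c.shift (-r) (fun K => w K (lastPt n)) A = (starRingEnd ℂ) M * w A (lastPt n))
    (i : Fin n) :
    coupledRow c r w A i.val = (starRingEnd ℂ) (edgeFactor M (i - 1)) * w A (i - 1) := by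
  obtain ⟨j, rfl⟩ : ∃ j, i = j + 1 := ⟨i - 1, by simp⟩
  rw [add_sub_cancel_right, coupledRow, withEdges, edgeFactor]
  by_cases hj : j.val + 1 < n
  · have h1 := val_add_one_of_lt hj
    rw [h1, if_neg (by omega), dif_pos (by omega), if_pos hj, map_one, one_mul]
    rfl
  · rw [if_pos (val_add_one_of_not_lt hj), if_neg hj, h]
    congr 2
    exact Fin.ext (by simp only [lastPt]; omega)

/-- A coupling factor of modulus one can be spread evenly over the cycle. -/
lemma edgeFactor_gauge (q d : ℝ) (i : Fin n) :
    edgeFactor (phase q (n * d)) i * phase q ((i + 1).val * d)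
      = phase q d * phase q (i.val * d) := by
  rw [← phase_add, edgeFactor]
  by_cases hi : i.val + 1 < n
  · rw [if_pos hi, one_mul, val_add_one_of_lt hi]
    congr 1; push_cast; ring
  · rw [if_neg hi, val_add_one_of_not_lt hi, Nat.cast_zero, zero_mul, phase_zero, mul_one]
    have h1 : (n : ℝ) = i.val + 1 := by
      have : n = i.val + 1 := by omega
      exact_mod_cast this
    congr 1; rw [h1]; ring

end Coupling

/-! ### Consistency of patch schemes -/

section PatchConsistency

lemma HasMacroscaleRate.mono {Nx Ny : ℕ} {σ : Type} [Fintype σ]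
    {F : PatchField Nx Ny σ → PatchField Nx Ny σ} {a b : ℤ} {Λ ε ε' γ η : ℝ}
    (h : HasMacroscaleRate F a b Λ ε γ η) (hε : 0 ≤ ε) (hle : ε ≤ ε') :
    HasMacroscaleRate F a b Λ ε' γ η := by
  have hO : ∀ v, ObeysRate F Λ ε v → ObeysRate F Λ ε' v := fun v hv t A B =>
    (hv t A B).trans (mul_le_mul_of_nonneg_right (pow_le_pow_left₀ hε hle 2)
      (Finset.sum_nonneg fun _ _ => by positivity))
  refine ⟨fun v hv => ?_, ?_⟩
  · obtain ⟨slow, fast, h1, h2, h3, h4, h5⟩ := h.1 v hv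
    exact ⟨slow, fast, h1, h2, h3, hO _ h4, h5⟩
  · obtain ⟨slow, h1, h2, h3⟩ := h.2
    exact ⟨slow, h1, hO _ h2, h3⟩

lemma exists_bounds {px py : ℕ} [NeZero px] [NeZero py] {κx κy : ZMod px → ZMod py → ℝ}
    (hκx : ∀ k l, 0 < κx k l) (hκy : ∀ k l, 0 < κy k l) :
    ∃ κ₀ K : ℝ, 0 < κ₀ ∧ 0 ≤ K ∧ (∀ k l, κ₀ ≤ κx k l) ∧ (∀ k l, κ₀ ≤ κy k l) ∧
      (∀ k l, κx k l ≤ K) ∧ ∀ k l, κy k l ≤ K := by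
  obtain ⟨sx, hsx⟩ := Finite.exists_min (Function.uncurry κx)
  obtain ⟨sy, hsy⟩ := Finite.exists_min (Function.uncurry κy)
  obtain ⟨tx, htx⟩ := Finite.exists_max (Function.uncurry κx)
  obtain ⟨ty, hty⟩ := Finite.exists_max (Function.uncurry κy)
  exact ⟨min (κx sx.1 sx.2) (κy sy.1 sy.2), max (κx tx.1 tx.2) (κy ty.1 ty.2),
    lt_min (hκx _ _) (hκy _ _), le_max_of_le_left (hκx _ _).le,
    fun k l => (min_le_left _ _).trans (hsx (k, l)),
    fun k l => (min_le_right _ _).trans (hsy (k, l)),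
    fun k l => (htx (k, l)).trans (le_max_left _ _),
    fun k l => (hty (k, l)).trans (le_max_right _ _)⟩

lemma eventually_mul_sq_lt (A : ℝ) {B : ℝ} (hB : 0 < B) : ∀ᶠ d in 𝓝 (0 : ℝ), A * d ^ 2 < B := by
  have h : Tendsto (fun d : ℝ => A * d ^ 2) (𝓝 0) (𝓝 (A * 0 ^ 2)) :=
    (Continuous.tendsto (by fun_prop) 0)
  exact h.eventually_lt_const (by simpa using hB)

/-- The spectrum of a patch scheme on waves, whose coupling factors `ρ exp (i q (n d))` have
modulus close to one: compare with the scheme with `ρ = 1`, spread the coupling factors evenly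
over the patch by a gauge transformation, and apply `rate_eq_homRate_or_le`. -/
lemma rate_near_homRate_or_le {px py : ℕ} [NeZero px] [NeZero py]
    {κx κy : ZMod px → ZMod py → ℝ} {κ₀ K : ℝ} (hκ₀ : 0 < κ₀) (hK : 0 ≤ K)
    (hx₀ : ∀ k l, κ₀ ≤ κx k l) (hy₀ : ∀ k l, κ₀ ≤ κy k l) (hxK : ∀ k l, κx k l ≤ K)
    (hyK : ∀ k l, κy k l ≤ K)
    {nx ny : ℕ} [NeZero nx] [NeZero ny] {σ : Type} [Fintype σ]
    {R U : Equiv.Perm σ} {π : σ → ZMod px × ZMod py}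
    (hR : ∀ s, π (R s) = shiftX px py (π s)) (hU : ∀ s, π (U s) = shiftY px py (π s))
    {ix : σ → Fin nx} {iy : σ → Fin ny} (hxR : ∀ s, ix (R s) = ix s + 1)
    (hxU : ∀ s, ix (U s) = ix s) (hyR : ∀ s, iy (R s) = iy s) (hyU : ∀ s, iy (U s) = iy s + 1)
    {c : ℝ} (hpoinc : ∀ f : σ → ℂ, (∀ g, IsInvariantField R U g → star g ⬝ᵥ f = 0) →
      c * l2sq f ≤ ∑ s, ‖f (R s) - f s‖ ^ 2 + ∑ s, ‖f (U s) - f s‖ ^ 2)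
    {dx dy d : ℝ} (hdx : 0 < dx) (hdy : 0 < dy) (hxd : dx ≤ d) (hyd : dy ≤ d) {q : ℝ × ℝ}
    (hζ : ‖phase q.1 dx - 1‖ ^ 2 + ‖phase q.2 dy - 1‖ ^ 2 ≤ c / 4)
    (hΛ : -(κ₀ * c / 4 / d ^ 2) < homRate κx κy dx dy q) {ρx ρy ε : ℝ}
    (hε : 4 * K * (|ρx - 1| / dx ^ 2 + |ρy - 1| / dy ^ 2) ≤ ε) {v : σ → ℂ} (hv : v ≠ 0) {ν : ℝ}
    (hTv : twistedOp R U (Function.uncurry κx ∘ π) (Function.uncurry κy ∘ π)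
      (edgeFactor (ρx * phase q.1 (nx * dx)) ∘ ix) (edgeFactor (ρy * phase q.2 (ny * dy)) ∘ iy)
      dx dy v = (ν : ℂ) • v) :
    |ν - homRate κx κy dx dy q| ≤ ε ∨ ν ≤ -(κ₀ * c / 4 / d ^ 2) + ε := by
  set ax := Function.uncurry κx ∘ π with hax
  set ay := Function.uncurry κy ∘ π with hay
  set ux := phase q.1 (nx * dx) with hux
  set uy := phase q.2 (ny * dy) with huy
  have hε0 : 0 ≤ ε := le_trans (by positivity) hε
  set T' := twistedOp R U ax ay (edgeFactor ux ∘ ix) (edgeFactor uy ∘ iy) dx dy with hT'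
  have hpert : l2sq (T' v - (ν : ℂ) • v) ≤ ε ^ 2 * l2sq v := by
    have h2 : l2sq (T' v - (ν : ℂ) • v) = l2sq ((ν : ℂ) • v - T' v) := by
      simp only [l2sq, Pi.sub_apply, norm_sub_rev]
    rw [h2, ← hTv]
    refine (l2sq_twistedOp_sub_le R U (fun s => hκ₀.le.trans (hx₀ _ _)) (fun s => hxK _ _)
      (fun s => hκ₀.le.trans (hy₀ _ _)) (fun s => hyK _ _) (abs_nonneg (ρx - 1))
      (abs_nonneg (ρy - 1)) (fun s => norm_edgeFactor_sub_le ρx (norm_phase _ _) (ix s))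
      (fun s => norm_edgeFactor_sub_le ρy (norm_phase _ _) (iy s)) dx dy v).trans ?_
    exact mul_le_mul_of_nonneg_right (pow_le_pow_left₀ (by positivity) hε 2) (l2sq_nonneg v)
  obtain ⟨ν', v', hv', hTv', hνν'⟩ :=
    exists_eigenvalue_near (isHermitianOp_twistedOp _ _ _ _ _ _ _ _) hv hε0 hpert
  set g : σ → ℂ := fun s => phase q.1 ((ix s).val * dx) * phase q.2 ((iy s).val * dy) with hg
  have hgn : ∀ s, ‖g s‖ = 1 := fun s => by rw [hg, norm_mul, norm_phase, norm_phase, one_mul]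
  have hg0 : ∀ s, g s ≠ 0 := fun s => norm_pos_iff.1 (by rw [hgn]; exact one_pos)
  have hgR : ∀ s, (edgeFactor ux ∘ ix) s * g (R s) = phase q.1 dx * g s := fun s => by
    simp only [hg, Function.comp_apply, hxR, hyR]
    rw [← mul_assoc, hux, edgeFactor_gauge, mul_assoc]
  have hgU : ∀ s, (edgeFactor uy ∘ iy) s * g (U s) = phase q.2 dy * g s := fun s => by
    simp only [hg, Function.comp_apply, hxU, hyU]
    rw [mul_left_comm, huy, edgeFactor_gauge, mul_left_comm]
  obtain ⟨w, rfl⟩ : ∃ w, v' = g * w := ⟨g⁻¹ * v', by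
    ext s; simp only [Pi.mul_apply, Pi.inv_apply]; rw [mul_inv_cancel_left₀ (hg0 s)]⟩
  have hw : w ≠ 0 := by rintro rfl; exact hv' (mul_zero g)
  rw [twistedOp_gauge ax ay hgn hgR hgU] at hTv'
  have hmode : twistedOp R U ax ay (fun _ => phase q.1 dx) (fun _ => phase q.2 dy) dx dy w
      = (ν' : ℂ) • w := by
    ext s
    have h1 := congrFun hTv' s
    simp only [Pi.mul_apply, Pi.smul_apply, smul_eq_mul] at h1 ⊢
    apply mul_left_cancel₀ (hg0 s)
    rw [h1]; ring
  rcases rate_eq_homRate_or_le hR hU hpoinc hκ₀ hx₀ hy₀ hdx hdy hxd hyd hζ hΛ hw hmode with h3 | h3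
  · left; rwa [← h3]
  · right
    have h4 := (abs_le.1 hνν').2
    linarith

/-- The energy of the constant field stays bounded as the spacings tend to zero, provided that the
coupling factors differ from one by terms of second order in modulus and first order in phase. -/
lemma constant_energy_le {σ : Type} [Fintype σ] (R U : Equiv.Perm σ) {a b : σ → ℝ} {K : ℝ}
    (ha : ∀ s, 0 ≤ a s) (ha' : ∀ s, a s ≤ K) (hb : ∀ s, 0 ≤ b s)
    (hb' : ∀ s, b s ≤ K) {nx ny : ℕ} (ix : σ → Fin nx) (iy : σ → Fin ny) {ρx ρy wx wy qx qy : ℝ}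
    {dx dy Bx By : ℝ} (hdx : 0 < dx) (hdy : 0 < dy) (hBx : 0 ≤ Bx) (hBy : 0 ≤ By)
    (hx : (qx * wx) ^ 2 + 2 * |ρx - 1| ≤ dx ^ 2 * Bx)
    (hy : (qy * wy) ^ 2 + 2 * |ρy - 1| ≤ dy ^ 2 * By) :
    -(star (1 : σ → ℂ) ⬝ᵥ twistedOp R U a b (edgeFactor (ρx * phase qx wx) ∘ ix)
        (edgeFactor (ρy * phase qy wy) ∘ iy) dx dy 1).re
      ≤ Fintype.card σ * (K * Bx) + Fintype.card σ * (K * By) := by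
  have hdir : ∀ {a f : σ → ℝ} {d B : ℝ}, 0 < d → (∀ s, 0 ≤ a s) → (∀ s, a s ≤ K) → 0 ≤ B →
      (∀ s, f s ≤ d ^ 2 * B) → (d ^ 2)⁻¹ * ∑ s, a s * f s ≤ Fintype.card σ * (K * B) := by
    intro a f d B hd ha ha' hB hf
    rw [inv_mul_le_iff₀ (by positivity)]
    calc ∑ s, a s * f s ≤ ∑ _s : σ, K * (d ^ 2 * B) := Finset.sum_le_sum fun s _ =>
          (mul_le_mul_of_nonneg_left (hf s) (ha s)).trans
            (mul_le_mul_of_nonneg_right (ha' s) (by positivity))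
      _ = _ := by rw [Finset.sum_const, Finset.card_univ, nsmul_eq_mul]; ring
  simp only [twistedOp, LinearMap.add_apply, LinearMap.smul_apply, dotProduct_add,
    dotProduct_smul, smul_eq_mul, add_re, re_ofReal_mul]
  rw [energy_dirOp_one, energy_dirOp_one, mul_neg, mul_neg, neg_add, neg_neg, neg_neg]
  exact add_le_add
    (hdir hdx ha ha' hBx fun s => (two_sub_re_edgeFactor_le ρx qx wx (ix s)).trans hx)
    (hdir hdy hb hb' hBy fun s => (two_sub_re_edgeFactor_le ρy qy wy (iy s)).trans hy)

lemma mul_le_add_mul_add {p q x y : ℝ} (hq : 0 ≤ q) (hp : 0 ≤ p) (hx : 0 ≤ x) (hy : 0 ≤ y) :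
    p * x ≤ (p + q) * (x + y) :=
  mul_le_mul (le_add_of_nonneg_right hq) (le_add_of_nonneg_right hy) hx (add_nonneg hp hq)

set_option maxHeartbeats 1000000 in
/-- A patch scheme that acts on waves as a twisted diffusion on a lattice `σ`, which maps to one
period of the diffusivities, is consistent with the homogenisation. -/
theorem isConsistent_of_twistedOp {px py : ℕ} [NeZero px] [NeZero py]
    {κx κy : ZMod px → ZMod py → ℝ} (hκx : ∀ k l, 0 < κx k l) (hκy : ∀ k l, 0 < κy k l)
    {nx ny : ℕ} [NeZero nx] [NeZero ny] {cx cy : Coupling} {σ : Type} [Fintype σ] [Nonempty σ]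
    {scheme : PatchScheme σ} {R U : Equiv.Perm σ} {π : σ → ZMod px × ZMod py}
    (hR : ∀ s, π (R s) = shiftX px py (π s)) (hU : ∀ s, π (U s) = shiftY px py (π s))
    {ix : σ → Fin nx} {iy : σ → Fin ny} (hxR : ∀ s, ix (R s) = ix s + 1)
    (hxU : ∀ s, ix (U s) = ix s) (hyR : ∀ s, iy (R s) = iy s) (hyU : ∀ s, iy (U s) = iy s + 1)
    (hscheme : ∀ (Nx Ny : ℕ) [NeZero Nx] [NeZero Ny] (rx ry dx dy : ℝ) (a b : ℤ) (Mx My : ℂ)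
      (V : PatchField Nx Ny σ), IsWave a b V →
      (∀ f : ZMod Nx → ℂ, (∀ A, f (A + 1) = exp (2 * Real.pi * I * a / Nx) * f A) → ∀ A,
        cx.shift rx f A = Mx * f A ∧ cx.shift (-rx) f A = (starRingEnd ℂ) Mx * f A) →
      (∀ f : ZMod Ny → ℂ, (∀ A, f (A + 1) = exp (2 * Real.pi * I * b / Ny) * f A) → ∀ A,
        cy.shift ry f A = My * f A ∧ cy.shift (-ry) f A = (starRingEnd ℂ) My * f A) →
      ∀ A B, scheme Nx Ny rx ry dx dy V A B
        = twistedOp R U (Function.uncurry κx ∘ π) (Function.uncurry κy ∘ π)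
          (edgeFactor Mx ∘ ix) (edgeFactor My ∘ iy) dx dy (V A B)) :
    IsConsistent κx κy nx ny cx cy scheme := by
  obtain ⟨κ₀, K, hκ₀, hK, hx₀, hy₀, hxK, hyK⟩ := exists_bounds hκx hκy
  obtain ⟨c, hc, hpoinc⟩ := exists_poincare R U
  -- Half of the gap of the unperturbed operator; the other half absorbs the perturbation.
  obtain ⟨β, hβ⟩ : ∃ x, x = κ₀ * c / 8 := ⟨_, rfl⟩
  have hβpos : 0 < β := by rw [hβ]; positivity
  refine ⟨β, hβpos, fun Lx Ly hLx hLy a b => ?_⟩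
  obtain ⟨Cx, hCx, Nx₀, hx⟩ := exists_coupling_factor cx hLx a
  obtain ⟨Cy, hCy, Ny₀, hy⟩ := exists_coupling_factor cy hLy b
  generalize 2 * Real.pi * a / Lx = qa at hx ⊢
  generalize 2 * Real.pi * b / Ly = qb at hy ⊢
  -- Bounds, uniform in `Nx`, `Ny`, `rx`, `ry`: the coupling error is at most `E`, the effective
  -- wavenumbers at most `Qx` and `Qy`; the moduli of the coupling factors change the rates by at
  -- most `C₁ ε`, the effective wavenumbers change `homRate` by at most `C₂ ε`; `Bx` and `By` bound
  -- the energy density of the constant field, and `G d²` the square of its fast part.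
  obtain ⟨E, hE⟩ : ∃ x, x = cx.error Lx + cy.error Ly := ⟨_, rfl⟩
  have hEx := cx.error_nonneg hLx.le
  have hEy := cy.error_nonneg hLy.le
  have hE0 : 0 ≤ E := by rw [hE]; exact add_nonneg hEx hEy
  obtain ⟨Qx, hQx⟩ : ∃ x, x = |qa| + Cx * E := ⟨_, rfl⟩
  obtain ⟨Qy, hQy⟩ : ∃ x, x = |qb| + Cy * E := ⟨_, rfl⟩
  obtain ⟨Q, hQ⟩ : ∃ x, x = Qx ^ 2 + Qy ^ 2 := ⟨_, rfl⟩
  obtain ⟨C₁, hC₁⟩ : ∃ x, x = 4 * K * (Cx * nx ^ 2 + Cy * ny ^ 2) := ⟨_, rfl⟩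
  have hQ0 : 0 ≤ Q := by rw [hQ]; positivity
  obtain ⟨C₂, hC₂⟩ : ∃ x, x = (Cx + Cy) * (K * Q + 2 * K * (1 + (Cx + Cy) * E)) := ⟨_, rfl⟩
  have hC₁0 : 0 ≤ C₁ := by rw [hC₁]; positivity
  have hC₂0 : 0 ≤ C₂ := by rw [hC₂]; positivity
  obtain ⟨Bx, hBx⟩ : ∃ x, x = nx ^ 2 * (Qx ^ 2 + 2 * (Cx * E)) := ⟨_, rfl⟩
  obtain ⟨By, hBy⟩ : ∃ x, x = ny ^ 2 * (Qy ^ 2 + 2 * (Cy * E)) := ⟨_, rfl⟩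
  have hBx0 : 0 ≤ Bx := by rw [hBx]; positivity
  have hBy0 : 0 ≤ By := by rw [hBy]; positivity
  obtain ⟨G, hG⟩ : ∃ x, x = ((C₁ + C₂) * E * Fintype.card σ
    + (Fintype.card σ * (K * Bx) + Fintype.card σ * (K * By))) / β := ⟨_, rfl⟩
  have hG0 : 0 ≤ G := by rw [hG]; positivity
  obtain ⟨d₀, hd₀, hsmall⟩ : ∃ d₀ > 0, ∀ d : ℝ, 0 < d → d ≤ d₀ → Q * d ^ 2 < c / 4 ∧
      K * Q * d ^ 2 < κ₀ * c / 4 ∧ C₁ * E * d ^ 2 < κ₀ * c / 8 ∧ G * d ^ 2 < 1 / 4 := by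
    have hev := ((eventually_mul_sq_lt Q (by positivity : 0 < c / 4)).and
      ((eventually_mul_sq_lt (K * Q) (by positivity : 0 < κ₀ * c / 4)).and
        ((eventually_mul_sq_lt (C₁ * E) (by positivity : 0 < κ₀ * c / 8)).and
          (eventually_mul_sq_lt G (by norm_num : (0 : ℝ) < 1 / 4)))))
    obtain ⟨e, he, h⟩ := Metric.eventually_nhds_iff.1 hev
    refine ⟨e / 2, by positivity, fun d hd hde => h ?_⟩
    rw [Real.dist_eq, sub_zero, abs_of_pos hd]
    linarith
  obtain ⟨M₀, hM₀⟩ := exists_nat_ge ((Lx + Ly) / d₀)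
  refine ⟨C₁ + C₂ + 4 * √G, max (max Nx₀ Ny₀) (M₀ + 1), ?_⟩
  intro Nx Ny _ _ hNx hNy rx ry hrx hrx1 hry hry1 Hx Hy dx dy hHx hHy hdx hdy
  have hgeom : ∀ (N n : ℕ) [NeZero N] [NeZero n] (L r H d : ℝ), 0 < L → L ≤ Lx + Ly →
      max (max Nx₀ Ny₀) (M₀ + 1) ≤ N → 0 < r → r ≤ 1 → H = L / N → d = r * H / n →
      0 < H ∧ H ≤ L ∧ 0 < d ∧ d ≤ d₀ ∧ n * d = r * H := by
    intro N n _ _ L r H d hL hLL hN hr hr1 hH hd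
    have hN1 : (1 : ℝ) ≤ N := by exact_mod_cast Nat.pos_of_neZero N
    have hn1 : (1 : ℝ) ≤ n := by exact_mod_cast Nat.pos_of_neZero n
    have hNM : (M₀ : ℝ) ≤ N := by
      exact_mod_cast (Nat.le_succ _).trans ((le_max_right _ _).trans hN)
    have hH0 : 0 < H := by rw [hH]; positivity
    have hHd : H ≤ d₀ := by
      rw [hH, div_le_iff₀ (by positivity)]
      have := hM₀.trans hNM
      rw [div_le_iff₀ hd₀] at this
      linarith
    refine ⟨hH0, ?_, by rw [hd]; positivity, ?_, by rw [hd]; field_simp⟩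
    · rw [hH]; exact div_le_self hL.le hN1
    · rw [hd]
      refine (div_le_self (by positivity) hn1).trans (le_trans ?_ hHd)
      exact mul_le_of_le_one_left hH0.le hr1
  obtain ⟨hHx0, hHxL, hdx0, hdxd, hndx⟩ :=
    hgeom Nx nx Lx rx Hx dx hLx (by linarith) hNx hrx hrx1 hHx hdx
  obtain ⟨hHy0, hHyL, hdy0, hdyd, hndy⟩ :=
    hgeom Ny ny Ly ry Hy dy hLy (by linarith) hNy hry hry1 hHy hdy
  obtain ⟨ρx, qx, hshx, hρx, hqx⟩ :=
    hx Nx ((le_max_left _ _).trans ((le_max_left _ _).trans hNx)) rx hrx hrx1 Hx hHx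
  obtain ⟨ρy, qy, hshy, hρy, hqy⟩ :=
    hy Ny ((le_max_right _ _).trans ((le_max_left _ _).trans hNy)) ry hry hry1 Hy hHy
  have hex0 := cx.error_nonneg hHx0.le
  have hey0 := cy.error_nonneg hHy0.le
  have hexL := cx.error_mono hHx0.le hHxL
  have heyL := cy.error_mono hHy0.le hHyL
  generalize cx.error Hx = ex at hex0 hexL hρx hqx ⊢
  generalize cy.error Hy = ey at hey0 heyL hρy hqy ⊢
  obtain ⟨ε, hε⟩ : ∃ x, x = ex + ey := ⟨_, rfl⟩
  have hε0 : 0 ≤ ε := by rw [hε]; exact add_nonneg hex0 hey0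
  have hεE : ε ≤ E := by rw [hε, hE]; exact add_le_add hexL heyL
  have hexE : ex ≤ E := by linarith
  have heyE : ey ≤ E := by linarith
  have hxd : dx ≤ max dx dy := le_max_left _ _
  have hyd : dy ≤ max dx dy := le_max_right _ _
  have hdd : max dx dy ≤ d₀ := max_le hdxd hdyd
  generalize max dx dy = d at hxd hyd hdd ⊢
  have hd0 : 0 < d := hdx0.trans_le hxd
  obtain ⟨hs1, hs2, hs3, hs4⟩ := hsmall d hd0 hdd
  have hqxQ : |qx| ≤ Qx := by
    have h1 : |qx| ≤ |qx - qa| + |qa| := by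
      have := abs_add_le (qx - qa) qa
      rwa [sub_add_cancel] at this
    have h2 : Cx * ex ≤ Cx * E := mul_le_mul_of_nonneg_left hexE hCx
    linarith
  have hqyQ : |qy| ≤ Qy := by
    have h1 : |qy| ≤ |qy - qb| + |qb| := by
      have := abs_add_le (qy - qb) qb
      rwa [sub_add_cancel] at this
    have h2 : Cy * ey ≤ Cy * E := mul_le_mul_of_nonneg_left heyE hCy
    linarith
  have hqx2 : qx ^ 2 ≤ Qx ^ 2 := sq_le_sq.2 (hqxQ.trans (le_abs_self _))
  have hqy2 : qy ^ 2 ≤ Qy ^ 2 := sq_le_sq.2 (hqyQ.trans (le_abs_self _))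
  have hqQ : qa ^ 2 + qb ^ 2 ≤ Q := by
    rw [hQ]
    have h1 : |qa| ≤ Qx := hQx ▸ le_add_of_nonneg_right (by positivity)
    have h2 : |qb| ≤ Qy := hQy ▸ le_add_of_nonneg_right (by positivity)
    exact add_le_add (sq_le_sq.2 (h1.trans (le_abs_self _)))
      (sq_le_sq.2 (h2.trans (le_abs_self _)))
  have hqQ' : qx ^ 2 + qy ^ 2 ≤ Q := by rw [hQ]; exact add_le_add hqx2 hqy2
  have hΛ : |homRate κx κy dx dy (qx, qy) - homRate κx κy dx dy (qa, qb)| ≤ C₂ * ε := by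
    have h1 : |qx - qa| ≤ (Cx + Cy) * ε := hqx.trans (by
      rw [hε]; exact mul_le_add_mul_add hCy hCx hex0 hey0)
    have h2 : |qy - qb| ≤ (Cx + Cy) * ε := hqy.trans (by
      rw [hε, add_comm Cx, add_comm ex]; exact mul_le_add_mul_add hCx hCy hey0 hex0)
    refine (abs_homRate_sub_le hK hκx hκy hxK hyK hdx0 hdy0 (by positivity) h1 h2 hqQ hqQ').trans ?_
    have h3 : K * Q + 2 * K * (1 + (Cx + Cy) * ε) ≤ K * Q + 2 * K * (1 + (Cx + Cy) * E) := by
      gcongr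
    calc (Cx + Cy) * ε * (K * Q + 2 * K * (1 + (Cx + Cy) * ε))
        ≤ (Cx + Cy) * ε * (K * Q + 2 * K * (1 + (Cx + Cy) * E)) := by gcongr
      _ = C₂ * ε := by rw [hC₂]; ring
  have hΛ' : -(κ₀ * c / 4 / d ^ 2) < homRate κx κy dx dy (qx, qy) := by
    have h1 := neg_homRate_le hK hxK hyK hdx0 hdy0 (qx, qy)
    have h2 : K * (qx ^ 2 + qy ^ 2) ≤ K * Q := mul_le_mul_of_nonneg_left hqQ' hK
    have h3 : K * Q < κ₀ * c / 4 / d ^ 2 := by rw [lt_div_iff₀ (by positivity)]; exact hs2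
    linarith
  have hζ : ‖phase qx dx - 1‖ ^ 2 + ‖phase qy dy - 1‖ ^ 2 ≤ c / 4 := by
    have hdir : ∀ q Q e : ℝ, q ^ 2 ≤ Q → 0 < e → e ≤ d → ‖phase q e - 1‖ ^ 2 ≤ Q * d ^ 2 := by
      intro q Q e hqQ he hed
      have h1 := pow_le_pow_left₀ (norm_nonneg _) (norm_phase_sub_one_le q e) 2
      rw [sq_abs, mul_pow] at h1
      have h0 : 0 ≤ Q := (sq_nonneg q).trans hqQ
      refine h1.trans ?_
      gcongr
    have h1 := hdir qx _ dx hqx2 hdx0 hxd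
    have h2 := hdir qy _ dy hqy2 hdy0 hyd
    refine (add_le_add h1 h2).trans ?_
    rw [← add_mul, ← hQ]
    exact hs1.le
  rw [← hndx] at hshx hρx
  rw [← hndy] at hshy hρy
  set T := twistedOp R U (Function.uncurry κx ∘ π) (Function.uncurry κy ∘ π)
    (edgeFactor (ρx * phase qx (nx * dx)) ∘ ix) (edgeFactor (ρy * phase qy (ny * dy)) ∘ iy)
    dx dy with hT
  have hpert : 4 * K * (|ρx - 1| / dx ^ 2 + |ρy - 1| / dy ^ 2) ≤ C₁ * ε := by
    have hρxd : |ρx - 1| / dx ^ 2 ≤ Cx * nx ^ 2 * ex := by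
      rw [div_le_iff₀ (by positivity)]
      exact hρx.trans (le_of_eq (by ring))
    have hρyd : |ρy - 1| / dy ^ 2 ≤ Cy * ny ^ 2 * ey := by
      rw [div_le_iff₀ (by positivity)]
      exact hρy.trans (le_of_eq (by ring))
    have h1 : |ρx - 1| / dx ^ 2 + |ρy - 1| / dy ^ 2 ≤ (Cx * nx ^ 2 + Cy * ny ^ 2) * ε := by
      have h2 : 0 ≤ Cx * nx ^ 2 * ey := by positivity
      have h3 : 0 ≤ Cy * ny ^ 2 * ex := by positivity
      rw [hε]; linarith
    calc 4 * K * (|ρx - 1| / dx ^ 2 + |ρy - 1| / dy ^ 2)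
        ≤ 4 * K * ((Cx * nx ^ 2 + Cy * ny ^ 2) * ε) := by gcongr
      _ = _ := by rw [hC₁]; ring
  have hspecT : ∀ (ν : ℝ) v, v ≠ 0 → T v = (ν : ℂ) • v →
      |ν - homRate κx κy dx dy (qa, qb)| ≤ (C₁ + C₂) * ε ∨ ν ≤ -(β / d ^ 2) := by
    intro ν v hv hTv
    rcases rate_near_homRate_or_le (q := (qx, qy)) hκ₀ hK hx₀ hy₀ hxK hyK hR hU hxR hxU hyR hyU
      hpoinc hdx0 hdy0 hxd hyd hζ hΛ' hpert hv hTv with h3 | h3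
    · left
      have h4 := abs_sub_le ν (homRate κx κy dx dy (qx, qy)) (homRate κx κy dx dy (qa, qb))
      linarith
    · right
      have h5 : C₁ * ε ≤ κ₀ * c / 8 / d ^ 2 := by
        rw [le_div_iff₀ (by positivity)]
        refine le_trans ?_ hs3.le
        gcongr
      have h6 : κ₀ * c / 4 / d ^ 2 = κ₀ * c / 8 / d ^ 2 + κ₀ * c / 8 / d ^ 2 := by ring
      rw [hβ]
      linarith
  have hone : -(star (1 : σ → ℂ) ⬝ᵥ T 1).re
      ≤ Fintype.card σ * (K * Bx) + Fintype.card σ * (K * By) := by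
    refine constant_energy_le R U (fun s => (hκx _ _).le) (fun s => hxK _ _)
      (fun s => (hκy _ _).le) (fun s => hyK _ _) ix iy hdx0 hdy0 hBx0 hBy0 ?_ ?_
    · have h2 : Cx * (nx * dx) ^ 2 * ex ≤ Cx * (nx * dx) ^ 2 * E := by gcongr
      have h3 := mul_le_mul_of_nonneg_right hqx2 (sq_nonneg (nx * dx))
      rw [mul_pow, hBx]
      linarith
    · have h2 : Cy * (ny * dy) ^ 2 * ey ≤ Cy * (ny * dy) ^ 2 * E := by gcongr
      have h3 := mul_le_mul_of_nonneg_right hqy2 (sq_nonneg (ny * dy))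
      rw [mul_pow, hBy]
      linarith
  -- The fast part of the constant field is at most `√G * d` at every point.
  have hGd : (√G * d) ^ 2 = G * d ^ 2 := by rw [mul_pow, Real.sq_sqrt hG0]
  have hrate := hasMacroscaleRate_of_hermitian (Nx := Nx) (Ny := Ny)
    (F := scheme Nx Ny rx ry dx dy) (a := a) (b := b) (T := T)
    (isHermitianOp_twistedOp _ _ _ _ _ _ _ _)
    (fun V hV => hscheme Nx Ny rx ry dx dy a b _ _ V hV hshx hshy)
    (ε := (C₁ + C₂) * ε) (η := (C₁ + C₂ + 4 * √G) * d) (δ := √G * d) (γ := β / d ^ 2)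
    (by positivity) (homRate_nonpos hκx hκy dx dy (qa, qb)) (by positivity) hspecT (by positivity)
    (by
      refine (sq_le_sq₀ (by positivity) (by norm_num)).1 ?_
      rw [hGd]; linarith)
    (by
      have : 0 ≤ (C₁ + C₂) * d := by positivity
      linarith)
    (by
      rw [hGd]
      have h1 : β / d ^ 2 * (G * d ^ 2) = (C₁ + C₂) * E * Fintype.card σ
          + (Fintype.card σ * (K * Bx) + Fintype.card σ * (K * By)) := by
        rw [hG]; field_simp
      have h2 : (C₁ + C₂) * ε * Fintype.card σ ≤ (C₁ + C₂) * E * Fintype.card σ := by gcongr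
      rw [h1]
      linarith)
  refine hrate.mono (by positivity) ?_
  rw [← hε]
  have : 0 ≤ 4 * √G * ε := by positivity
  linarith

end PatchConsistency

/-! ### Even analytic functions of two variables -/

open Asymptotics in
/-- The Taylor expansion of an even analytic function of two variables, to second order. -/
lemma exists_quadratic_expansion {f : ℝ × ℝ → ℝ} (hf : AnalyticAt ℝ f 0) (h0 : f 0 = 0)
    (heven : ∀ q, f (-q) = f q) : ∃ Kxx Kxy Kyy : ℝ,
      (fun q : ℝ × ℝ => f q + (Kxx * q.1 ^ 2 + 2 * Kxy * q.1 * q.2 + Kyy * q.2 ^ 2))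
        =O[𝓝 0] fun q => ‖q‖ ^ 4 := by
  obtain ⟨p, hp⟩ := hf
  let L : ℝ × ℝ →L[ℝ] ℝ × ℝ →L[ℝ] ℝ :=
    (continuousMultilinearCurryFin1 ℝ (ℝ × ℝ) ℝ).toContinuousLinearEquiv.toContinuousLinearMap ∘L
      (p 2).curryLeft
  have hL : ∀ y : ℝ × ℝ, p 2 (fun _ => y) = L y y := fun y => by
    have h : (fun _ => y) = (Fin.cons y ((Fin.snoc 0 y : Fin 1 → ℝ × ℝ)) : Fin 2 → ℝ × ℝ) := by
      ext i <;> fin_cases i <;> rfl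
    rw [h]
    rfl
  have hL' : ∀ y : ℝ × ℝ, L y y = L (1, 0) (1, 0) * y.1 ^ 2
      + (L (1, 0) (0, 1) + L (0, 1) (1, 0)) * y.1 * y.2 + L (0, 1) (0, 1) * y.2 ^ 2 := fun y => by
    have hy : y = y.1 • ((1, 0) : ℝ × ℝ) + y.2 • ((0, 1) : ℝ × ℝ) := by ext <;> simp
    conv_lhs => rw [hy]
    simp only [map_add, map_smul, add_apply, smul_apply, smul_eq_mul]
    ring
  have h1 := hp.isBigO_sub_partialSum_pow 4
  have h2 := h1.comp_tendsto (k := fun q : ℝ × ℝ => -q) (by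
    simpa using (continuous_neg (G := ℝ × ℝ)).tendsto 0)
  simp only [Function.comp_def, norm_neg] at h2
  refine ⟨-L (1, 0) (1, 0), -(L (1, 0) (0, 1) + L (0, 1) (1, 0)) / 2, -L (0, 1) (0, 1),
    ((h1.add h2).const_mul_left (1 / 2)).congr_left fun q => ?_⟩
  -- The terms of odd order cancel in the mean of the values at `q` and `-q`.
  have hodd : ∀ n, p n (fun _ => -q) = (-1) ^ n * p n fun _ => q := fun n => by
    have := (p n).map_smul_univ (fun _ => (-1 : ℝ)) fun _ => q
    simpa using this
  have hzero : p 0 (fun _ => q) = 0 := by rw [← h0]; exact hp.coeff_zero _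
  simp only [FormalMultilinearSeries.partialSum, Finset.sum_range_succ, Finset.sum_range_zero,
    hodd, zero_add, heven, hzero]
  rw [hL, hL']
  ring

open Asymptotics in
/-- The quadratic part inherits definiteness from the function, along every line through zero. -/
lemma quadratic_form_pos {f : ℝ × ℝ → ℝ} {c : ℝ} (hc : 0 < c)
    (hf : ∀ᶠ q in 𝓝 (0 : ℝ × ℝ), f q ≤ -(c * (q.1 ^ 2 + q.2 ^ 2))) {Kxx Kxy Kyy : ℝ}
    (h : (fun q : ℝ × ℝ => f q + (Kxx * q.1 ^ 2 + 2 * Kxy * q.1 * q.2 + Kyy * q.2 ^ 2))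
        =O[𝓝 0] fun q => ‖q‖ ^ 4) {q : ℝ × ℝ} (hq : q ≠ 0) :
    0 < Kxx * q.1 ^ 2 + 2 * Kxy * q.1 * q.2 + Kyy * q.2 ^ 2 := by
  obtain ⟨C, hC⟩ := h.bound
  have hpos : 0 < q.1 ^ 2 + q.2 ^ 2 := by
    rcases eq_or_ne q.1 0 with h1 | h1
    · have h2 : q.2 ≠ 0 := fun h2 => hq (Prod.ext h1 h2)
      positivity
    · positivity
  have hline : Tendsto (fun t : ℝ => t • q) (𝓝[≠] 0) (𝓝 0) := by
    have : Tendsto (fun t : ℝ => t • q) (𝓝 0) (𝓝 ((0 : ℝ) • q)) :=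
      Continuous.tendsto (by fun_prop) 0
    rw [zero_smul] at this
    exact this.mono_left nhdsWithin_le_nhds
  have hlim : Tendsto (fun t : ℝ => c * (q.1 ^ 2 + q.2 ^ 2) - C * (t ^ 2 * ‖q‖ ^ 4)) (𝓝[≠] 0)
      (𝓝 (c * (q.1 ^ 2 + q.2 ^ 2) - C * (0 ^ 2 * ‖q‖ ^ 4))) :=
    (Continuous.tendsto (by fun_prop) 0).mono_left nhdsWithin_le_nhds
  have hle := le_of_tendsto hlim (b := Kxx * q.1 ^ 2 + 2 * Kxy * q.1 * q.2 + Kyy * q.2 ^ 2) (by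
    filter_upwards [hline.eventually hf, hline.eventually hC, self_mem_nhdsWithin] with t h1 h2 ht
    have ht2 : 0 < t ^ 2 := by have : t ≠ 0 := ht; positivity
    have h3 := neg_le_of_abs_le (h2.trans_eq rfl)
    simp only [Prod.smul_fst, Prod.smul_snd, smul_eq_mul, norm_smul, mul_pow,
      Real.norm_eq_abs] at h1 h3
    have h4 : |t| ^ 4 = t ^ 2 * t ^ 2 := by rw [← sq_abs t]; ring
    rw [h4, abs_of_nonneg (by positivity : 0 ≤ t ^ 2 * t ^ 2 * ‖q‖ ^ 4)] at h3
    refine le_of_mul_le_mul_left ?_ ht2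
    linarith)
  have := mul_pos hc hpos
  simp only [zero_pow two_ne_zero, zero_mul, mul_zero, sub_zero] at hle
  linarith

/-! ### The slow manifold of the lattice -/

section Homogenisation

variable {px py : ℕ} [NeZero px] [NeZero py]

/-- The lattice of one period is connected. -/
lemma component_shift (s₀ : ZMod px × ZMod py) :
    component (shiftX px py) (shiftY px py) s₀ = Set.univ := by
  refine Set.eq_univ_of_forall fun t g hg => ?_
  have hx : ∀ (j : ℕ) (s : ZMod px × ZMod py), g ((shiftX px py ^ j) s) = g s := fun j s => by
    induction j with
    | zero => simp
    | succ j ih => rw [pow_succ', Equiv.Perm.mul_apply, hg.1, ih]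
  have hy : ∀ (j : ℕ) (s : ZMod px × ZMod py), g ((shiftY px py ^ j) s) = g s := fun j s => by
    induction j with
    | zero => simp
    | succ j ih => rw [pow_succ', Equiv.Perm.mul_apply, hg.2, ih]
  have ht : t = (shiftX px py ^ (t.1 - s₀.1).val) ((shiftY px py ^ (t.2 - s₀.2).val) s₀) := by
    rw [shiftX_pow, shiftY_pow]
    simp
  rw [ht, hx, hy]

/-- For small wavenumbers there is a spectral gap, above which all modes are proportional. -/
lemma exists_gap {κx κy : ZMod px → ZMod py → ℝ} (hκx : ∀ k l, 0 < κx k l)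
    (hκy : ∀ k l, 0 < κy k l) {dx dy : ℝ} (hdx : 0 < dx) (hdy : 0 < dy) :
    ∃ β ρ : ℝ, 0 < β ∧ 0 < ρ ∧ ∀ q : ℝ × ℝ, |q.1| ≤ ρ → |q.2| ≤ ρ → ∀ (w₁ w₂) (μ₁ μ₂ : ℝ),
      latticeOp κx κy dx dy q w₁ = (μ₁ : ℂ) • w₁ → latticeOp κx κy dx dy q w₂ = (μ₂ : ℂ) • w₂ →
      -β < μ₁ → -β < μ₂ → ∃ c₁ c₂ : ℂ, (c₁ ≠ 0 ∨ c₂ ≠ 0) ∧ ∀ s, c₁ * w₁ s + c₂ * w₂ s = 0 := by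
  obtain ⟨κ₀, -, hκ₀, -, hx, hy, -, -⟩ := exists_bounds hκx hκy
  obtain ⟨c, hc0, hc⟩ := exists_poincare (shiftX px py) (shiftY px py)
  have hd : 0 < max dx dy := lt_max_of_lt_left hdx
  refine ⟨κ₀ * c / 4 / max dx dy ^ 2, √(c / 8) / max dx dy, by positivity, by positivity,
    fun q hq1 hq2 w₁ w₂ μ₁ μ₂ h₁ h₂ hμ₁ hμ₂ => ?_⟩
  have hphase : ∀ q d : ℝ, 0 < d → d ≤ max dx dy → |q| ≤ √(c / 8) / max dx dy →
      ‖phase q d - 1‖ ^ 2 ≤ c / 8 := fun q d hd0 hdm hq => by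
    have h : |q * d| ≤ √(c / 8) := by
      rw [abs_mul, abs_of_pos hd0]
      rw [le_div_iff₀ hd] at hq
      exact (mul_le_mul_of_nonneg_left hdm (abs_nonneg q)).trans hq
    calc ‖phase q d - 1‖ ^ 2 ≤ √(c / 8) ^ 2 :=
          pow_le_pow_left₀ (norm_nonneg _) ((norm_phase_sub_one_le q d).trans h) 2
      _ = c / 8 := Real.sq_sqrt (by positivity)
  have hζ : ‖phase q.1 dx - 1‖ ^ 2 + ‖phase q.2 dy - 1‖ ^ 2 ≤ c / 4 := by
    have h1 := hphase q.1 dx hdx (le_max_left _ _) hq1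
    have h2 := hphase q.2 dy hdy (le_max_right _ _) hq2
    linarith
  obtain ⟨c₁, c₂, hne, h⟩ := slow_modes_dependent hc hκ₀ (fun s => hx s.1 s.2)
    (fun s => hy s.1 s.2) (norm_phase _ _) (norm_phase _ _) hζ hdx hdy (le_max_left _ _)
    (le_max_right _ _) h₁ h₂ hμ₁ hμ₂ 0
  exact ⟨c₁, c₂, hne, fun s => h s (by rw [component_shift]; trivial)⟩

omit [NeZero px] [NeZero py] in
lemma latticeOp_zero_one (κx κy : ZMod px → ZMod py → ℝ) (dx dy : ℝ) :
    latticeOp κx κy dx dy 0 1 = 0 := by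
  ext s
  simp [latticeOp, twistedOp_apply, dirOp_apply, phase]

/-- The equation for the slow manifold at wavenumber zero is nondegenerate. -/
lemma eq_zero_of_latticeOp_zero {κx κy : ZMod px → ZMod py → ℝ} (hκx : ∀ k l, 0 < κx k l)
    (hκy : ∀ k l, 0 < κy k l) {dx dy : ℝ} (hdx : 0 < dx) (hdy : 0 < dy)
    {w : ZMod px × ZMod py → ℂ} {z : ℂ} (h : latticeOp κx κy dx dy 0 w = z • 1)
    (hw : ∑ s, w s = 0) : w = 0 ∧ z = 0 := by
  have hcard : ∑ _s : ZMod px × ZMod py, (1 : ℂ) ≠ 0 := by simp [NeZero.ne]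
  have hz : z = 0 := by
    have h1 := isHermitianOp_twistedOp (shiftX px py) (shiftY px py) (Function.uncurry κx)
      (Function.uncurry κy) (fun _ => phase (0 : ℝ × ℝ).1 dx) (fun _ => phase (0 : ℝ × ℝ).2 dy)
      dx dy 1 w
    rw [← latticeOp, h, latticeOp_zero_one] at h1
    simp only [dotProduct_smul, star_one, star_zero, zero_dotProduct, smul_eq_mul] at h1
    refine (mul_eq_zero.1 h1).resolve_right ?_
    simpa [dotProduct] using hcard
  obtain ⟨β, ρ, hβ, hρ, hgap⟩ := exists_gap hκx hκy hdx hdy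
  have h0 : latticeOp κx κy dx dy 0 w = ((0 : ℝ) : ℂ) • w := by simp [h, hz]
  have h1 : latticeOp κx κy dx dy 0 1 = ((0 : ℝ) : ℂ) • 1 := by simp [latticeOp_zero_one]
  obtain ⟨c₁, c₂, hne, hdep⟩ := hgap 0 (by simpa using hρ.le) (by simpa using hρ.le) w 1 0 0 h0 h1
    (by linarith) (by linarith)
  have h2 : ∑ s, (c₁ * w s + c₂ * (1 : ZMod px × ZMod py → ℂ) s) = 0 :=
    Finset.sum_eq_zero fun s _ => hdep s
  rw [Finset.sum_add_distrib, ← Finset.mul_sum, ← Finset.mul_sum, hw, mul_zero, zero_add] at h2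
  have hc₂ : c₂ = 0 := (mul_eq_zero.1 h2).resolve_right hcard
  refine ⟨funext fun s => ?_, hz⟩
  have h3 := hdep s
  rw [hc₂, zero_mul, add_zero] at h3
  exact (mul_eq_zero.1 h3).resolve_left (hne.resolve_right fun h => h hc₂)

open scoped ContDiff in
/-- The analytic branch of slow modes, by the implicit function theorem. -/
lemma exists_slow_branch {κx κy : ZMod px → ZMod py → ℝ} (hκx : ∀ k l, 0 < κx k l)
    (hκy : ∀ k l, 0 < κy k l) {dx dy : ℝ} (hdx : 0 < dx) (hdy : 0 < dy) :
    ∃ (W : ℝ × ℝ → ZMod px × ZMod py → ℂ) (z : ℝ × ℝ → ℂ), AnalyticAt ℝ W 0 ∧ AnalyticAt ℝ z 0 ∧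
      W 0 = 1 ∧ z 0 = 0 ∧ ∀ᶠ q in 𝓝 (0 : ℝ × ℝ), latticeOp κx κy dx dy q (W q) = z q • W q ∧
        ∑ s, W q s = px * py := by
  -- The equation `F = (0, px * py)` for the mode shape and the rate, normalised to mean one.
  let F : (ℝ × ℝ) × ((ZMod px × ZMod py → ℂ) × ℂ) → (ZMod px × ZMod py → ℂ) × ℂ :=
    fun p => (latticeOp κx κy dx dy p.1 p.2.1 - p.2.2 • p.2.1, ∑ s, p.2.1 s)
  have hF : ContDiff ℝ ω F := by
    refine ContDiff.prodMk (contDiff_pi.2 fun s => ?_) ?_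
    · simp only [latticeOp, twistedOp_apply, dirOp_apply, Pi.sub_apply, Pi.smul_apply, smul_eq_mul,
        conj_phase, div_eq_mul_inv]
      have h : ∀ d : ℝ, ContDiff ℝ ω fun q : ℝ => phase q d := fun d =>
        (contDiff_const.mul (ofRealCLM.contDiff.comp (contDiff_id.mul contDiff_const))).cexp
      have h1 := h dx
      have h2 := h dy
      fun_prop
    · fun_prop
  obtain ⟨u, hu⟩ : ∃ u : (ℝ × ℝ) × ((ZMod px × ZMod py → ℂ) × ℂ), u = (0, (1, 0)) := ⟨_, rfl⟩
  have hinv : (fderiv ℝ F u ∘L .inr ℝ (ℝ × ℝ) ((ZMod px × ZMod py → ℂ) × ℂ)).IsInvertible := by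
    have hinj : Function.Injective
        (fderiv ℝ F u ∘L .inr ℝ (ℝ × ℝ) ((ZMod px × ZMod py → ℂ) × ℂ)) := by
      rw [injective_iff_map_eq_zero]
      rintro ⟨w, x⟩ hwx
      have h1 : HasDerivAt (fun t : ℝ => F (u + t • ((0 : ℝ × ℝ), (w, x))))
          (fderiv ℝ F u (0, (w, x))) 0 :=
        ((hF.differentiable (by simp)).differentiableAt.hasFDerivAt (x := u)).hasLineDerivAt _
      have h2 : (fun t : ℝ => F (u + t • ((0 : ℝ × ℝ), (w, x)))) = fun t : ℝ =>
          ((t : ℂ) • latticeOp κx κy dx dy 0 w - ((t : ℂ) * x) • (1 + (t : ℂ) • w),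
            ∑ s, (1 + (t : ℂ) * w s)) := by
        ext t
        · simp [F, hu, latticeOp_zero_one]
        · simp [F, hu]
      have h3 : HasDerivAt (fun t : ℝ => (((t : ℂ) • latticeOp κx κy dx dy 0 w
          - ((t : ℂ) * x) • ((1 : ZMod px × ZMod py → ℂ) + (t : ℂ) • w),
            ∑ s, (1 + (t : ℂ) * w s)) : (ZMod px × ZMod py → ℂ) × ℂ))
          (latticeOp κx κy dx dy 0 w - x • 1, ∑ s, w s) 0 := by
        have ht : HasDerivAt (fun t : ℝ => (t : ℂ)) 1 0 := ofRealCLM.hasDerivAt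
        refine HasDerivAt.prodMk (hasDerivAt_pi.2 fun s => ?_) (HasDerivAt.fun_sum fun s _ => ?_)
        · have h4 := (ht.mul_const (latticeOp κx κy dx dy 0 w s)).sub
            ((ht.mul_const x).mul ((ht.mul_const (w s)).const_add 1))
          simpa [Pi.sub_def, Pi.mul_def, mul_add] using h4
        · simpa using (ht.mul_const (w s)).const_add 1
      rw [h2] at h1
      have h4 := h3.unique h1
      have h5 : fderiv ℝ F u (0, (w, x)) = 0 := hwx
      rw [h5, Prod.mk_eq_zero] at h4
      obtain ⟨hw, hx⟩ := eq_zero_of_latticeOp_zero hκx hκy hdx hdy (sub_eq_zero.1 h4.1) h4.2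
      rw [hw, hx]; rfl
    exact ⟨(LinearEquiv.ofInjectiveEndo _ hinj).toContinuousLinearEquiv,
      ContinuousLinearMap.ext fun _ => rfl⟩
  have hFu : ContDiffAt ℝ ω F u := hF.contDiffAt
  have hψ := hFu.contDiffAt_implicitFunction (by simp) hinv
  have hψ0 := hFu.implicitFunction_apply_self (by simp) hinv
  have hψF := hFu.eventually_apply_implicitFunction (by simp) hinv
  generalize hFu.implicitFunction (by simp) hinv = ψ at hψ hψ0 hψF
  rw [hu] at hψ hψ0 hψF
  refine ⟨fun q => (ψ q).1, fun q => (ψ q).2, (contDiffAt_fst.comp _ hψ).analyticAt,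
    (contDiffAt_snd.comp _ hψ).analyticAt, by simp [hψ0], by simp [hψ0],
    hψF.mono fun q hq => ?_⟩
  simp only [F, latticeOp_zero_one, Prod.mk.injEq, zero_smul, sub_zero] at hq
  refine ⟨sub_eq_zero.1 hq.1, ?_⟩
  rw [hq.2]
  simp

lemma norm_phase_pow_sub_one_ge {q d : ℝ} {p : ℕ} (h : |p * (q * d)| ≤ Real.pi) :
    2 / Real.pi * |p * (q * d)| ≤ ‖phase q d ^ p - 1‖ := by
  have h1 : phase q d ^ p = exp (I * ((p * (q * d) : ℝ) : ℂ)) := by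
    rw [phase, ← exp_nat_mul]; congr 1; push_cast; ring
  rw [h1, norm_exp_I_mul_ofReal_sub_one, norm_mul, Real.norm_eq_abs, Real.norm_eq_abs,
    abs_of_pos (zero_lt_two' ℝ)]
  generalize (p : ℝ) * (q * d) = x at h
  have h2 : |x / 2| = |x| / 2 := by rw [abs_div, abs_of_pos (zero_lt_two' ℝ)]
  have h3 := Real.mul_abs_le_abs_sin (x := x / 2) (by rw [h2]; linarith)
  rw [h2] at h3
  linarith

/-- The homogenised rate is bounded above by a negative definite quadratic form: round one period
the phase `exp (𝐢 p q d)` has to be undone. -/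
lemma exists_homRate_le {κx κy : ZMod px → ZMod py → ℝ} (hκx : ∀ k l, 0 < κx k l)
    (hκy : ∀ k l, 0 < κy k l) {dx dy : ℝ} (hdx : 0 < dx) (hdy : 0 < dy) :
    ∃ c : ℝ, 0 < c ∧ ∀ᶠ q in 𝓝 (0 : ℝ × ℝ),
      homRate κx κy dx dy q ≤ -(c * (q.1 ^ 2 + q.2 ^ 2)) := by
  obtain ⟨κ₀, -, hκ₀, -, hx, hy, -, -⟩ := exists_bounds hκx hκy
  have hpi := Real.pi_pos
  refine ⟨κ₀ * (2 / Real.pi) ^ 2, by positivity, ?_⟩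
  have hdir : ∀ (p : ℕ) [NeZero p] (q d : ℝ), 0 < d → |p * (q * d)| < Real.pi →
      (2 / Real.pi) ^ 2 * q ^ 2 ≤ ‖phase q d ^ p - 1‖ ^ 2 / p ^ 2 / d ^ 2 := by
    intro p _ q d hd h
    have hp : (0 : ℝ) < p := by exact_mod_cast Nat.pos_of_neZero p
    have h1 := pow_le_pow_left₀ (by positivity) (norm_phase_pow_sub_one_ge h.le) 2
    rw [mul_pow, sq_abs] at h1
    rw [le_div_iff₀ (by positivity), le_div_iff₀ (by positivity)]
    exact (le_of_eq (by ring)).trans h1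
  have hlim1 : ∀ᶠ q in 𝓝 (0 : ℝ × ℝ), |px * (q.1 * dx)| < Real.pi := by
    have : Tendsto (fun q : ℝ × ℝ => |px * (q.1 * dx)|) (𝓝 0) (𝓝 |px * ((0 : ℝ × ℝ).1 * dx)|) :=
      Continuous.tendsto (by fun_prop) 0
    exact this.eventually_lt_const (by simpa using hpi)
  have hlim2 : ∀ᶠ q in 𝓝 (0 : ℝ × ℝ), |py * (q.2 * dy)| < Real.pi := by
    have : Tendsto (fun q : ℝ × ℝ => |py * (q.2 * dy)|) (𝓝 0) (𝓝 |py * ((0 : ℝ × ℝ).2 * dy)|) :=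
      Continuous.tendsto (by fun_prop) 0
    exact this.eventually_lt_const (by simpa using hpi)
  filter_upwards [hlim1, hlim2] with q h1 h2
  have h3 := add_le_add (hdir px q.1 dx hdx h1) (hdir py q.2 dy hdy h2)
  have h4 := homRate_le_holonomy hκ₀.le hx hy dx dy q
  have h5 := mul_le_mul_of_nonneg_left h3 hκ₀.le
  linarith

/-- The analytic branch of slow modes lies in the gap, so it is the slow manifold, and its rate is
the homogenised one. -/
theorem isHomogenisation_homRate {κx κy : ZMod px → ZMod py → ℝ} (hκx : ∀ k l, 0 < κx k l)
    (hκy : ∀ k l, 0 < κy k l) {dx dy : ℝ} (hdx : 0 < dx) (hdy : 0 < dy) :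
    IsHomogenisation κx κy dx dy (homRate κx κy dx dy) := by
  obtain ⟨W, z, hW, hz, hW0, hz0, hWz⟩ := exists_slow_branch hκx hκy hdx hdy
  obtain ⟨β, ρ, hβ, hρ, hgap⟩ := exists_gap hκx hκy hdx hdy
  have hcard : (px * py : ℂ) ≠ 0 := by simp [NeZero.ne]
  have hsmall : ∀ᶠ q in 𝓝 (0 : ℝ × ℝ), |q.1| ≤ ρ ∧ |q.2| ≤ ρ := by
    filter_upwards [Metric.closedBall_mem_nhds (0 : ℝ × ℝ) hρ] with q hq
    rw [mem_closedBall_zero_iff, Prod.norm_def] at hq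
    exact max_le_iff.1 hq
  have hre : ∀ᶠ q in 𝓝 (0 : ℝ × ℝ), -β < (z q).re := by
    have h : Tendsto (fun q => (z q).re) (𝓝 0) (𝓝 (z 0).re) :=
      (continuous_re.continuousAt.comp hz.continuousAt).tendsto
    exact h.eventually_const_lt (by rw [hz0]; simpa using hβ)
  have hreal : ∀ᶠ q in 𝓝 (0 : ℝ × ℝ), W q ≠ 0 ∧
      latticeOp κx κy dx dy q (W q) = ((z q).re : ℂ) • W q := by
    filter_upwards [hWz] with q hq
    have hne : W q ≠ 0 := fun h0 => by
      rw [h0] at hq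
      exact hcard (by simpa using hq.2.symm)
    refine ⟨hne, ?_⟩
    have h1 := energy_twistedOp (shiftX px py) (shiftY px py) (Function.uncurry κx)
      (Function.uncurry κy) (m := fun _ => phase q.1 dx) (n := fun _ => phase q.2 dy)
      (fun _ => norm_phase _ _) (fun _ => norm_phase _ _) dx dy (W q)
    rw [← latticeOp, hq.1, dotProduct_smul, star_dotProduct_self, smul_eq_mul] at h1
    have h2 := congrArg Complex.im h1
    rw [im_mul_ofReal, ofReal_im] at h2
    have h3 : (z q).im = 0 := (mul_eq_zero.1 h2).resolve_right (l2sq_pos hne).ne'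
    have h4 : ((z q).re : ℂ) = z q := Complex.ext (by simp) (by simp [h3])
    rw [h4, hq.1]
  have hslow : ∀ᶠ q in 𝓝 (0 : ℝ × ℝ), ∀ (μ : ℝ) (w), latticeOp κx κy dx dy q w = (μ : ℂ) • w →
      -β < μ → ∃ c : ℂ, w = c • W q := by
    filter_upwards [hsmall, hre, hreal] with q hq h1 h2 μ w hw hμ
    obtain ⟨c₁, c₂, hne, h⟩ := hgap q hq.1 hq.2 w (W q) μ _ hw h2.2 hμ h1
    have hc₁ : c₁ ≠ 0 := fun h0 => by
      obtain ⟨s, hs⟩ := Function.ne_iff.1 h2.1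
      have h3 := h s
      rw [h0, zero_mul, zero_add] at h3
      exact (mul_eq_zero.1 h3).elim (hne.resolve_left fun h => h h0) hs
    refine ⟨-c₂ / c₁, funext fun s => ?_⟩
    rw [Pi.smul_apply, smul_eq_mul, div_mul_eq_mul_div, eq_div_iff hc₁]
    linear_combination h s
  have hΛ : ∀ᶠ q in 𝓝 (0 : ℝ × ℝ), (z q).re = homRate κx κy dx dy q := by
    filter_upwards [hre, hreal, hslow] with q h1 h2 h3
    have hspec := homRate_spec κx κy dx dy q
    obtain ⟨w, hw, hmode⟩ := hspec.1
    obtain ⟨c, rfl⟩ := h3 _ w hmode (h1.trans_le (hspec.2.1 _ ⟨_, h2⟩))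
    rw [map_smul, h2.2, smul_comm] at hmode
    have h4 := smul_left_injective ℂ hw hmode
    exact_mod_cast h4
  have hanalytic : AnalyticAt ℝ (homRate κx κy dx dy) 0 :=
    ((reCLM.analyticAt _).comp hz).congr hΛ
  have hzero : homRate κx κy dx dy 0 = 0 := by rw [← hΛ.self_of_nhds, hz0, zero_re]
  obtain ⟨Kxx, Kxy, Kyy, hK⟩ := exists_quadratic_expansion hanalytic hzero
    (homRate_neg κx κy dx dy)
  obtain ⟨c, hc, hle⟩ := exists_homRate_le hκx hκy hdx hdy
  refine ⟨hanalytic, ⟨fun q k l => W q (k, l), ?_, ?_, ?_, β, hβ, ?_⟩, Kxx, Kxy, Kyy,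
    fun q hq => quadratic_form_pos hc hle hK hq, hK⟩
  · exact analyticAt_pi_iff.2 fun k => analyticAt_pi_iff.2 fun l => analyticAt_pi_iff.1 hW (k, l)
  · exact funext fun k => funext fun l => congrFun hW0 (k, l)
  · filter_upwards [hWz, hreal, hΛ] with q h1 h2 h3
    refine ⟨?_, ?_⟩
    · rw [← Fintype.sum_prod_type' fun k l => W q (k, l)]
      simp only [Prod.mk.eta]
      rw [h1.2, div_self hcard]
    · have h4 := uncurry_ensembleSymbol κx κy dx dy q fun k l => W q (k, l)
      ext k l
      have h5 := congrFun (h4.trans (h2.2.trans (by rw [h3]))) (k, l)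
      exact h5
  · filter_upwards [hslow] with q hq μ w hw
    rw [or_iff_not_imp_right, not_le]
    intro hμ
    obtain ⟨c, hcw⟩ := hq μ _ (isLatticeMode_iff.1 hw).2 hμ
    exact ⟨c, funext fun k => funext fun l => congrFun hcw (k, l)⟩

end Homogenisation

/-! ### The two patch schemes as twisted diffusions -/

section Schemes

variable {px py : ℕ} [NeZero px] [NeZero py] {κx κy : ZMod px → ZMod py → ℝ} {nx ny : ℕ}
  [NeZero nx] [NeZero ny]

/-- On waves, the ensemble scheme is diffusion on the positions `(i, j)` and ensemble indices
`(k, l)`, where the right neighbour of `(i, j, k, l)` is `(i + 1, j, k + 1, l)`. -/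
theorem isConsistent_ensembleScheme (hκx : ∀ k l, 0 < κx k l) (hκy : ∀ k l, 0 < κy k l)
    (cx cy : Coupling) :
    IsConsistent κx κy nx ny cx cy (ensembleScheme κx κy nx ny cx cy) := by
  obtain ⟨R, hR⟩ : ∃ R : Equiv.Perm (Fin nx × Fin ny × ZMod px × ZMod py),
      ∀ s, R s = (s.1 + 1, s.2.1, s.2.2.1 + 1, s.2.2.2) :=
    ⟨Equiv.addRight (1, 0, 1, 0), fun s => by simp [Prod.ext_iff]⟩
  obtain ⟨U, hU⟩ : ∃ U : Equiv.Perm (Fin nx × Fin ny × ZMod px × ZMod py),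
      ∀ s, U s = (s.1, s.2.1 + 1, s.2.2.1, s.2.2.2 + 1) :=
    ⟨Equiv.addRight (0, 1, 0, 1), fun s => by simp [Prod.ext_iff]⟩
  have hR' : ∀ s, R.symm s = (s.1 - 1, s.2.1, s.2.2.1 - 1, s.2.2.2) := fun s => by
    rw [Equiv.symm_apply_eq, hR]; simp
  have hU' : ∀ s, U.symm s = (s.1, s.2.1 - 1, s.2.2.1, s.2.2.2 - 1) := fun s => by
    rw [Equiv.symm_apply_eq, hU]; simp
  refine isConsistent_of_twistedOp hκx hκy (R := R) (U := U) (π := fun s => s.2.2)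
    (ix := fun s => s.1) (iy := fun s => s.2.1) (fun s => by rw [hR, shiftX_apply])
    (fun s => by rw [hU, shiftY_apply]) (fun s => by rw [hR]) (fun s => by rw [hU])
    (fun s => by rw [hR]) (fun s => by rw [hU]) ?_
  intro Nx Ny _ _ rx ry dx dy a b Mx My V hV hx hy A B
  ext s
  have hVx : ∀ i k A, V (A + 1) B (i, s.2.1, k, s.2.2.2)
      = exp (2 * Real.pi * I * a / Nx) * V A B (i, s.2.1, k, s.2.2.2) := fun i k A => hV.1 A B _
  have hVy : ∀ j l B, V A (B + 1) (s.1, j, s.2.2.1, l)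
      = exp (2 * Real.pi * I * b / Ny) * V A B (s.1, j, s.2.2.1, l) := fun j l B => hV.2 A B _
  have h1 := fun i k => hx (fun K => V K B (i, s.2.1, k, s.2.2.2)) (hVx i k) A
  have h2 := fun j l => hy (fun K => V A K (s.1, j, s.2.2.1, l)) (hVy j l) B
  rw [twistedOp_apply, dirOp_apply, dirOp_apply]
  simp only [ensembleScheme, hR, hU, hR', hU', Function.comp_apply, Function.uncurry]
  rw [coupledRow_right (w := fun K i' => V K B (i', s.2.1, s.2.2.1 + 1, s.2.2.2))
      (h1 (firstPt nx) (s.2.2.1 + 1)).1 s.1,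
    coupledRow_left (w := fun K i' => V K B (i', s.2.1, s.2.2.1 - 1, s.2.2.2))
      (h1 (lastPt nx) (s.2.2.1 - 1)).2 s.1,
    coupledRow_right (w := fun K j' => V A K (s.1, j', s.2.2.1, s.2.2.2 + 1))
      (h2 (firstPt ny) (s.2.2.2 + 1)).1 s.2.1,
    coupledRow_left (w := fun K j' => V A K (s.1, j', s.2.2.1, s.2.2.2 - 1))
      (h2 (lastPt ny) (s.2.2.2 - 1)).2 s.2.1]

/-- On waves, the scheme for a single realisation is diffusion on the positions `(i, j)`.  As the
patch holds whole periods, closing up its rows to cycles is compatible with the diffusivities. -/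
theorem isConsistent_singleScheme (hκx : ∀ k l, 0 < κx k l) (hκy : ∀ k l, 0 < κy k l)
    (cx cy : Coupling) (hnx : px ∣ nx) (hny : py ∣ ny) (φ : ZMod px) (ψ : ZMod py) :
    IsConsistent κx κy nx ny cx cy (singleScheme κx κy φ ψ nx ny cx cy) := by
  obtain ⟨R, hR⟩ : ∃ R : Equiv.Perm (Fin nx × Fin ny), ∀ s, R s = (s.1 + 1, s.2) :=
    ⟨Equiv.addRight (1, 0), fun s => by simp [Prod.ext_iff]⟩
  obtain ⟨U, hU⟩ : ∃ U : Equiv.Perm (Fin nx × Fin ny), ∀ s, U s = (s.1, s.2 + 1) :=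
    ⟨Equiv.addRight (0, 1), fun s => by simp [Prod.ext_iff]⟩
  have hR' : ∀ s, R.symm s = (s.1 - 1, s.2) := fun s => by
    rw [Equiv.symm_apply_eq, hR]; simp
  have hU' : ∀ s, U.symm s = (s.1, s.2 - 1) := fun s => by
    rw [Equiv.symm_apply_eq, hU]; simp
  have hcast : ∀ {n p : ℕ} [NeZero n] (_ : p ∣ n) (i : Fin n),
      (((i + 1).val + 1 : ℕ) : ZMod p) = ((i.val + 1 : ℕ) : ZMod p) + 1 := by
    intro n p _ hp i
    by_cases hi : i.val + 1 < n
    · rw [val_add_one_of_lt hi]; push_cast; ring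
    · have h1 : i.val + 1 = n := by omega
      rw [val_add_one_of_not_lt hi, h1, (ZMod.natCast_eq_zero_iff n p).2 hp]; simp
  have hcast' : ∀ {n p : ℕ} [NeZero n] (_ : p ∣ n) (i : Fin n),
      (((i - 1).val + 1 : ℕ) : ZMod p) = ((i.val + 1 : ℕ) : ZMod p) - 1 := by
    intro n p _ hp i
    have := hcast hp (i - 1)
    rw [sub_add_cancel] at this
    rw [this, add_sub_cancel_right]
  refine isConsistent_of_twistedOp hκx hκy (R := R) (U := U)
    (π := fun s => (((s.1.val + 1 : ℕ) : ZMod px) + φ, ((s.2.val + 1 : ℕ) : ZMod py) + ψ))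
    (ix := fun s => s.1) (iy := fun s => s.2)
    (fun s => by rw [hR, shiftX_apply, hcast hnx, add_right_comm])
    (fun s => by rw [hU, shiftY_apply, hcast hny, add_right_comm])
    (fun s => by rw [hR]) (fun s => by rw [hU]) (fun s => by rw [hR]) (fun s => by rw [hU]) ?_
  intro Nx Ny _ _ rx ry dx dy a b Mx My V hV hx hy A B
  ext s
  have hVx : ∀ i A, V (A + 1) B (i, s.2)
      = exp (2 * Real.pi * I * a / Nx) * V A B (i, s.2) := fun i A => hV.1 A B _
  have hVy : ∀ j B, V A (B + 1) (s.1, j)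
      = exp (2 * Real.pi * I * b / Ny) * V A B (s.1, j) := fun j B => hV.2 A B _
  have h1 := fun i => hx (fun K => V K B (i, s.2)) (hVx i) A
  have h2 := fun j => hy (fun K => V A K (s.1, j)) (hVy j) B
  have hxr := coupledRow_right (w := fun K i' => V K B (i', s.2)) (h1 (firstPt nx)).1 s.1
  have hxl := coupledRow_left (w := fun K i' => V K B (i', s.2)) (h1 (lastPt nx)).2 s.1
  have hyr := coupledRow_right (w := fun K j' => V A K (s.1, j')) (h2 (firstPt ny)).1 s.2
  have hyl := coupledRow_left (w := fun K j' => V A K (s.1, j')) (h2 (lastPt ny)).2 s.2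
  rw [twistedOp_apply, dirOp_apply, dirOp_apply]
  simp only [singleScheme, hR, hU, hR', hU', Function.comp_apply, Function.uncurry, hcast' hnx,
    hcast' hny, sub_add_eq_add_sub]
  generalize coupledRow cx rx (fun K i' => V K B (i', s.2)) A = xrow at hxr hxl ⊢
  generalize coupledRow cy ry (fun K j' => V A K (s.1, j')) B = yrow at hyr hyl ⊢
  rw [hxr, hxl, hyr, hyl]

end Schemes

theorem mainTheorem4 (px py : ℕ) [NeZero px] [NeZero py] (κx κy : ZMod px → ZMod py → ℝ)
    (hκx : ∀ k l, 0 < κx k l) (hκy : ∀ k l, 0 < κy k l) :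
    (∀ dx dy : ℝ, 0 < dx → 0 < dy →
      IsHomogenisation κx κy dx dy (homRate κx κy dx dy)) ∧
    (∀ (nx ny : ℕ) [NeZero nx] [NeZero ny] (cx cy : Coupling),
      IsConsistent κx κy nx ny cx cy (ensembleScheme κx κy nx ny cx cy)) ∧
    (∀ (nx ny : ℕ) [NeZero nx] [NeZero ny] (cx cy : Coupling), px ∣ nx → py ∣ ny →
      ∀ (φ : ZMod px) (ψ : ZMod py),
        IsConsistent κx κy nx ny cx cy (singleScheme κx κy φ ψ nx ny cx cy)) :=
  ⟨fun _ _ hdx hdy => isHomogenisation_homRate hκx hκy hdx hdy,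
    fun _ _ _ _ cx cy => isConsistent_ensembleScheme hκx hκy cx cy,
    fun _ _ _ _ cx cy hnx hny φ ψ => isConsistent_singleScheme hκx hκy cx cy hnx hny φ ψ⟩
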